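/- **Setting.** Let $U\subset\mathbb R^d$ be a bounded simply connected domain and let $$C_X(x,y)=\log\frac1{|x-y|}+g(x,y)\quad (x,y\in U),\qquad C_X=0 \text{ off } U\times U,$$ where $g\in L^1(U\times U)\cap C(U\times U)$ is bounded from above and $C_X$ is symmetric and positive semi-definite, i.e. $\iint C_X(x,y)f(x)\overline{f(y)}\,dx\,dy\ge 0$ for all $f\in C_c^\infty(\mathbb R^d)$. Let $X$ be a log-correlated field with this covariance, i.e. a real random tempered distribution such that the variables $X(f)$, $f\in\mathcal S(\mathbb R^d)$, are jointly Gaussian and centred with $\mathbb E\,X(f)X(h)=\iint C_X(x,y)f(x)h(y)\,dx\,dy$. A sequence $(X_n)_{n\ge1}$ of almost surely continuous, jointly Gaussian, centred fields on $U$ (on some probability space) is a *standard approximation* of $X$ if 1. $\mathbb E\,X_m(x)X_n(y)\to C_X(x,y)$ as $(m,n)\to\infty$, in Lebesgue measure on $U\times U$; 2. there are $c_1\ge c_2\ge\dots>0$ with $c_n\to0$ such that $\sup_{n}\sup_{x,y\in K}\bigl|\mathbb E\,X_n(x)X_n(y)-\log\frac1{\max(c_n,|x-y|)}\bigr|<\infty$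 for every compact $K\subset U$; 3. $\sup_{n}\sup_{x,y\in U,\,x\ne y}\bigl[\mathbb E\,X_n(x)X_n(y)-\log\frac1{|x-y|}\bigr]<\infty$. For $s\in\mathbb R$, $H^s(\mathbb R^d)$ is the space of tempered distributions $u$ with $\|u\|_{H^s}^2=\int(1+|\xi|^2)^s|\widehat u(\xi)|^2d\xi<\infty$. **Theorem.** Let $0<\beta<\sqrt d$ and let $(X_n)$ be a standard approximation of $X$. Put $$\mu_n(x)=e^{i\beta X_n(x)+\frac{\beta^2}{2}\mathbb E[X_n(x)^2]}\quad(x\in U),\qquad \mu_n=0\text{ outside }U,$$ and assume that these functions are integrable, i.e. $\int_U e^{\frac{\beta^2}{2}\mathbb E[X_n(x)^2]}dx<\infty$ for every $n$. Then there is a random tempered distribution $\mu$, on the probability space of the $X_n$, such that for every $s<-\frac d2$ the functions $\mu_n$ are random elements of $H^s(\mathbb R^d)$, $\mu$ is a random element of $H^s(\mathbb R^d)$, and $\mu_n\to\mu$ in probability in $H^s(\mathbb R^d)$. The limit $\mu$ is non-trivial (it is not almost surely equal to any fixed tempered distribution, in particular not almost surely zero), and almost surely $\mu$ is supported on $\overline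 U$. Moreover, let $(\widetilde X_n)$ be another standard approximation of $X$, on the same probability space, for which the corresponding functions $\widetilde\mu_n$ are also integrable, and suppose that $$\lim_{n\to\infty}\mathbb E\,X_n(x)\widetilde X_n(y)=C_X(x,y)\quad\text{in Lebesgue measure on }U\times U.$$ Then the corresponding limits $\mu$ and $\widetilde\mu$ (in $H^s(\mathbb R^d)$ and in $H^{s'}(\mathbb R^d)$ for any $s,s'<-\frac d2$) are equal almost surely. -/

import Mathlib

open MeasureTheory ProbabilityTheory Filter Topology
open scoped SchwartzMap FourierTransform ENNReal ComplexConjugate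

noncomputable section

namespace ImaginaryChaos

/-- The space `ℝᵈ` with its Euclidean norm. -/
abbrev Space (d : ℕ) := EuclideanSpace ℝ (Fin d)

variable {d : ℕ}

/-! ### Covariances and log-correlated fields -/

/-- The kernel `C_X(x, y) = log (1 / |x - y|) + g(x, y)` on `U × U`, extended by zero to
`ℝᵈ × ℝᵈ`.  (Its value on the diagonal, a null set, plays no role.) -/
def logKernel (U : Set (Space d)) (g : Space d → Space d → ℝ) (x y : Space d) : ℝ :=
  (U ×ˢ U).indicator (fun z => Real.log (1 / ‖z.1 - z.2‖) + g z.1 z.2) (x, y)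

/-- The standing assumptions: `U` is a bounded simply connected domain, `g ∈ L¹(U × U) ∩ C(U × U)`
is bounded from above, and `C_X = log (1 / |x - y|) + g` is a covariance kernel, that is, symmetric
and positive semi-definite. -/
structure IsLogCovariance (U : Set (Space d)) (g : Space d → Space d → ℝ) : Prop where
  isOpen : IsOpen U
  isSimplyConnected : IsSimplyConnected U
  isBounded : Bornology.IsBounded U
  integrableOn : IntegrableOn (fun z : Space d × Space d => g z.1 z.2) (U ×ˢ U)
  continuousOn : ContinuousOn (fun z : Space d × Space d => g z.1 z.2) (U ×ˢ U)
  bddAbove : ∃ B : ℝ, ∀ x ∈ U, ∀ y ∈ U, g x y ≤ B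
  symm : ∀ x y, logKernel U g x y = logKernel U g y x
  posSemidef : ∀ f : Space d → ℂ, ContDiff ℝ (⊤ : ℕ∞) f → HasCompactSupport f →
    0 ≤ (∫ z : Space d × Space d, (logKernel U g z.1 z.2 : ℂ) * f z.1 * conj (f z.2)).re

/-- `X`, a random real tempered distribution, is a centred Gaussian field with covariance
kernel `C`: the variables `X(f)` are jointly Gaussian and centred, with
`E X(f) X(h) = ∫∫ C(x, y) f(x) h(y) dx dy`. -/
structure IsGaussianField {Ω : Type*} [MeasurableSpace Ω] (P : Measure Ω)
    (C : Space d → Space d → ℝ) (X : Ω → (𝓢(Space d, ℝ) →L[ℝ] ℝ)) : Prop where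
  gaussian : IsGaussianProcess (fun (f : 𝓢(Space d, ℝ)) ω => X ω f) P
  centered : ∀ f : 𝓢(Space d, ℝ), ∫ ω, X ω f ∂P = 0
  covariance : ∀ f h : 𝓢(Space d, ℝ), ∫ ω, X ω f * X ω h ∂P =
    ∫ z : Space d × Space d, C z.1 z.2 * f z.1 * h z.2

/-- `(Xₙ)` is a standard approximation, on the domain `U`, of a field with covariance kernel `C`.
Only the values of the `Xₙ` on `U` matter. -/
structure IsStandardApproximation {Ω : Type*} [MeasurableSpace Ω] (P : Measure Ω)
    (U : Set (Space d)) (C : Space d → Space d → ℝ) (X : ℕ → Space d → Ω → ℝ) : Prop where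
  continuous : ∀ n, ∀ᵐ ω ∂P, ContinuousOn (fun x => X n x ω) U
  gaussian : IsGaussianProcess (fun (p : ℕ × U) ω => X p.1 (p.2 : Space d) ω) P
  centered : ∀ n, ∀ x ∈ U, ∫ ω, X n x ω ∂P = 0
  tendsto_covariance : TendstoInMeasure (volume.restrict (U ×ˢ U))
    (fun (p : ℕ × ℕ) (z : Space d × Space d) => ∫ ω, X p.1 z.1 ω * X p.2 z.2 ω ∂P)
    atTop (fun z => C z.1 z.2)
  local_bound : ∃ c : ℕ → ℝ, Antitone c ∧ (∀ n, 0 < c n) ∧ Tendsto c atTop (𝓝 0) ∧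
    ∀ K ⊆ U, IsCompact K → ∃ B : ℝ, ∀ n, ∀ x ∈ K, ∀ y ∈ K,
      |∫ ω, X n x ω * X n y ω ∂P - Real.log (1 / max (c n) ‖x - y‖)| ≤ B
  /-- The bound is void on the diagonal, where `log (1 / |x - y|) = +∞`. -/
  upper_bound : ∃ B : ℝ, ∀ n, ∀ x ∈ U, ∀ y ∈ U, x ≠ y →
    ∫ ω, X n x ω * X n y ω ∂P - Real.log (1 / ‖x - y‖) ≤ B

/-! ### The approximating functions as tempered distributions -/

open Classical in
/-- The tempered distribution `φ ↦ ∫ φ(x) f(x) dx` given by an integrable function `f`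
(and zero if `f` is not integrable). -/
def ofFunction (f : Space d → ℂ) : 𝓢'(Space d, ℂ) :=
  if h : MemLp f 1 volume then (h.toLp f : 𝓢'(Space d, ℂ)) else 0

lemma ofFunction_apply {f : Space d → ℂ} (hf : Integrable f) (φ : 𝓢(Space d, ℂ)) :
    ofFunction f φ = ∫ x, φ x * f x := by
  have h : MemLp f 1 volume := memLp_one_iff_integrable.2 hf
  rw [ofFunction, dif_pos h, Lp.toTemperedDistribution_apply]
  refine integral_congr_ae ?_
  filter_upwards [h.coeFn_toLp] with x hx
  rw [hx, smul_eq_mul]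

/-- The function `μₙ(x) = exp (i β Xₙ(x) + β² / 2 E[Xₙ(x)²])`, understood as zero outside `U`. -/
def chaosFunction {Ω : Type*} [MeasurableSpace Ω] (P : Measure Ω) (U : Set (Space d)) (β : ℝ)
    (X : ℕ → Space d → Ω → ℝ) (n : ℕ) (ω : Ω) : Space d → ℂ :=
  U.indicator fun x =>
    Complex.exp (Complex.I * (β * X n x ω : ℝ) + (β ^ 2 / 2 * ∫ ω', X n x ω' ^ 2 ∂P : ℝ))

/-- The function `μₙ` as a random tempered distribution. -/
def chaosApprox {Ω : Type*} [MeasurableSpace Ω] (P : Measure Ω) (U : Set (Space d)) (β : ℝ)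
    (X : ℕ → Space d → Ω → ℝ) (n : ℕ) (ω : Ω) : 𝓢'(Space d, ℂ) :=
  ofFunction (chaosFunction P U β X n ω)

/-! ### Sobolev spaces -/

/-- `(1 + |ξ|²)^{s/2} û(ξ)`, as a tempered distribution. -/
def weightedFourier (s : ℝ) (u : 𝓢'(Space d, ℂ)) : 𝓢'(Space d, ℂ) :=
  TemperedDistribution.smulLeftCLM ℂ
    (fun ξ : Space d => (((1 + ‖ξ‖ ^ 2) ^ (s / 2) : ℝ) : ℂ)) (𝓕 u)

/-- The norm `‖u‖_{H^s} = ‖(1 + |ξ|²)^{s/2} û‖_{L²}`, with value `∞` if `u ∉ H^s(ℝᵈ)`. -/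
def sobolevENorm (s : ℝ) (u : 𝓢'(Space d, ℂ)) : ℝ≥0∞ :=
  ⨅ (v : Lp ℂ 2 (volume : Measure (Space d))) (_ : weightedFourier s u = v), ‖v‖ₑ

/-- Finiteness of the norm is membership in Mathlib's Sobolev space. -/
lemma sobolevENorm_lt_top_iff {s : ℝ} {u : 𝓢'(Space d, ℂ)} :
    sobolevENorm s u < ∞ ↔ TemperedDistribution.MemSobolev s 2 u := by
  rw [TemperedDistribution.memSobolev_iff_exists_smulLeftCLM_fourier, sobolevENorm]
  simp only [iInf_lt_iff]
  exact ⟨fun ⟨v, hv, _⟩ => ⟨v, hv⟩, fun ⟨v, hv⟩ => ⟨v, hv, enorm_lt_top⟩⟩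

lemma sobolevENorm_eq {s : ℝ} {u : 𝓢'(Space d, ℂ)} {v : Lp ℂ 2 (volume : Measure (Space d))}
    (h : weightedFourier s u = v) : sobolevENorm s u = ‖v‖ₑ := by
  refine le_antisymm (iInf₂_le v h) (le_iInf₂ fun w hw => ?_)
  have hker := Lp.ker_toTemperedDistributionCLM_eq_bot (F := ℂ) (p := 2)
    (μ := (volume : Measure (Space d)))
  have : v = w := LinearMap.ker_eq_bot.1 hker (by simpa using h.symm.trans hw)
  rw [this]

/-- `μ` is a random element of `H^s(ℝᵈ)`, up to a null set: it takes values in `H^s(ℝᵈ)` and is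
Borel measurable there, the space being identified with `L²(ℝᵈ)` by the isometric isomorphism
`u ↦ (1 + |ξ|²)^{s/2} û`. -/
def IsSobolevRandomElement {Ω : Type*} [MeasurableSpace Ω] (P : Measure Ω) (s : ℝ)
    (μ : Ω → 𝓢'(Space d, ℂ)) : Prop :=
  ∃ F : Ω → Lp ℂ 2 (volume : Measure (Space d)), AEStronglyMeasurable F P ∧
    ∀ᵐ ω ∂P, weightedFourier s (μ ω) = F ω

/-- The random elements `μₙ` of `H^s(ℝᵈ)` converge in probability in `H^s(ℝᵈ)` to `μ`. -/
structure ConvergesInProbability {Ω : Type*} [MeasurableSpace Ω] (P : Measure Ω) (s : ℝ)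
    (μn : ℕ → Ω → 𝓢'(Space d, ℂ)) (μ : Ω → 𝓢'(Space d, ℂ)) : Prop where
  approx : ∀ n, IsSobolevRandomElement P s (μn n)
  limit : IsSobolevRandomElement P s μ
  tendsto : ∀ ε : ℝ≥0∞, 0 < ε →
    Tendsto (fun n => P {ω | ε ≤ sobolevENorm s (μn n ω - μ ω)}) atTop (𝓝 0)

end ImaginaryChaos

end

/-!
# Convergence of imaginary multiplicative chaos

The fields `Xₙ` are regarded as functions `x ↦ Xₙ(x)` with values in a Gaussian Hilbert space in
`L²(P)`, and `μₙ(x)` as the Wick exponential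
`wickExp β (Xₙ(x)) = exp (i β Xₙ(x) + β² ‖Xₙ(x)‖² / 2)`. For jointly Gaussian `h, h'` one has
`⟪wickExp β h, wickExp β h'⟫ = exp (β² ⟪h, h'⟫)`
(`inner_wickExp`), so the second moment of `∫ f μₙ` is an integral of `exp (β² E[Xₙ(x) Xₙ(y)])`.
The upper bound on the covariances dominates these kernels by `|x - y| ^ (-β²)`, which is
integrable because `β² < d`.

*Convergence.* Let `A`, `B` be Gaussian fields whose covariances and mixed covariances tend to `C`
in measure, with the exponential moments `∬ exp (β² C_A)`, `∬ exp (β² C_B)` asymptotically at most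
`∬ exp (β² C)`. By Cauchy–Schwarz the mixed exponential moment obeys the same bound, so Scheffé's
lemma gives `L¹` convergence of all kernels and `∫ f (wickExp A - wickExp B) → 0` in `L²(P)`,
uniformly over `|f| ≤ 1` (`exists_tendsto_norm_integral_smul_sub_sq_le`). With `A = Xₘ`, `B = Xₙ`
and `f` a character this makes `(1 + |ξ|²) ^ (s / 2) 𝓕 μₙ(ξ)` a Cauchy sequence in `L²(P × ℝᵈ)`,
as `(1 + |ξ|²) ^ s` is integrable for `s < -d / 2`. Limits for different `s` agree because `L²`
convergence implies almost sure convergence of a subsequence as tempered distributions.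

*Non-triviality.* Tested against a bump function `φ`, the limit has variance
`∬ φ(x) φ(y) (exp (β² C(x, y)) - 1)`, which is positive as `C > 0` near the diagonal (`not_ae_eq_const`).

*Uniqueness.* Two approximations `Xₙ`, `X'ₙ` need not be jointly Gaussian, so their chaoses cannot
be compared by the formula for the inner product. Instead `Xₙ` is compared with its averages over
the cells of a fine finite partition, which lie in the same Gaussian space; Jensen's inequality
and Cauchy–Schwarz bound their exponential moments (`integral_exp_cellAverage_le`), so the general
comparison applies (`exists_tendsto_norm_cellAverage_sub_sq_le`). For a fixed partition only
finitely many random variables are involved, and the averages of `Xₙ` and `X'ₙ` approach each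
other in `L²(P)` once the mixed covariances converge in `L¹`, after which continuity of the Wick
exponential suffices (`tendsto_integral_norm_wickExp_cellAverage_sub`). Convergence in `L¹`
follows from convergence in measure and second moment bounds; that for the mixed kernels is
inherited from those of `Xₙ` and `X'ₙ` by `⟪a, b⟫² = ⟪a ⊗ a, b ⊗ b⟫` (`integral_inner_sq_le`).
-/

noncomputable section

namespace ImaginaryChaos

set_option linter.unusedSectionVars false

/-! ### Limits of integrals under convergence in measure -/

section InMeasure

variable {α ι : Type*} [MeasurableSpace α] {ν : Measure α} {l : Filter ι}

/-- Dominated convergence for functions `Φ(a, uᵢ(a))` where `uᵢ` converges in measure. -/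
theorem tendsto_integral_of_tendstoInMeasure [l.IsCountablyGenerated]
    {u : ι → α → ℝ} {c : α → ℝ} (huc : TendstoInMeasure ν u l c)
    {Φ : α → ℝ → ℝ} (hΦ : ∀ a, Continuous (Φ a)) {bound : α → ℝ} (hb : Integrable bound ν)
    (hbd : ∀ i, ∀ᵐ a ∂ν, |Φ a (u i a)| ≤ bound a)
    (hmeas : ∀ i, AEStronglyMeasurable (fun a => Φ a (u i a)) ν) :
    Tendsto (fun i => ∫ a, Φ a (u i a) ∂ν) l (𝓝 (∫ a, Φ a (c a) ∂ν)) := by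
  refine tendsto_of_subseq_tendsto fun ns hns => ?_
  obtain ⟨ms, -, hms⟩ := (huc.comp hns).exists_seq_tendsto_ae
  refine ⟨ms, tendsto_integral_of_dominated_convergence bound (fun n => hmeas _) hb
    (fun n => hbd _) ?_⟩
  filter_upwards [hms] with a ha
  exact ((hΦ a).tendsto _).comp ha

/-- Scheffé's lemma under convergence in measure: non-negative functions whose integrals are
asymptotically at most that of the limit converge in `L¹`. -/
theorem tendsto_integral_abs_sub_of_integral_le [l.IsCountablyGenerated]
    {u : ι → α → ℝ} {c : α → ℝ} (huc : TendstoInMeasure ν u l c)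
    {ψ : ℝ → ℝ} (hψ : Continuous ψ) (hψ0 : ∀ t, 0 ≤ ψ t)
    (hc : Integrable (fun a => ψ (c a)) ν) (hu : ∀ i, Integrable (fun a => ψ (u i a)) ν)
    {b : ι → ℝ} (hle : ∀ i, ∫ a, ψ (u i a) ∂ν ≤ b i)
    (hb : Tendsto b l (𝓝 (∫ a, ψ (c a) ∂ν))) :
    Tendsto (fun i => ∫ a, |ψ (u i a) - ψ (c a)| ∂ν) l (𝓝 0) := by
  have hpos : ∀ i, Integrable (fun a => max (ψ (c a) - ψ (u i a)) 0) ν := fun i =>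
    (hc.sub (hu i)).pos_part
  have h1 : Tendsto (fun i => ∫ a, max (ψ (c a) - ψ (u i a)) 0 ∂ν) l (𝓝 0) := by
    have := tendsto_integral_of_tendstoInMeasure huc
      (Φ := fun a t => max (ψ (c a) - ψ t) 0) (fun a => by fun_prop) hc
      (fun i => .of_forall fun a => by
        rw [abs_of_nonneg (le_max_right _ _)]
        exact max_le (by linarith [hψ0 (u i a)]) (hψ0 _))
      (fun i => (hpos i).aestronglyMeasurable)
    simpa using this
  have h2 : Tendsto (fun i => b i - ∫ a, ψ (c a) ∂ν + 2 * ∫ a, max (ψ (c a) - ψ (u i a)) 0 ∂ν) l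
      (𝓝 0) := by
    simpa using (hb.sub_const (∫ a, ψ (c a) ∂ν)).add (h1.const_mul 2)
  refine squeeze_zero (fun i => integral_nonneg fun a => abs_nonneg _) (fun i => ?_) h2
  -- `|s - t| = s - t + 2 (t - s)⁺`, and the positive part `(t - s)⁺` is dominated by `t`.
  have h3 : ∫ a, |ψ (u i a) - ψ (c a)| ∂ν = ∫ a, ψ (u i a) ∂ν - ∫ a, ψ (c a) ∂ν
      + 2 * ∫ a, max (ψ (c a) - ψ (u i a)) 0 ∂ν := by
    rw [← integral_sub (hu i) hc, ← integral_const_mul,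
      ← integral_add (f := fun a => ψ (u i a) - ψ (c a)) ((hu i).sub hc) ((hpos i).const_mul 2)]
    refine integral_congr_ae (.of_forall fun a => ?_)
    dsimp only
    rcases le_total (ψ (c a)) (ψ (u i a)) with h | h
    · rw [abs_of_nonneg (by linarith), max_eq_right (by linarith)]; ring
    · rw [abs_of_nonpos (by linarith), max_eq_left (by linarith)]; ring
  linarith [hle i]

/-- On a finite measure space, convergence in measure and a uniform second moment bound give
convergence in `L¹`. -/
theorem tendsto_integral_abs_sub_of_integral_sq_le [IsFiniteMeasure ν] [l.IsCountablyGenerated]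
    [l.NeBot] {u : ι → α → ℝ} {c : α → ℝ} (huc : TendstoInMeasure ν u l c)
    (hu : ∀ i, MemLp (u i) 2 ν) {M : ℝ} (hM : ∀ i, ∫ a, u i a ^ 2 ∂ν ≤ M) :
    MemLp c 2 ν ∧ Tendsto (fun i => ∫ a, |u i a - c a| ∂ν) l (𝓝 0) := by
  have hM0 : 0 ≤ M := by
    obtain ⟨i⟩ := l.nonempty_of_neBot
    exact (integral_nonneg fun a => sq_nonneg _).trans (hM i)
  have hn : ∀ i, eLpNorm (u i) 2 ν ≤ ENNReal.ofReal (M ^ (2⁻¹ : ℝ)) := fun i => by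
    rw [(hu i).eLpNorm_eq_integral_rpow_norm two_ne_zero ENNReal.ofNat_ne_top]
    refine ENNReal.ofReal_le_ofReal ?_
    simp only [ENNReal.toReal_ofNat, Real.rpow_ofNat, Real.norm_eq_abs, sq_abs]
    exact Real.rpow_le_rpow (integral_nonneg fun a => sq_nonneg _) (hM i) (by norm_num)
  have hc2 := eLpNorm_le_of_tendstoInMeasure (.of_forall hn) huc
    fun i => (hu i).aestronglyMeasurable
  have hc : MemLp c 2 ν :=
    ⟨huc.aestronglyMeasurable fun i => (hu i).aestronglyMeasurable,
      hc2.trans_lt ENNReal.ofReal_lt_top⟩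
  refine ⟨hc, ?_⟩
  have hsq : ∀ {w : α → ℝ}, MemLp w 2 ν → Integrable (fun a => w a ^ 2) ν := fun hw =>
    hw.integrable_sq
  set M' := 2 * M + 2 * ∫ a, c a ^ 2 ∂ν
  have hM'0 : 0 ≤ M' := by
    have : 0 ≤ ∫ a, c a ^ 2 ∂ν := integral_nonneg fun a => sq_nonneg (c a)
    positivity
  have hd : ∀ i, Integrable (fun a => |u i a - c a|) ν := fun i =>
    (((hu i).sub hc).integrable one_le_two).abs
  rw [Metric.tendsto_nhds]
  intro ε hε
  -- Truncate at level `R`; beyond it, `|u - c| ≤ (u - c)² / R`, whose integral is below `ε / 2`.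
  set R := 2 * (M' + 1) / ε with hR
  have hR0 : 0 < R := by positivity
  have hmin : ∀ i, Integrable (fun a => min |u i a - c a| R) ν := fun i =>
    (hd i).inf (integrable_const R)
  have h1 : Tendsto (fun i => ∫ a, min |u i a - c a| R ∂ν) l (𝓝 0) := by
    have := tendsto_integral_of_tendstoInMeasure huc
      (Φ := fun a t => min |t - c a| R) (fun a => by fun_prop) (integrable_const R)
      (fun i => .of_forall fun a => by
        rw [abs_of_nonneg (le_min (abs_nonneg _) hR0.le)]
        exact min_le_right _ _)
      (fun i => (hmin i).aestronglyMeasurable)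
    simpa [hR0.le] using this
  have h2 := (Metric.tendsto_nhds.1 h1) (ε / 2) (by positivity)
  filter_upwards [h2] with i hi
  have hq : Integrable (fun a => (u i a - c a) ^ 2) ν := hsq ((hu i).sub hc)
  have h3 : ∫ a, |u i a - c a| ∂ν ≤ ∫ a, min |u i a - c a| R ∂ν
      + R⁻¹ * ∫ a, (u i a - c a) ^ 2 ∂ν := by
    rw [← integral_const_mul, ← integral_add (hmin i) (hq.const_mul _)]
    refine integral_mono (hd i) ((hmin i).add (hq.const_mul _)) fun a => ?_
    dsimp only
    rcases le_total |u i a - c a| R with h | h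
    · rw [min_eq_left h]
      have : 0 ≤ R⁻¹ * (u i a - c a) ^ 2 := by positivity
      linarith
    · rw [min_eq_right h, ← sq_abs, ← div_eq_inv_mul]
      have : |u i a - c a| ≤ |u i a - c a| ^ 2 / R := by
        rw [le_div_iff₀ hR0, sq]
        exact mul_le_mul_of_nonneg_left h (abs_nonneg _)
      linarith
  have h4 : ∫ a, (u i a - c a) ^ 2 ∂ν ≤ M' := by
    calc ∫ a, (u i a - c a) ^ 2 ∂ν ≤ ∫ a, (2 * u i a ^ 2 + 2 * c a ^ 2) ∂ν := by
          refine integral_mono hq (((hsq (hu i)).const_mul 2).add ((hsq hc).const_mul 2))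
            fun a => ?_
          dsimp only
          nlinarith [sq_nonneg (u i a + c a)]
      _ = 2 * ∫ a, u i a ^ 2 ∂ν + 2 * ∫ a, c a ^ 2 ∂ν := by
          rw [integral_add ((hsq (hu i)).const_mul 2) ((hsq hc).const_mul 2), integral_const_mul,
            integral_const_mul]
      _ ≤ M' := by linarith [hM i]
  have h5 : R⁻¹ * M' < ε / 2 := by
    rw [hR, inv_div, div_mul_eq_mul_div, div_lt_iff₀ (by positivity)]
    nlinarith
  have h6 : R⁻¹ * ∫ a, (u i a - c a) ^ 2 ∂ν ≤ R⁻¹ * M' :=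
    mul_le_mul_of_nonneg_left h4 (by positivity)
  rw [Real.dist_eq, sub_zero, abs_of_nonneg (integral_nonneg fun a => le_min (abs_nonneg _) hR0.le)]
    at hi
  rw [Real.dist_eq, sub_zero, abs_of_nonneg (integral_nonneg fun a => abs_nonneg _)]
  linarith

end InMeasure

/-! ### Wick exponentials in `L²` -/

section Wick

variable {Ω : Type*} [MeasurableSpace Ω] {P : Measure Ω} [IsProbabilityMeasure P]

lemma norm_exp_mul_I (t : ℝ) : ‖Complex.exp (t * Complex.I)‖ = 1 :=
  Complex.norm_exp_ofReal_mul_I t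

lemma memLp_phase (β : ℝ) (h : Lp ℝ 2 P) :
    MemLp (fun ω => Complex.exp ((β * h ω : ℝ) * Complex.I)) 2 P := by
  refine MemLp.of_bound ?_ 1 (.of_forall fun ω => (norm_exp_mul_I _).le)
  have := (Lp.aestronglyMeasurable h).aemeasurable
  exact AEMeasurable.aestronglyMeasurable (by fun_prop)

/-- The random variable `exp (i β h)` as an element of `L²(P)`. -/
def phase (β : ℝ) (h : Lp ℝ 2 P) : Lp ℂ 2 P := (memLp_phase β h).toLp _

lemma coeFn_phase (β : ℝ) (h : Lp ℝ 2 P) :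
    phase β h =ᵐ[P] fun ω => Complex.exp ((β * h ω : ℝ) * Complex.I) :=
  MemLp.coeFn_toLp _

lemma lipschitzWith_phase (β : ℝ) :
    LipschitzWith ‖β‖₊ (phase β : Lp ℝ 2 P → Lp ℂ 2 P) := by
  refine LipschitzWith.of_dist_le_mul fun h h' => ?_
  rw [dist_eq_norm, dist_eq_norm, coe_nnnorm]
  refine Lp.norm_le_mul_norm_of_ae_le_mul ?_
  filter_upwards [coeFn_phase β h, coeFn_phase β h', Lp.coeFn_sub h h',
    Lp.coeFn_sub (phase β h) (phase β h')] with ω h1 h2 h3 h4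
  rw [h4, h3, Pi.sub_apply, Pi.sub_apply, h1, h2, ← norm_mul, mul_sub]
  set a := β * h ω
  set b := β * h' ω
  have h5 : Complex.exp (a * Complex.I) - Complex.exp (b * Complex.I)
      = Complex.exp (b * Complex.I) * (Complex.exp (Complex.I * (a - b : ℝ)) - 1) := by
    rw [mul_sub, ← Complex.exp_add, mul_one]
    push_cast
    ring_nf
  rw [h5, norm_mul, norm_exp_mul_I, one_mul]
  exact Real.norm_exp_I_mul_ofReal_sub_one_le

lemma continuous_phase (β : ℝ) : Continuous (phase β : Lp ℝ 2 P → Lp ℂ 2 P) :=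
  (lipschitzWith_phase β).continuous

lemma norm_phase (β : ℝ) (h : Lp ℝ 2 P) : ‖phase β h‖ = 1 := by
  rw [phase, Lp.norm_toLp]
  have : eLpNorm (fun ω => Complex.exp ((β * h ω : ℝ) * Complex.I)) 2 P
      = eLpNorm (fun _ => (1 : ℂ)) 2 P :=
    eLpNorm_congr_norm_ae (.of_forall fun ω => by rw [norm_exp_mul_I, norm_one])
  rw [this, eLpNorm_const _ two_ne_zero (NeZero.ne P)]
  simp

lemma inner_phase (β : ℝ) (h h' : Lp ℝ 2 P) :
    inner ℂ (phase β h) (phase β h') = ∫ ω, Complex.exp ((β * (h' - h) ω : ℝ) * Complex.I) ∂P := by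
  rw [L2.inner_def]
  refine integral_congr_ae ?_
  filter_upwards [coeFn_phase β h, coeFn_phase β h', Lp.coeFn_sub h' h] with ω h1 h2 h3
  rw [h1, h2, h3, RCLike.inner_apply, ← Complex.exp_conj, ← Complex.exp_add]
  simp only [Pi.sub_apply, map_mul, Complex.conj_ofReal, Complex.conj_I]
  push_cast
  ring_nf

/-- The elements of `L²(P)` whose characteristic function at `β` is that of a centred Gaussian
variable. -/
def gaussianAt (β : ℝ) (P : Measure Ω) : Set (Lp ℝ 2 P) :=
  {h | ∫ ω, Complex.exp ((β * h ω : ℝ) * Complex.I) ∂P = (Real.exp (-(β ^ 2 / 2 * ‖h‖ ^ 2)) : ℂ)}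

lemma isClosed_gaussianAt (β : ℝ) : IsClosed (gaussianAt β P) := by
  have h : ∀ h : Lp ℝ 2 P, ∫ ω, Complex.exp ((β * h ω : ℝ) * Complex.I) ∂P
      = inner ℂ (phase β 0) (phase β h) := fun h => by rw [inner_phase, sub_zero]
  have hc := continuous_phase (P := P) β
  simp only [gaussianAt, h]
  exact isClosed_eq (by fun_prop) (by fun_prop)

/-- The Wick exponential `exp (i β h + β² ‖h‖² / 2)`. -/
def wickExp (β : ℝ) (h : Lp ℝ 2 P) : Lp ℂ 2 P := (Real.exp (β ^ 2 / 2 * ‖h‖ ^ 2) : ℂ) • phase β h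

lemma continuous_wickExp (β : ℝ) : Continuous (wickExp β : Lp ℝ 2 P → Lp ℂ 2 P) := by
  have := continuous_phase (P := P) β
  unfold wickExp
  fun_prop

/-- Wick exponentials of close vectors of nearly the same norm are close. -/
lemma tendsto_norm_wickExp_sub (β : ℝ) {ι : Type*} {l : Filter ι} {h h' : ι → Lp ℝ 2 P} {ρ : ℝ}
    (hh : Tendsto (fun i => ‖h i‖ ^ 2) l (𝓝 ρ)) (hh' : Tendsto (fun i => ‖h' i‖ ^ 2) l (𝓝 ρ))
    (hsub : Tendsto (fun i => ‖h i - h' i‖) l (𝓝 0)) :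
    Tendsto (fun i => ‖wickExp β (h i) - wickExp β (h' i)‖) l (𝓝 0) := by
  set e : Lp ℝ 2 P → ℝ := fun v => Real.exp (β ^ 2 / 2 * ‖v‖ ^ 2) with he
  have hexp : Continuous fun t : ℝ => Real.exp (β ^ 2 / 2 * t) := by fun_prop
  have h1 : Tendsto (fun i => e (h i)) l (𝓝 (Real.exp (β ^ 2 / 2 * ρ))) :=
    (hexp.tendsto _).comp hh
  have h2 : Tendsto (fun i => e (h' i)) l (𝓝 (Real.exp (β ^ 2 / 2 * ρ))) :=
    (hexp.tendsto _).comp hh'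
  have h3 : Tendsto (fun i => e (h i) * (‖β‖ * ‖h i - h' i‖) + |e (h i) - e (h' i)|) l (𝓝 0) := by
    simpa using (h1.mul (hsub.const_mul ‖β‖)).add (h1.sub h2).abs
  refine squeeze_zero (fun _ => norm_nonneg _) (fun i => ?_) h3
  have h4 : wickExp β (h i) - wickExp β (h' i)
      = (e (h i) : ℂ) • (phase β (h i) - phase β (h' i))
        + ((e (h i) - e (h' i) : ℝ) : ℂ) • phase β (h' i) := by
    simp only [wickExp, he]
    push_cast
    module
  rw [h4]
  refine (norm_add_le _ _).trans (add_le_add ?_ ?_)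
  · rw [norm_smul, Complex.norm_real, Real.norm_eq_abs, Real.abs_exp]
    exact mul_le_mul_of_nonneg_left ((lipschitzWith_phase β).norm_sub_le _ _) (Real.exp_pos _).le
  · rw [norm_smul, Complex.norm_real, norm_phase, mul_one, Real.norm_eq_abs]

lemma norm_wickExp (β : ℝ) (h : Lp ℝ 2 P) : ‖wickExp β h‖ = Real.exp (β ^ 2 / 2 * ‖h‖ ^ 2) := by
  rw [wickExp, norm_smul, norm_phase, mul_one, Complex.norm_real, Real.norm_eq_abs, Real.abs_exp]

lemma coeFn_wickExp (β : ℝ) (h : Lp ℝ 2 P) : wickExp β h =ᵐ[P] fun ω =>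
    Complex.exp (Complex.I * (β * h ω : ℝ) + (β ^ 2 / 2 * ‖h‖ ^ 2 : ℝ)) := by
  filter_upwards [coeFn_phase β h, Lp.coeFn_smul (Real.exp (β ^ 2 / 2 * ‖h‖ ^ 2) : ℂ) (phase β h)]
    with ω h1 h2
  rw [wickExp, h2, Pi.smul_apply, h1, smul_eq_mul, Complex.ofReal_exp, ← Complex.exp_add]
  ring_nf

/-- The covariance of Wick exponentials. -/
lemma inner_wickExp {β : ℝ} {h h' : Lp ℝ 2 P} (hh : h' - h ∈ gaussianAt β P) :
    inner ℂ (wickExp β h) (wickExp β h') = (Real.exp (β ^ 2 * inner ℝ h h') : ℂ) := by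
  rw [wickExp, wickExp, inner_smul_left, inner_smul_right, inner_phase, hh, Complex.conj_ofReal,
    ← Complex.ofReal_mul, ← Complex.ofReal_mul, ← Real.exp_add, ← Real.exp_add, norm_sub_sq_real,
    real_inner_comm h']
  ring_nf

variable {T : Type*} {Y : T → Ω → ℝ}

/-- The closed linear span of a centred Gaussian process consists of Gaussian variables. -/
lemma closure_span_subset_gaussianAt (hY : IsGaussianProcess Y P) (h0 : ∀ t, ∫ ω, Y t ω ∂P = 0)
    {y : T → Lp ℝ 2 P} (hy : ∀ t, y t =ᵐ[P] Y t) (β : ℝ) :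
    ((Submodule.span ℝ (Set.range y)).topologicalClosure : Set (Lp ℝ 2 P)) ⊆ gaussianAt β P := by
  rw [Submodule.topologicalClosure_coe]
  refine closure_minimal (fun h hh => ?_) (isClosed_gaussianAt β)
  obtain ⟨c, rfl⟩ := Finsupp.mem_span_range_iff_exists_finsupp.1 hh
  set Z : Ω → ℝ := fun ω => ∑ t ∈ c.support, c t * Y t ω with hZ
  have hlaw : HasGaussianLaw Z P := by
    simpa [smul_eq_mul] using (hY.smul (fun t => c t)).hasGaussianLaw_fun_sum (I := c.support)
  have hZy : (c.sum fun t a => a • y t : Lp ℝ 2 P) =ᵐ[P] Z := by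
    have h1 : ∀ᵐ ω ∂P, ∀ t ∈ c.support, (c t • y t : Lp ℝ 2 P) ω = c t * Y t ω := by
      rw [Filter.eventually_all_finset]
      intro t _
      filter_upwards [hy t, Lp.coeFn_smul (c t) (y t)] with ω h1 h2
      rw [h2, Pi.smul_apply, h1, smul_eq_mul]
    filter_upwards [h1, Lp.coeFn_finsetSum c.support (fun t => c t • y t)] with ω h1 h2
    rw [Finsupp.sum, h2, Finset.sum_apply]
    exact Finset.sum_congr rfl h1
  have hmean : ∫ ω, Z ω ∂P = 0 := by
    rw [hZ, integral_finsetSum _ fun t _ => ((hY.hasGaussianLaw_eval t).integrable.const_mul _)]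
    simp [integral_const_mul, h0]
  have hvar : Var[Z; P] = ‖(c.sum fun t a => a • y t : Lp ℝ 2 P)‖ ^ 2 := by
    rw [variance_of_integral_eq_zero hlaw.aemeasurable hmean, ← real_inner_self_eq_norm_sq,
      L2.inner_def]
    refine integral_congr_ae ?_
    filter_upwards [hZy] with ω hω
    rw [hω]
    simp [sq]
  have hchar := charFun_gaussianReal (μ := 0) (v := Var[Z; P].toNNReal) β
  rw [← hmean, ← hlaw.map_eq_gaussianReal, charFun_apply_real,
    integral_map hlaw.aemeasurable (by fun_prop), hmean] at hchar
  rw [gaussianAt, Set.mem_ofPred_eq, ← hvar]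
  have : ∫ ω, Complex.exp ((β * (c.sum fun t a => a • y t : Lp ℝ 2 P) ω : ℝ) * Complex.I) ∂P
      = ∫ ω, Complex.exp (β * Z ω * Complex.I) ∂P := by
    refine integral_congr_ae ?_
    filter_upwards [hZy] with ω hω
    rw [hω]
    push_cast
    rfl
  rw [this, hchar, Real.coe_toNNReal _ (variance_nonneg _ _), Complex.ofReal_exp]
  congr 1
  push_cast
  ring

end Wick

/-! ### Second moments of integrated fields -/

section Bochner

variable {E : Type*} [MeasurableSpace E] {lam : Measure E} [SFinite lam]
  {𝕜 V : Type*} [RCLike 𝕜] [NormedAddCommGroup V] [InnerProductSpace 𝕜 V]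

lemma aestronglyMeasurable_inner_prod {F G : E → V} (hF : AEStronglyMeasurable F lam)
    (hG : AEStronglyMeasurable G lam) :
    AEStronglyMeasurable (fun z : E × E => inner 𝕜 (F z.1) (G z.2)) (lam.prod lam) :=
  hF.comp_fst.inner hG.comp_snd

lemma integrable_inner_prod {F G : E → V} (hF : Integrable F lam) (hG : Integrable G lam) :
    Integrable (fun z : E × E => inner 𝕜 (F z.1) (G z.2)) (lam.prod lam) :=
  (hF.norm.mul_prod hG.norm).mono' (aestronglyMeasurable_inner_prod hF.1 hG.1)
    (.of_forall fun _ => norm_inner_le_norm _ _)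

lemma inner_integral_integral [CompleteSpace V] [NormedSpace ℝ V] {F G : E → V}
    (hF : Integrable F lam) (hG : Integrable G lam) :
    inner 𝕜 (∫ x, F x ∂lam) (∫ y, G y ∂lam)
      = ∫ z : E × E, inner 𝕜 (F z.1) (G z.2) ∂(lam.prod lam) := by
  rw [integral_prod_symm _ (integrable_inner_prod hF hG), ← integral_inner hG]
  refine integral_congr_ae (.of_forall fun y => ?_)
  dsimp only
  rw [← inner_conj_symm, ← integral_inner hF, ← integral_conj]
  simp

lemma norm_integral_smul_sq_le [CompleteSpace V] [NormedSpace ℝ V] {f : E → 𝕜}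
    (hf : AEStronglyMeasurable f lam) (hf1 : ∀ x, ‖f x‖ ≤ 1) {G : E → V} (hG : Integrable G lam) :
    ‖∫ x, f x • G x ∂lam‖ ^ 2
      ≤ ∫ z : E × E, ‖inner 𝕜 (G z.1) (G z.2)‖ ∂(lam.prod lam) := by
  have hfG : Integrable (fun x => f x • G x) lam := hG.bdd_smul 1 hf (.of_forall hf1)
  have h1 : ‖∫ x, f x • G x ∂lam‖ ^ 2
      = ‖inner 𝕜 (∫ x, f x • G x ∂lam) (∫ x, f x • G x ∂lam)‖ := by
    rw [inner_self_eq_norm_sq_to_K, norm_pow, RCLike.norm_ofReal, abs_norm]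
  rw [h1, inner_integral_integral hfG hfG]
  refine (norm_integral_le_integral_norm _).trans
    (integral_mono (integrable_inner_prod hfG hfG).norm (integrable_inner_prod hG hG).norm
      fun z => ?_)
  dsimp only
  rw [inner_smul_left, inner_smul_right, norm_mul, norm_mul, RCLike.norm_conj]
  have h2 := hf1 z.1
  have h3 := hf1 z.2
  have h4 := norm_nonneg (inner 𝕜 (G z.1) (G z.2))
  calc _ ≤ 1 * (1 * ‖inner 𝕜 (G z.1) (G z.2)‖) := by gcongr
    _ = _ := by ring

end Bochner

section WickField

variable {Ω : Type*} [MeasurableSpace Ω] {P : Measure Ω} [IsProbabilityMeasure P]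
  {E : Type*} [MeasurableSpace E] {lam : Measure E} [SFinite lam] {β : ℝ}
  {S : Submodule ℝ (Lp ℝ 2 P)} {A B : E → Lp ℝ 2 P}

/-- A field `A` on `E`, seen as a function with values in `L²(P)`, which takes values in the
subspace `S` and whose Wick exponential is Bochner integrable. -/
structure IsWickField (β : ℝ) (S : Submodule ℝ (Lp ℝ 2 P)) (lam : Measure E)
    (A : E → Lp ℝ 2 P) : Prop where
  mem : ∀ᵐ x ∂lam, A x ∈ S
  aestronglyMeasurable : AEStronglyMeasurable A lam
  integrable : Integrable (fun x => wickExp β (A x)) lam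

/-- The covariance `E[A(x) B(y)]` at `z = (x, y)`. -/
def crossCov (A B : E → Lp ℝ 2 P) (z : E × E) : ℝ := inner ℝ (A z.1) (B z.2)

lemma aestronglyMeasurable_crossCov (hA : AEStronglyMeasurable A lam)
    (hB : AEStronglyMeasurable B lam) :
    AEStronglyMeasurable (crossCov A B) (lam.prod lam) :=
  aestronglyMeasurable_inner_prod hA hB

namespace IsWickField

lemma neg (hA : IsWickField β S lam A) : IsWickField β S lam (fun x => -A x) where
  mem := hA.mem.mono fun _ h => S.neg_mem h
  aestronglyMeasurable := hA.aestronglyMeasurable.neg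
  integrable := by
    refine hA.integrable.mono ?_ (.of_forall fun x => by simp [norm_wickExp])
    exact (continuous_wickExp β).comp_aestronglyMeasurable hA.aestronglyMeasurable.neg

lemma inner_wickExp_ae (hS : (S : Set (Lp ℝ 2 P)) ⊆ gaussianAt β P) (hA : IsWickField β S lam A)
    (hB : IsWickField β S lam B) : ∀ᵐ z ∂(lam.prod lam),
    inner ℂ (wickExp β (A z.1)) (wickExp β (B z.2))
      = (Real.exp (β ^ 2 * crossCov A B z) : ℂ) := by
  filter_upwards [Measure.quasiMeasurePreserving_fst.ae hA.mem,
    Measure.quasiMeasurePreserving_snd.ae hB.mem] with z h1 h2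
  exact inner_wickExp (hS (S.sub_mem h2 h1))

lemma integrable_exp (hS : (S : Set (Lp ℝ 2 P)) ⊆ gaussianAt β P) (hA : IsWickField β S lam A)
    (hB : IsWickField β S lam B) :
    Integrable (fun z => Real.exp (β ^ 2 * crossCov A B z)) (lam.prod lam) := by
  have := ((integrable_inner_prod (𝕜 := ℂ) hA.integrable hB.integrable).congr
    (inner_wickExp_ae hS hA hB)).re
  simpa only [RCLike.re_to_complex, Complex.ofReal_re] using this

lemma inner_integral (hS : (S : Set (Lp ℝ 2 P)) ⊆ gaussianAt β P) (hA : IsWickField β S lam A)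
    (hB : IsWickField β S lam B) :
    inner ℂ (∫ x, wickExp β (A x) ∂lam) (∫ x, wickExp β (B x) ∂lam)
      = ((∫ z, Real.exp (β ^ 2 * crossCov A B z) ∂(lam.prod lam) : ℝ) : ℂ) := by
  rw [inner_integral_integral hA.integrable hB.integrable,
    integral_congr_ae (inner_wickExp_ae hS hA hB), integral_complex_ofReal]

/-- Cauchy–Schwarz for the exponential kernels. -/
lemma integral_exp_le (hS : (S : Set (Lp ℝ 2 P)) ⊆ gaussianAt β P) (hA : IsWickField β S lam A)
    (hB : IsWickField β S lam B) :
    ∫ z, Real.exp (β ^ 2 * crossCov A B z) ∂(lam.prod lam)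
      ≤ (∫ z, Real.exp (β ^ 2 * crossCov A A z) ∂(lam.prod lam)
        + ∫ z, Real.exp (β ^ 2 * crossCov B B z) ∂(lam.prod lam)) / 2 := by
  have key : ∀ v w : Lp ℂ 2 P, (inner ℂ v w).re ≤ ((inner ℂ v v).re + (inner ℂ w w).re) / 2 := by
    intro v w
    have h1 := re_inner_le_norm (𝕜 := ℂ) v w
    have h2 := inner_self_eq_norm_sq (𝕜 := ℂ) v
    have h3 := inner_self_eq_norm_sq (𝕜 := ℂ) w
    simp only [RCLike.re_to_complex] at h1 h2 h3
    nlinarith [sq_nonneg (‖v‖ - ‖w‖)]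
  have := key (∫ x, wickExp β (A x) ∂lam) (∫ x, wickExp β (B x) ∂lam)
  rwa [inner_integral hS hA hB, inner_integral hS hA hA, inner_integral hS hB hB,
    Complex.ofReal_re, Complex.ofReal_re, Complex.ofReal_re] at this

/-- Expansion of the second moment of the difference of two chaoses; the four kernels
`exp (β² ⟪·, ·⟫)` enter with signs adding up to zero, so each may be compared with `exp (β² C)`. -/
lemma norm_integral_smul_sub_sq_le (hS : (S : Set (Lp ℝ 2 P)) ⊆ gaussianAt β P)
    (hA : IsWickField β S lam A) (hB : IsWickField β S lam B) {C : E × E → ℝ}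
    (hC : ∀ z, C z.swap = C z) (hCint : Integrable (fun z => Real.exp (β ^ 2 * C z)) (lam.prod lam))
    {f : E → ℂ} (hf : AEStronglyMeasurable f lam) (hf1 : ∀ x, ‖f x‖ ≤ 1) :
    ‖∫ x, f x • (wickExp β (A x) - wickExp β (B x)) ∂lam‖ ^ 2
      ≤ ∫ z, |Real.exp (β ^ 2 * crossCov A A z) - Real.exp (β ^ 2 * C z)| ∂(lam.prod lam)
      + ∫ z, |Real.exp (β ^ 2 * crossCov B B z) - Real.exp (β ^ 2 * C z)| ∂(lam.prod lam)
      + 2 * ∫ z, |Real.exp (β ^ 2 * crossCov A B z) - Real.exp (β ^ 2 * C z)|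
        ∂(lam.prod lam) := by
  set k : (E → Lp ℝ 2 P) → (E → Lp ℝ 2 P) → E × E → ℝ := fun A B z =>
    |Real.exp (β ^ 2 * crossCov A B z) - Real.exp (β ^ 2 * C z)| with hk
  have hi : ∀ {A B : E → Lp ℝ 2 P}, IsWickField β S lam A → IsWickField β S lam B →
      Integrable (k A B) (lam.prod lam) := fun hA hB => ((integrable_exp hS hA hB).sub hCint).abs
  have hswap : ∫ z, k B A z ∂(lam.prod lam) = ∫ z, k A B z ∂(lam.prod lam) := by
    rw [← integral_prod_swap]
    refine integral_congr_ae (.of_forall fun z => ?_)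
    simp only [hk, hC, crossCov, Prod.fst_swap, Prod.snd_swap, real_inner_comm]
  have hsum : ∫ z, (k A A z + k B B z + (k A B z + k B A z)) ∂(lam.prod lam)
      = ∫ z, k A A z ∂(lam.prod lam) + ∫ z, k B B z ∂(lam.prod lam)
        + 2 * ∫ z, k A B z ∂(lam.prod lam) := by
    rw [integral_add (f := fun z => k A A z + k B B z) (g := fun z => k A B z + k B A z)
        ((hi hA hA).add (hi hB hB)) ((hi hA hB).add (hi hB hA)),
      integral_add (hi hA hA) (hi hB hB), integral_add (hi hA hB) (hi hB hA), hswap]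
    ring
  have hD : Integrable (fun x => wickExp β (A x) - wickExp β (B x)) lam :=
    hA.integrable.sub hB.integrable
  refine (norm_integral_smul_sq_le (𝕜 := ℂ) hf hf1 hD).trans (le_of_le_of_eq ?_ hsum)
  refine integral_mono_ae (integrable_inner_prod hD hD).norm
    (((hi hA hA).add (hi hB hB)).add ((hi hA hB).add (hi hB hA))) ?_
  filter_upwards [inner_wickExp_ae hS hA hA, inner_wickExp_ae hS hA hB, inner_wickExp_ae hS hB hA,
    inner_wickExp_ae hS hB hB] with z h1 h2 h3 h4
  simp only [hk]
  rw [inner_sub_left, inner_sub_right, inner_sub_right, h1, h2, h3, h4, ← Complex.ofReal_sub,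
    ← Complex.ofReal_sub, ← Complex.ofReal_sub, Complex.norm_real, Real.norm_eq_abs]
  set a := Real.exp (β ^ 2 * crossCov A A z)
  set b := Real.exp (β ^ 2 * crossCov B B z)
  set p := Real.exp (β ^ 2 * crossCov A B z)
  set q := Real.exp (β ^ 2 * crossCov B A z)
  set c := Real.exp (β ^ 2 * C z)
  have : a - p - (q - b) = (a - c) + (b - c) - ((p - c) + (q - c)) := by ring
  rw [this]
  exact (abs_sub _ _).trans (add_le_add (abs_add_le _ _) (abs_add_le _ _))

end IsWickField

/-- Two families of jointly Gaussian fields whose covariances converge in measure to `C` have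
asymptotically equal imaginary chaoses, uniformly over test functions bounded by `1`, as soon as
the total masses of the exponential kernels are asymptotically at most that of `exp (β² C)`. No
bound on the cross-covariance is needed: Cauchy–Schwarz controls the mass of its exponential. -/
theorem exists_tendsto_norm_integral_smul_sub_sq_le {ι : Type*} {l : Filter ι}
    [l.IsCountablyGenerated] {S : ι → Submodule ℝ (Lp ℝ 2 P)}
    (hS : ∀ i, (S i : Set (Lp ℝ 2 P)) ⊆ gaussianAt β P) {A B : ι → E → Lp ℝ 2 P}
    (hA : ∀ i, IsWickField β (S i) lam (A i)) (hB : ∀ i, IsWickField β (S i) lam (B i))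
    {C : E × E → ℝ} (hC : ∀ z, C z.swap = C z)
    (hCint : Integrable (fun z => Real.exp (β ^ 2 * C z)) (lam.prod lam))
    (hAA : TendstoInMeasure (lam.prod lam) (fun i => crossCov (A i) (A i)) l C)
    (hBB : TendstoInMeasure (lam.prod lam) (fun i => crossCov (B i) (B i)) l C)
    (hAB : TendstoInMeasure (lam.prod lam) (fun i => crossCov (A i) (B i)) l C)
    {a b : ι → ℝ}
    (ha : ∀ i, ∫ z, Real.exp (β ^ 2 * crossCov (A i) (A i) z) ∂(lam.prod lam) ≤ a i)
    (hb : ∀ i, ∫ z, Real.exp (β ^ 2 * crossCov (B i) (B i) z) ∂(lam.prod lam) ≤ b i)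
    (hat : Tendsto a l (𝓝 (∫ z, Real.exp (β ^ 2 * C z) ∂(lam.prod lam))))
    (hbt : Tendsto b l (𝓝 (∫ z, Real.exp (β ^ 2 * C z) ∂(lam.prod lam)))) :
    ∃ δ : ι → ℝ, Tendsto δ l (𝓝 0) ∧ ∀ i, ∀ f : E → ℂ, AEStronglyMeasurable f lam →
      (∀ x, ‖f x‖ ≤ 1) →
      ‖∫ x, f x • (wickExp β (A i x) - wickExp β (B i x)) ∂lam‖ ^ 2 ≤ δ i := by
  have hψ : Continuous fun t : ℝ => Real.exp (β ^ 2 * t) := by fun_prop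
  have hψ0 : ∀ t : ℝ, 0 ≤ Real.exp (β ^ 2 * t) := fun t => (Real.exp_pos _).le
  have h1 := tendsto_integral_abs_sub_of_integral_le hAA hψ hψ0 hCint
    (fun i => (hA i).integrable_exp (hS i) (hA i)) ha hat
  have h2 := tendsto_integral_abs_sub_of_integral_le hBB hψ hψ0 hCint
    (fun i => (hB i).integrable_exp (hS i) (hB i)) hb hbt
  have h3 := tendsto_integral_abs_sub_of_integral_le hAB hψ hψ0 hCint
    (fun i => (hA i).integrable_exp (hS i) (hB i)) (b := fun i => (a i + b i) / 2)
    (fun i => ((hA i).integral_exp_le (hS i) (hB i)).trans (by linarith [ha i, hb i]))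
    (by simpa using (hat.add hbt).div_const 2)
  refine ⟨_, by simpa using (h1.add h2).add (h3.const_mul 2), fun i f hf hf1 => ?_⟩
  exact (hA i).norm_integral_smul_sub_sq_le (hS i) (hB i) hC hCint hf hf1

end WickField

/-! ### Standard approximations as fields of `L²` vectors -/

section

section Vectors

variable {Ω : Type*} [MeasurableSpace Ω] (P : Measure Ω)

open Classical in
/-- A random variable as an element of `L²(P)` (zero if it is not square integrable). -/
def toL2 (Y : Ω → ℝ) : Lp ℝ 2 P := if h : MemLp Y 2 P then h.toLp Y else 0

variable {P}

lemma coeFn_toL2 {Y : Ω → ℝ} (h : MemLp Y 2 P) : toL2 P Y =ᵐ[P] Y := by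
  rw [toL2, dif_pos h]
  exact h.coeFn_toLp

lemma inner_toL2 {Y Z : Ω → ℝ} (hY : MemLp Y 2 P) (hZ : MemLp Z 2 P) :
    inner ℝ (toL2 P Y) (toL2 P Z) = ∫ ω, Y ω * Z ω ∂P := by
  rw [L2.inner_def]
  refine integral_congr_ae ?_
  filter_upwards [coeFn_toL2 hY, coeFn_toL2 hZ] with ω h1 h2
  simp [h1, h2, mul_comm]

lemma norm_toL2_sq {Y : Ω → ℝ} (hY : MemLp Y 2 P) : ‖toL2 P Y‖ ^ 2 = ∫ ω, Y ω ^ 2 ∂P := by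
  rw [← real_inner_self_eq_norm_sq, inner_toL2 hY hY]
  simp_rw [sq]

end Vectors

variable {d : ℕ} {Ω : Type*} [MeasurableSpace Ω] {P : Measure Ω} [IsProbabilityMeasure P]
  {U : Set (Space d)} {C : Space d → Space d → ℝ} {X X' : ℕ → Space d → Ω → ℝ} {β : ℝ}

variable (P) in
/-- The approximation `Xₙ` as a function `ℝᵈ → L²(P)`. -/
def fieldVec (X : ℕ → Space d → Ω → ℝ) (n : ℕ) (x : Space d) : Lp ℝ 2 P := toL2 P (X n x)

variable (P U) in
/-- The Gaussian Hilbert space generated by the variables `Xₙ(x)`, `x ∈ U`. -/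
def gaussianSpace (X : ℕ → Space d → Ω → ℝ) : Submodule ℝ (Lp ℝ 2 P) :=
  (Submodule.span ℝ (Set.range fun p : ℕ × U => fieldVec P X p.1 p.2)).topologicalClosure

namespace IsStandardApproximation

lemma memLp (h : IsStandardApproximation P U C X) (n : ℕ) {x : Space d} (hx : x ∈ U) :
    MemLp (X n x) 2 P :=
  (h.gaussian.hasGaussianLaw_eval (n, ⟨x, hx⟩)).memLp_two

lemma gaussianSpace_subset (h : IsStandardApproximation P U C X) (β : ℝ) :
    (gaussianSpace P U X : Set (Lp ℝ 2 P)) ⊆ gaussianAt β P :=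
  closure_span_subset_gaussianAt h.gaussian (fun p => h.centered p.1 p.2 p.2.2)
    (fun p => coeFn_toL2 (h.memLp p.1 p.2.2)) β

lemma fieldVec_mem (n : ℕ) {x : Space d} (hx : x ∈ U) :
    fieldVec P X n x ∈ gaussianSpace P U X :=
  Submodule.le_topologicalClosure _ (Submodule.subset_span ⟨(n, ⟨x, hx⟩), rfl⟩)

lemma inner_fieldVec (h : IsStandardApproximation P U C X)
    {C' : Space d → Space d → ℝ} (h' : IsStandardApproximation P U C' X') (m n : ℕ)
    {x y : Space d} (hx : x ∈ U) (hy : y ∈ U) :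
    inner ℝ (fieldVec P X m x) (fieldVec P X' n y) = ∫ ω, X m x ω * X' n y ω ∂P :=
  inner_toL2 (h.memLp m hx) (h'.memLp n hy)

/-- Almost sure continuity of a Gaussian field implies continuity in `L²`. -/
lemma continuousOn_fieldVec (h : IsStandardApproximation P U C X) (n : ℕ) :
    ContinuousOn (fieldVec P X n) U := by
  rw [continuousOn_iff_continuous_domRestrict, continuous_iff_seqContinuous]
  intro x x₀ hx
  set v : ℕ → Lp ℝ 2 P := fun k => fieldVec P X n (x k) - fieldVec P X n x₀ with hv
  have hvS : ∀ k, v k ∈ gaussianAt 1 P := fun k => h.gaussianSpace_subset 1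
    (Submodule.sub_mem _ (fieldVec_mem n (x k).2) (fieldVec_mem n x₀.2))
  have h1 : Tendsto (fun k => ∫ ω, Complex.exp (((1 : ℝ) * v k ω : ℝ) * Complex.I) ∂P) atTop
      (𝓝 (∫ _, (1 : ℂ) ∂P)) := by
    refine tendsto_integral_of_dominated_convergence (fun _ => (1 : ℝ))
      (fun k => ((memLp_phase 1 (v k)).aestronglyMeasurable)) (integrable_const _)
      (fun k => .of_forall fun ω => (norm_exp_mul_I _).le) ?_
    have hae : ∀ᵐ ω ∂P, ∀ k, v k ω = X n (x k) ω - X n x₀ ω := by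
      refine ae_all_iff.2 fun k => ?_
      filter_upwards [Lp.coeFn_sub (fieldVec P X n (x k)) (fieldVec P X n x₀),
        coeFn_toL2 (h.memLp n (x k).2), coeFn_toL2 (h.memLp n x₀.2)] with ω h1 h2 h3
      rw [hv, h1, Pi.sub_apply, fieldVec, fieldVec, h2, h3]
    filter_upwards [hae, h.continuous n] with ω h1 h2
    have h3 : Tendsto (fun k => X n (x k) ω) atTop (𝓝 (X n x₀ ω)) :=
      ((continuousOn_iff_continuous_domRestrict.1 h2).tendsto x₀).comp hx
    have h4 : Tendsto (fun k => v k ω) atTop (𝓝 0) := by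
      simp only [h1]
      simpa using h3.sub_const (X n x₀ ω)
    have h5 : Continuous fun t : ℝ => Complex.exp (((1 : ℝ) * t : ℝ) * Complex.I) := by fun_prop
    simpa [Function.comp_def] using (h5.tendsto 0).comp h4
  -- The increments are Gaussian, so their characteristic functions determine their norms.
  have h2 : Tendsto (fun k => Real.exp (-(1 ^ 2 / 2 * ‖v k‖ ^ 2))) atTop (𝓝 1) := by
    have h3 : ∀ k, ∫ ω, Complex.exp (((1 : ℝ) * v k ω : ℝ) * Complex.I) ∂P
      = (Real.exp (-(1 ^ 2 / 2 * ‖v k‖ ^ 2)) : ℂ) := fun k => hvS k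
    simp only [h3] at h1
    have := (Complex.continuous_re.tendsto _).comp h1
    simpa [Function.comp_def, ← Complex.ofReal_exp] using this
  have h3 : Tendsto (fun k => ‖v k‖ ^ 2) atTop (𝓝 0) := by
    have h4 := ((Real.continuousAt_log one_ne_zero).tendsto.comp h2).const_mul (-2)
    rw [Real.log_one, mul_zero] at h4
    refine h4.congr fun k => ?_
    simp only [Function.comp_apply, Real.log_exp]
    ring
  have h4 : Tendsto (fun k => ‖v k‖) atTop (𝓝 0) := by
    have := h3.sqrt
    simpa using this
  exact tendsto_iff_norm_sub_tendsto_zero.2 h4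

lemma isWickField (h : IsStandardApproximation P U C X) (hU : MeasurableSet U)
    (hint : ∀ n, IntegrableOn (fun x => Real.exp (β ^ 2 / 2 * ∫ ω, X n x ω ^ 2 ∂P)) U) (n : ℕ) :
    IsWickField β (gaussianSpace P U X) (volume.restrict U) (fieldVec P X n) where
  mem := (ae_restrict_mem hU).mono fun x hx => fieldVec_mem n hx
  aestronglyMeasurable := (h.continuousOn_fieldVec n).aestronglyMeasurable hU
  integrable := by
    refine (hint n).mono' ((continuous_wickExp β).comp_aestronglyMeasurable
      ((h.continuousOn_fieldVec n).aestronglyMeasurable hU)) ?_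
    filter_upwards [ae_restrict_mem hU] with x hx
    rw [norm_wickExp, fieldVec, norm_toL2_sq (h.memLp n hx)]

lemma crossCov_ae_eq (h : IsStandardApproximation P U C X)
    {C' : Space d → Space d → ℝ} (h' : IsStandardApproximation P U C' X') (hU : MeasurableSet U)
    (m n : ℕ) : (fun z : Space d × Space d => ∫ ω, X m z.1 ω * X' n z.2 ω ∂P)
      =ᵐ[(volume.restrict U).prod (volume.restrict U)]
      crossCov (fieldVec P X m) (fieldVec P X' n) := by
  rw [Measure.prod_restrict]
  filter_upwards [ae_restrict_mem (hU.prod hU)] with z hz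
  rw [crossCov, h.inner_fieldVec h' m n hz.1 hz.2]

lemma tendstoInMeasure_crossCov (h : IsStandardApproximation P U C X) (hU : MeasurableSet U) :
    TendstoInMeasure ((volume.restrict U).prod (volume.restrict U))
      (fun p : ℕ × ℕ => crossCov (fieldVec P X p.1) (fieldVec P X p.2)) atTop
      (fun z => C z.1 z.2) := by
  have h1 := h.tendsto_covariance
  rw [Measure.volume_eq_prod, ← Measure.prod_restrict] at h1
  exact h1.congr_left fun p => h.crossCov_ae_eq h hU p.1 p.2

end IsStandardApproximation

/-! ### The singularity of the limiting kernel -/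

section Singularity

lemma ae_ne_of_pos (hd : 0 < d) (U : Set (Space d)) :
    ∀ᵐ z ∂((volume.restrict U).prod (volume.restrict U)), z.1 ≠ z.2 := by
  have : Nonempty (Fin d) := ⟨⟨0, hd⟩⟩
  have : Nontrivial (Space d) := inferInstance
  rw [ae_iff]
  simp only [ne_eq, not_not]
  have hm : MeasurableSet {z : Space d × Space d | z.1 = z.2} :=
    measurableSet_eq_fun measurable_fst measurable_snd
  rw [Measure.measure_prod_null hm]
  refine .of_forall fun x => ?_
  have : Prod.mk x ⁻¹' {z : Space d × Space d | z.1 = z.2} = {x} := by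
    ext y
    simp [eq_comm]
  simp only [this, Pi.zero_apply]
  exact measure_singleton _

/-- The Riesz kernel `|x - y|⁻ᵅ`, `α < d`, is integrable on the square of a bounded set. -/
lemma integrable_riesz (hd : 0 < d) {α : ℝ} (hα : α < d) (hU : MeasurableSet U)
    (hb : Bornology.IsBounded U) :
    Integrable (fun z : Space d × Space d => ‖z.1 - z.2‖ ^ (-α))
      ((volume.restrict U).prod (volume.restrict U)) := by
  obtain ⟨R, hR⟩ := hb.subset_ball (0 : Space d)
  have hfin : Module.finrank ℝ (Space d) = d := by simp
  have h1 : IntegrableOn (fun x : Space d => ‖x‖ ^ (-α)) (Metric.ball 0 (2 * R)) volume := by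
    refine integrableOn_ball_of_norm_le_rpow (C := 1) (α := α) (by omega) (by rwa [hfin])
      (.of_forall fun x => ?_)
      (Measurable.aestronglyMeasurable (by fun_prop))
    rw [one_mul, Real.norm_eq_abs, abs_of_nonneg (by positivity)]
  have h2 : Integrable (U.indicator fun _ => (1 : ℝ)) (volume : Measure (Space d)) := by
    rw [integrable_indicator_iff hU]
    exact integrableOn_const (hb.measure_lt_top.ne)
  -- On `U × U` the kernel agrees with `(x, y) ↦ 1_U(y) k(x - y)`, where `k` is the restriction of
  -- `|·|⁻ᵅ` to a ball: the integrand of a convolution of integrable functions.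
  have h3 := h2.convolution_integrand (ContinuousLinearMap.mul ℝ ℝ) (μ := volume) (ν := volume)
    (h1.integrable_indicator Metric.isOpen_ball.measurableSet)
  rw [Measure.prod_restrict]
  refine (h3.integrableOn (s := U ×ˢ U)).congr_fun (fun z hz => ?_) (hU.prod hU)
  have hz' : z.1 - z.2 ∈ Metric.ball (0 : Space d) (2 * R) := by
    have h4 := hR hz.1
    have h5 := hR hz.2
    rw [mem_ball_zero_iff] at h4 h5 ⊢
    linarith [norm_sub_le z.1 z.2]
  simp [hz.2, Set.indicator_of_mem hz']

lemma exp_mul_le_riesz {r t B : ℝ} (hr : 0 < r) (h : t - Real.log (1 / r) ≤ B) :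
    Real.exp (β ^ 2 * t) ≤ Real.exp (β ^ 2 * B) * r ^ (-β ^ 2) := by
  rw [Real.rpow_def_of_pos hr, ← Real.exp_add]
  refine Real.exp_le_exp.2 ?_
  rw [one_div, Real.log_inv] at h
  nlinarith [mul_le_mul_of_nonneg_left h (sq_nonneg β)]

end Singularity

variable {g : Space d → Space d → ℝ}

namespace IsLogCovariance

lemma logKernel_of_mem {x y : Space d} (hx : x ∈ U) (hy : y ∈ U) :
    logKernel U g x y = Real.log (1 / ‖x - y‖) + g x y := by
  rw [logKernel, Set.indicator_of_mem (by exact ⟨hx, hy⟩)]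

lemma exp_logKernel_le (hC : IsLogCovariance U g) (hd : 0 < d) (β : ℝ) :
    ∃ B : ℝ, ∀ᵐ z ∂((volume.restrict U).prod (volume.restrict U)),
      Real.exp (β ^ 2 * logKernel U g z.1 z.2) ≤ B * ‖z.1 - z.2‖ ^ (-β ^ 2) := by
  obtain ⟨B, hB⟩ := hC.bddAbove
  refine ⟨Real.exp (β ^ 2 * B), ?_⟩
  have hU := hC.isOpen.measurableSet
  filter_upwards [ae_ne_of_pos hd U, by
    rw [Measure.prod_restrict]; exact ae_restrict_mem (hU.prod hU)] with z hne hz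
  refine exp_mul_le_riesz (norm_pos_iff.2 (sub_ne_zero.2 hne)) ?_
  rw [logKernel_of_mem hz.1 hz.2]
  linarith [hB _ hz.1 _ hz.2]

end IsLogCovariance

namespace IsStandardApproximation

variable (hC : IsLogCovariance U g) (h : IsStandardApproximation P U (logKernel U g) X)
  (hd : 0 < d) (hβ : β ^ 2 < d)
include hC h hd hβ

lemma integrable_exp_logKernel :
    Integrable (fun z : Space d × Space d => Real.exp (β ^ 2 * logKernel U g z.1 z.2))
      ((volume.restrict U).prod (volume.restrict U)) := by
  have hU := hC.isOpen.measurableSet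
  obtain ⟨B, hB⟩ := hC.exp_logKernel_le hd β
  refine ((integrable_riesz hd hβ hU hC.isBounded).const_mul B).mono' ?_ ?_
  · have h1 : AEStronglyMeasurable (fun z : Space d × Space d => logKernel U g z.1 z.2)
        ((volume.restrict U).prod (volume.restrict U)) :=
      (h.tendstoInMeasure_crossCov hU).aestronglyMeasurable fun p =>
        aestronglyMeasurable_crossCov ((h.continuousOn_fieldVec _).aestronglyMeasurable hU)
          ((h.continuousOn_fieldVec _).aestronglyMeasurable hU)
    exact (by fun_prop : Continuous fun t : ℝ => Real.exp (β ^ 2 * t)).comp_aestronglyMeasurable h1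
  · filter_upwards [hB] with z hz
    rwa [Real.norm_eq_abs, Real.abs_exp]

/-- The exponential kernels converge, being dominated by a Riesz kernel. -/
lemma tendsto_integral_mul_exp {w : Space d × Space d → ℝ} (hw : Measurable w)
    (hw1 : ∀ z, |w z| ≤ 1) :
    Tendsto (fun n => ∫ z, w z * Real.exp (β ^ 2 * crossCov (fieldVec P X n) (fieldVec P X n) z)
        ∂((volume.restrict U).prod (volume.restrict U))) atTop
      (𝓝 (∫ z, w z * Real.exp (β ^ 2 * logKernel U g z.1 z.2)
        ∂((volume.restrict U).prod (volume.restrict U)))) := by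
  have hU := hC.isOpen.measurableSet
  obtain ⟨B, hB⟩ := h.upper_bound
  refine tendsto_integral_of_tendstoInMeasure
    ((h.tendstoInMeasure_crossCov hU).comp (tendsto_atTop_diagonal (α := ℕ)))
    (Φ := fun z t => w z * Real.exp (β ^ 2 * t)) (fun _ => by fun_prop)
    (bound := fun z => Real.exp (β ^ 2 * B) * ‖z.1 - z.2‖ ^ (-β ^ 2))
    ((integrable_riesz hd hβ hU hC.isBounded).const_mul _) (fun n => ?_) fun n => ?_
  · filter_upwards [ae_ne_of_pos hd U, by
      rw [Measure.prod_restrict]; exact ae_restrict_mem (hU.prod hU)] with z hne hz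
    rw [abs_mul, Real.abs_exp]
    refine (mul_le_of_le_one_left (Real.exp_pos _).le (hw1 z)).trans
      (exp_mul_le_riesz (norm_pos_iff.2 (sub_ne_zero.2 hne)) ?_)
    simp only [Function.comp_apply, crossCov]
    rw [h.inner_fieldVec h n n hz.1 hz.2]
    exact hB n _ hz.1 _ hz.2 hne
  · exact hw.aestronglyMeasurable.mul
      ((by fun_prop : Continuous fun t : ℝ => Real.exp (β ^ 2 * t)).comp_aestronglyMeasurable
      (aestronglyMeasurable_crossCov ((h.continuousOn_fieldVec _).aestronglyMeasurable hU)
          ((h.continuousOn_fieldVec _).aestronglyMeasurable hU)))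

lemma tendsto_integral_exp :
    Tendsto (fun n => ∫ z, Real.exp (β ^ 2 * crossCov (fieldVec P X n) (fieldVec P X n) z)
        ∂((volume.restrict U).prod (volume.restrict U))) atTop
      (𝓝 (∫ z, Real.exp (β ^ 2 * logKernel U g z.1 z.2)
        ∂((volume.restrict U).prod (volume.restrict U)))) := by
  simpa only [one_mul] using tendsto_integral_mul_exp hC h hd hβ (w := fun _ => 1)
    measurable_const (fun _ => by simp)

variable (hint : ∀ n, IntegrableOn (fun x => Real.exp (β ^ 2 / 2 * ∫ ω, X n x ω ^ 2 ∂P)) U)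
include hint

/-- The chaoses of the `Xₙ` form a Cauchy sequence in `L²(P)`, uniformly over test functions
bounded by `1`. -/
theorem exists_tendsto_norm_sub_sq_le :
    ∃ δ : ℕ × ℕ → ℝ, Tendsto δ atTop (𝓝 0) ∧ ∀ p, ∀ f : Space d → ℂ,
      AEStronglyMeasurable f (volume.restrict U) → (∀ x, ‖f x‖ ≤ 1) →
      ‖∫ x in U, f x • (wickExp β (fieldVec P X p.1 x) - wickExp β (fieldVec P X p.2 x))‖ ^ 2
        ≤ δ p := by
  have hU := hC.isOpen.measurableSet
  have : IsFiniteMeasure (volume.restrict U) := ⟨by simpa using hC.isBounded.measure_lt_top⟩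
  have hcov := h.tendstoInMeasure_crossCov hU
  have hF := fun n => h.isWickField hU hint n
  have hfst : Tendsto (Prod.fst : ℕ × ℕ → ℕ) atTop atTop := by
    rw [← prod_atTop_atTop_eq]; exact tendsto_fst
  have hsnd : Tendsto (Prod.snd : ℕ × ℕ → ℕ) atTop atTop := by
    rw [← prod_atTop_atTop_eq]; exact tendsto_snd
  have hexp := tendsto_integral_exp hC h hd hβ
  have h1 : TendstoInMeasure ((volume.restrict U).prod (volume.restrict U))
      (fun p : ℕ × ℕ => crossCov (fieldVec P X p.1) (fieldVec P X p.1)) atTop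
      (fun z => logKernel U g z.1 z.2) :=
    hcov.comp (ns := fun p : ℕ × ℕ => (p.1, p.1)) ((tendsto_atTop_diagonal (α := ℕ)).comp hfst)
  have h2 : TendstoInMeasure ((volume.restrict U).prod (volume.restrict U))
      (fun p : ℕ × ℕ => crossCov (fieldVec P X p.2) (fieldVec P X p.2)) atTop
      (fun z => logKernel U g z.1 z.2) :=
    hcov.comp (ns := fun p : ℕ × ℕ => (p.2, p.2)) ((tendsto_atTop_diagonal (α := ℕ)).comp hsnd)
  exact exists_tendsto_norm_integral_smul_sub_sq_le (S := fun _ => gaussianSpace P U X)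
    (fun _ => h.gaussianSpace_subset β)
    (A := fun p : ℕ × ℕ => fieldVec P X p.1) (B := fun p : ℕ × ℕ => fieldVec P X p.2)
    (fun p => hF p.1) (fun p => hF p.2)
    (C := fun z => logKernel U g z.1 z.2) (fun z => hC.symm _ _)
    (integrable_exp_logKernel hC h hd hβ)
    h1 h2 hcov
    (fun _ => le_rfl) (fun _ => le_rfl) (hexp.comp hfst) (hexp.comp hsnd)

end IsStandardApproximation

end

/-! ### Sobolev spaces and their identification with `L²` -/

section Sobolev

variable {d : ℕ}

/-- The Sobolev weight `(1 + |ξ|²)^{s/2}`. -/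
def sobolevWeight (s : ℝ) (ξ : Space d) : ℂ := (((1 + ‖ξ‖ ^ 2) ^ (s / 2) : ℝ) : ℂ)

lemma hasTemperateGrowth_sobolevWeight (s : ℝ) :
    (sobolevWeight s : Space d → ℂ).HasTemperateGrowth := by
  unfold sobolevWeight
  fun_prop

lemma sobolevWeight_mul_neg (s : ℝ) :
    (sobolevWeight s * sobolevWeight (-s) : Space d → ℂ) = fun _ => 1 := by
  ext ξ
  rw [Pi.mul_apply, sobolevWeight, sobolevWeight, ← Complex.ofReal_mul,
    ← Real.rpow_add (by positivity), neg_div, add_neg_cancel, Real.rpow_zero, Complex.ofReal_one]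

/-- The inverse of `weightedFourier s`. -/
def ofWeightedFourier (s : ℝ) : 𝓢'(Space d, ℂ) →L[ℂ] 𝓢'(Space d, ℂ) :=
  (FourierTransform.fourierInvCLM ℂ 𝓢'(Space d, ℂ)) ∘L
    TemperedDistribution.smulLeftCLM ℂ (sobolevWeight (-s))

lemma ofWeightedFourier_weightedFourier (s : ℝ) (u : 𝓢'(Space d, ℂ)) :
    ofWeightedFourier s (weightedFourier s u) = u := by
  have h : weightedFourier s u = TemperedDistribution.smulLeftCLM ℂ (sobolevWeight s) (𝓕 u) := rfl
  rw [h, ofWeightedFourier, ContinuousLinearMap.comp_apply,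
    TemperedDistribution.smulLeftCLM_smulLeftCLM_apply (hasTemperateGrowth_sobolevWeight _)
      (hasTemperateGrowth_sobolevWeight _), sobolevWeight_mul_neg,
    TemperedDistribution.smulLeftCLM_const, one_smul]
  simp

lemma weightedFourier_ofWeightedFourier (s : ℝ) (u : 𝓢'(Space d, ℂ)) :
    weightedFourier s (ofWeightedFourier s u) = u := by
  have h : weightedFourier s (ofWeightedFourier s u)
    = TemperedDistribution.smulLeftCLM ℂ (sobolevWeight s) (𝓕 (ofWeightedFourier s u)) := rfl
  rw [h, ofWeightedFourier, ContinuousLinearMap.comp_apply, FourierTransform.fourierInvCLM_apply,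
    FourierTransform.fourier_fourierInv_eq,
    TemperedDistribution.smulLeftCLM_smulLeftCLM_apply (hasTemperateGrowth_sobolevWeight _)
      (hasTemperateGrowth_sobolevWeight _), mul_comm, sobolevWeight_mul_neg,
    TemperedDistribution.smulLeftCLM_const, one_smul]

lemma weightedFourier_sub (s : ℝ) (u v : 𝓢'(Space d, ℂ)) :
    weightedFourier s (u - v) = weightedFourier s u - weightedFourier s v := by
  have h : 𝓕 (u - v) = 𝓕 u - 𝓕 v := map_sub (FourierTransform.fourierCLM ℂ 𝓢'(Space d, ℂ)) u v
  rw [weightedFourier, h, map_sub]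
  rfl

/-- The embedding of `H^s`, identified with `L²`, into the tempered distributions. -/
def sobolevEmbedding (s : ℝ) : Lp ℂ 2 (volume : Measure (Space d)) →L[ℂ] 𝓢'(Space d, ℂ) :=
  ofWeightedFourier s ∘L Lp.toTemperedDistributionCLM ℂ volume 2

lemma weightedFourier_eq_iff {s : ℝ} {u : 𝓢'(Space d, ℂ)}
    {v : Lp ℂ 2 (volume : Measure (Space d))} :
    weightedFourier s u = v ↔ u = sobolevEmbedding s v := by
  constructor
  · intro h
    rw [← ofWeightedFourier_weightedFourier s u, h]
    rfl
  · rintro rfl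
    exact weightedFourier_ofWeightedFourier s _

lemma sobolevENorm_sub_eq {s : ℝ} {u u' : 𝓢'(Space d, ℂ)}
    {v v' : Lp ℂ 2 (volume : Measure (Space d))} (h : weightedFourier s u = v)
    (h' : weightedFourier s u' = v') : sobolevENorm s (u - u') = ‖v - v'‖ₑ := by
  refine sobolevENorm_eq ?_
  rw [weightedFourier_sub, h, h']
  exact (map_sub (Lp.toTemperedDistributionCLM ℂ volume 2) v v').symm

lemma memLp_sobolevWeight {s : ℝ} (hs : s < -(d : ℝ) / 2) :
    MemLp (sobolevWeight s : Space d → ℂ) 2 := by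
  have hm : AEStronglyMeasurable (sobolevWeight s : Space d → ℂ) volume :=
    (hasTemperateGrowth_sobolevWeight s).1.continuous.aestronglyMeasurable
  rw [memLp_two_iff_integrable_sq_norm hm]
  have hfin : Module.finrank ℝ (Space d) = d := by simp
  refine (integrable_rpow_neg_one_add_norm_sq (E := Space d) (μ := volume) (r := -(2 * s))
    (by rw [hfin]; linarith)).congr (.of_forall fun ξ => ?_)
  have h0 : (0 : ℝ) ≤ 1 + ‖ξ‖ ^ 2 := by positivity
  simp only [sobolevWeight]
  rw [Complex.norm_real, Real.norm_eq_abs, sq_abs, ← Real.rpow_mul_natCast h0]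
  congr 1
  push_cast
  ring

variable {s : ℝ}

lemma continuous_fourier {f : Space d → ℂ} (hf : Integrable f) : Continuous (𝓕 f) :=
  VectorFourier.fourierIntegral_continuous Real.continuous_fourierChar (innerSL ℝ).continuous₂ hf

lemma memLp_weight_mul_fourier (hs : s < -(d : ℝ) / 2) {f : Space d → ℂ} (hf : Integrable f) :
    MemLp (fun ξ => sobolevWeight s ξ * 𝓕 f ξ) 2 := by
  refine ((memLp_sobolevWeight hs).norm.const_mul (∫ x, ‖f x‖)).mono'
    ((memLp_sobolevWeight hs).aestronglyMeasurable.mul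
      (continuous_fourier hf).aestronglyMeasurable) (.of_forall fun ξ => ?_)
  rw [norm_mul, mul_comm]
  exact mul_le_mul_of_nonneg_right (VectorFourier.norm_fourierIntegral_le_integral_norm _ _ _ _ _)
    (norm_nonneg _)

open Classical in
/-- The element of `L²` which represents the integrable function `f` in `H^s`, `s < -d/2`, that is,
`(1 + |ξ|²)^{s/2} 𝓕 f(ξ)` (zero if this is not square integrable). -/
def sobolevRep (s : ℝ) (f : Space d → ℂ) : Lp ℂ 2 (volume : Measure (Space d)) :=
  if h : MemLp (fun ξ => sobolevWeight s ξ * 𝓕 f ξ) 2 then h.toLp _ else 0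

lemma coeFn_sobolevRep (hs : s < -(d : ℝ) / 2) {f : Space d → ℂ} (hf : Integrable f) :
    sobolevRep s f =ᵐ[volume] fun ξ => sobolevWeight s ξ * 𝓕 f ξ := by
  rw [sobolevRep, dif_pos (memLp_weight_mul_fourier hs hf)]
  exact MemLp.coeFn_toLp _

lemma sobolevRep_congr {f g : Space d → ℂ} (h : f =ᵐ[volume] g) :
    sobolevRep s f = sobolevRep s g := by
  have : (𝓕 f : Space d → ℂ) = 𝓕 g := funext fun ξ => Real.fourier_congr_ae h ξ
  classical
  change (fun F : Space d → ℂ => if h : MemLp (fun ξ => sobolevWeight s ξ * F ξ) 2 then h.toLp _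
    else 0) (𝓕 f) = _
  rw [this]
  rfl

lemma weightedFourier_ofFunction (hs : s < -(d : ℝ) / 2) {f : Space d → ℂ} (hf : Integrable f) :
    weightedFourier s (ofFunction f) = sobolevRep s f := by
  have h : weightedFourier s (ofFunction f)
    = TemperedDistribution.smulLeftCLM ℂ (sobolevWeight s) (𝓕 (ofFunction f)) := rfl
  ext φ
  rw [h, TemperedDistribution.smulLeftCLM_apply_apply, TemperedDistribution.fourier_apply,
    ofFunction_apply hf, Lp.toTemperedDistribution_apply]
  set ψ := SchwartzMap.smulLeftCLM ℂ (sobolevWeight s : Space d → ℂ) φ with hψ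
  have h1 : ∫ ξ, 𝓕 (ψ : Space d → ℂ) ξ • f ξ = ∫ x, ψ x • 𝓕 f x := by
    simpa using! VectorFourier.integral_fourierIntegral_smul_eq_flip (L := innerₗ (Space d))
      Real.continuous_fourierChar continuous_inner ψ.integrable hf
  have h2 : ∀ ξ, (𝓕 ψ : 𝓢(Space d, ℂ)) ξ = 𝓕 (ψ : Space d → ℂ) ξ := fun ξ => by
    rw [SchwartzMap.fourier_coe]
  simp only [h2]
  rw [show ∫ x, 𝓕 (ψ : Space d → ℂ) x * f x = ∫ x, ψ x • 𝓕 f x from h1]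
  refine integral_congr_ae ?_
  filter_upwards [coeFn_sobolevRep hs hf] with ξ hξ
  rw [hξ, hψ, SchwartzMap.smulLeftCLM_apply_apply (hasTemperateGrowth_sobolevWeight s)]
  simp only [smul_eq_mul]
  ring

end Sobolev

/-! ### Random elements of Sobolev spaces -/

section RandomElements

/-- A map into a second countable metric space is measurable as soon as all distances to points
are. -/
lemma measurable_of_measurable_edist {α Y : Type*} [MeasurableSpace α] [MetricSpace Y]
    [SecondCountableTopology Y] [MeasurableSpace Y] [BorelSpace Y] {F : α → Y}
    (hF : ∀ q, Measurable fun a => edist (F a) q) : Measurable F := by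
  have hb : TopologicalSpace.IsTopologicalBasis {B : Set Y | ∃ q r, B = Metric.eball q r} := by
    refine TopologicalSpace.isTopologicalBasis_of_isOpen_of_nhds ?_ ?_
    · rintro _ ⟨q, r, rfl⟩
      exact Metric.isOpen_eball
    · intro q V hq hV
      obtain ⟨r, hr, h⟩ := EMetric.mem_nhds_iff.1 (hV.mem_nhds hq)
      exact ⟨_, ⟨q, r, rfl⟩, Metric.mem_eball_self hr, h⟩
  rw [‹BorelSpace Y›.measurable_eq, hb.borel_eq_generateFrom]
  refine measurable_generateFrom ?_
  rintro _ ⟨q, r, rfl⟩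
  exact measurableSet_lt (hF q) measurable_const

variable {d : ℕ} {Ω : Type*} [MeasurableSpace Ω] {P : Measure Ω} [IsProbabilityMeasure P] {s : ℝ}
  {M M' : Ω → Space d → ℂ}

lemma stronglyMeasurable_fourier {M : Ω → Space d → ℂ}
    (hM : StronglyMeasurable fun p : Ω × Space d => M p.1 p.2) :
    StronglyMeasurable fun p : Ω × Space d => 𝓕 (M p.1) p.2 := by
  simp_rw [Real.fourier_eq]
  refine StronglyMeasurable.integral_prod_right'
    (f := fun q : (Ω × Space d) × Space d => Real.fourierChar (-inner ℝ q.2 q.1.2) • M q.1.1 q.2) ?_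
  have h1 : StronglyMeasurable fun q : (Ω × Space d) × Space d => M q.1.1 q.2 :=
    hM.comp_measurable (by fun_prop : Measurable fun q : (Ω × Space d) × Space d => (q.1.1, q.2))
  have h2 : Continuous fun t : ℝ => (Real.fourierChar t : ℂ) :=
    continuous_subtype_val.comp Real.continuous_fourierChar
  have h3 : StronglyMeasurable fun q : (Ω × Space d) × Space d =>
      (Real.fourierChar (-inner ℝ q.2 q.1.2) : ℂ) :=
    h2.comp_stronglyMeasurable
      (measurable_snd.inner (measurable_snd.comp measurable_fst)).neg.stronglyMeasurable
  exact h3.mul h1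

lemma stronglyMeasurable_sobolevRep {M : Ω → Space d → ℂ}
    (hM : StronglyMeasurable fun p : Ω × Space d => M p.1 p.2) :
    StronglyMeasurable fun ω => sobolevRep s (M ω) := by
  let _ : MeasurableSpace ↥(Lp ℂ 2 (volume : Measure (Space d))) := borel _
  have : Fact ((2 : ℝ≥0∞) ≠ ∞) := ⟨ENNReal.ofNat_ne_top⟩
  have : BorelSpace ↥(Lp ℂ 2 (volume : Measure (Space d))) := ⟨rfl⟩
  have hw : StronglyMeasurable (sobolevWeight s : Space d → ℂ) :=
    (hasTemperateGrowth_sobolevWeight s).1.continuous.stronglyMeasurable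
  set Φ : Ω → Space d → ℂ := fun ω ξ => sobolevWeight s ξ * 𝓕 (M ω) ξ with hΦ
  have hΦm : StronglyMeasurable fun p : Ω × Space d => Φ p.1 p.2 :=
    (hw.comp_measurable measurable_snd).mul (stronglyMeasurable_fourier hM)
  have hΦs : ∀ ω, AEStronglyMeasurable (Φ ω) volume := fun ω =>
    (hΦm.comp_measurable measurable_prodMk_left).aestronglyMeasurable
  have hset : MeasurableSet {ω | MemLp (Φ ω) 2 volume} := by
    have : {ω | MemLp (Φ ω) 2 volume} = {ω | ∫⁻ ξ, ‖Φ ω ξ‖ₑ ^ (2 : ℝ) < ∞} := by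
      ext ω
      rw [Set.mem_ofPred_eq, Set.mem_ofPred_eq, MemLp, and_iff_right (hΦs ω),
        eLpNorm_lt_top_iff_lintegral_rpow_enorm_lt_top two_ne_zero ENNReal.ofNat_ne_top]
      simp
    rw [this]
    exact measurableSet_lt (Measurable.lintegral_prod_right'
      (f := fun p : Ω × Space d => ‖Φ p.1 p.2‖ₑ ^ (2 : ℝ)) (hΦm.enorm.pow_const _))
      measurable_const
  -- `L²` being separable, it suffices that distances are measurable, which are computed by Fubini.
  refine Measurable.stronglyMeasurable (measurable_of_measurable_edist fun q => ?_)
  have hq : Measurable fun ω =>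
      (∫⁻ ξ, ‖Φ ω ξ - q ξ‖ₑ ^ (2 : ℝ))
        ^ (1 / (2 : ℝ)) := by
    refine Measurable.pow_const (Measurable.lintegral_prod_right'
      (f := fun p : Ω × Space d => ‖Φ p.1 p.2 - q p.2‖ₑ ^ (2 : ℝ)) ?_) _
    exact ((hΦm.measurable.sub ((Lp.stronglyMeasurable q).measurable.comp
      measurable_snd)).enorm.pow_const _)
  classical
  convert Measurable.piecewise hset hq (measurable_const (a := edist 0 q)) using 1
  ext ω
  by_cases h : MemLp (Φ ω) 2 volume
  · rw [Set.piecewise_eq_of_mem _ _ _ (by exact h)]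
    have h1 : sobolevRep s (M ω) = h.toLp := dif_pos h
    rw [h1, edist_eq_enorm_sub, Lp.enorm_def,
      eLpNorm_eq_lintegral_rpow_enorm_toReal two_ne_zero ENNReal.ofNat_ne_top,
      ENNReal.toReal_ofNat]
    congr 1
    refine lintegral_congr_ae ?_
    filter_upwards [Lp.coeFn_sub (h.toLp (Φ ω)) q, h.coeFn_toLp] with ξ h2 h3
    rw [h2, Pi.sub_apply, h3]
  · rw [Set.piecewise_eq_of_notMem _ _ _ (by exact h)]
    have h1 : sobolevRep s (M ω) = 0 := dif_neg h
    rw [h1]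

/-- A jointly measurable version has the same Fourier transform at every frequency. -/
lemma exists_stronglyMeasurable_fourier_eq
    (hM : AEStronglyMeasurable (fun p : Ω × Space d => M p.1 p.2) (P.prod volume)) :
    ∃ N : Ω → Space d → ℂ, (StronglyMeasurable fun p : Ω × Space d => N p.1 p.2) ∧
      (∀ᵐ ω ∂P, ∀ ξ, 𝓕 (M ω) ξ = 𝓕 (N ω) ξ) := by
  obtain ⟨G, hG, hMG⟩ := hM
  refine ⟨fun ω x => G (ω, x), hG, ?_⟩
  filter_upwards [Measure.ae_ae_of_ae_prod hMG] with ω hω ξ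
  exact Real.fourier_congr_ae hω ξ

lemma aestronglyMeasurable_sobolevRep
    (hM : AEStronglyMeasurable (fun p : Ω × Space d => M p.1 p.2) (P.prod volume)) :
    AEStronglyMeasurable (fun ω => sobolevRep s (M ω)) P := by
  refine ⟨fun ω => sobolevRep s fun x => hM.mk _ (ω, x),
    stronglyMeasurable_sobolevRep hM.stronglyMeasurable_mk, ?_⟩
  filter_upwards [Measure.ae_ae_of_ae_prod hM.ae_eq_mk] with ω hω
  exact sobolevRep_congr hω

lemma enorm_sobolevRep_sub_sq (hs : s < -(d : ℝ) / 2) {f f' : Space d → ℂ} (hf : Integrable f)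
    (hf' : Integrable f') : ‖sobolevRep s f - sobolevRep s f'‖ₑ ^ 2
      = ∫⁻ ξ, ‖sobolevWeight s ξ‖ₑ ^ 2 * ‖𝓕 f ξ - 𝓕 f' ξ‖ₑ ^ 2 := by
  rw [Lp.enorm_def, eLpNorm_eq_lintegral_rpow_enorm_toReal two_ne_zero ENNReal.ofNat_ne_top,
    ENNReal.toReal_ofNat, ← ENNReal.rpow_two, ← ENNReal.rpow_mul, one_div,
    inv_mul_cancel₀ two_ne_zero, ENNReal.rpow_one]
  simp only [ENNReal.rpow_two]
  refine lintegral_congr_ae ?_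
  filter_upwards [coeFn_sobolevRep hs hf, coeFn_sobolevRep hs hf',
    Lp.coeFn_sub (sobolevRep s f) (sobolevRep s f')] with ξ h6 h7 h8
  rw [h8, Pi.sub_apply, h6, h7, ← mul_sub, enorm_mul, mul_pow]

/-- A bound on the second moments of the Fourier coefficients which is uniform in the frequency
gives a bound in `L²(P; H^s)`. -/
lemma lintegral_enorm_sobolevRep_sub_sq_le (hs : s < -(d : ℝ) / 2)
    (hM : AEStronglyMeasurable (fun p : Ω × Space d => M p.1 p.2) (P.prod volume))
    (hM' : AEStronglyMeasurable (fun p : Ω × Space d => M' p.1 p.2) (P.prod volume))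
    (hi : ∀ᵐ ω ∂P, Integrable (M ω)) (hi' : ∀ᵐ ω ∂P, Integrable (M' ω)) {δ : ℝ≥0∞}
    (hδ : ∀ ξ, ∫⁻ ω, ‖𝓕 (M ω) ξ - 𝓕 (M' ω) ξ‖ₑ ^ 2 ∂P ≤ δ) :
    ∫⁻ ω, ‖sobolevRep s (M ω) - sobolevRep s (M' ω)‖ₑ ^ 2 ∂P
      ≤ δ * ∫⁻ ξ : Space d, ‖sobolevWeight s ξ‖ₑ ^ 2 := by
  have hw : Measurable (sobolevWeight s : Space d → ℂ) :=
    (hasTemperateGrowth_sobolevWeight s).1.continuous.measurable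
  obtain ⟨N, hN, h1⟩ := exists_stronglyMeasurable_fourier_eq hM
  obtain ⟨N', hN', h2⟩ := exists_stronglyMeasurable_fourier_eq hM'
  have hm : Measurable fun p : Ω × Space d => 𝓕 (N p.1) p.2 - 𝓕 (N' p.1) p.2 :=
    ((stronglyMeasurable_fourier hN).sub (stronglyMeasurable_fourier hN')).measurable
  have hΨ : Measurable fun p : Ω × Space d =>
      ‖sobolevWeight s p.2‖ₑ ^ 2 * ‖𝓕 (N p.1) p.2 - 𝓕 (N' p.1) p.2‖ₑ ^ 2 :=
    ((hw.comp measurable_snd).enorm.pow_const 2).mul (hm.enorm.pow_const 2)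
  have h3 : ∫⁻ ω, ‖sobolevRep s (M ω) - sobolevRep s (M' ω)‖ₑ ^ 2 ∂P
      = ∫⁻ ω, ∫⁻ ξ, ‖sobolevWeight s ξ‖ₑ ^ 2 * ‖𝓕 (N ω) ξ - 𝓕 (N' ω) ξ‖ₑ ^ 2 ∂volume ∂P := by
    refine lintegral_congr_ae ?_
    filter_upwards [hi, hi', h1, h2] with ω hω hω' h4 h5
    rw [enorm_sobolevRep_sub_sq hs hω hω']
    simp only [h4, h5]
  rw [h3, lintegral_lintegral_swap hΨ.aemeasurable]
  have h4 : ∀ ξ, ∫⁻ ω, ‖sobolevWeight s ξ‖ₑ ^ 2 * ‖𝓕 (N ω) ξ - 𝓕 (N' ω) ξ‖ₑ ^ 2 ∂P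
      ≤ ‖sobolevWeight s ξ‖ₑ ^ 2 * δ := by
    intro ξ
    have hm' : Measurable fun ω => ‖𝓕 (N ω) ξ - 𝓕 (N' ω) ξ‖ₑ ^ 2 :=
      (hm.comp measurable_prodMk_right).enorm.pow_const 2
    have h5 : ∫⁻ ω, ‖𝓕 (N ω) ξ - 𝓕 (N' ω) ξ‖ₑ ^ 2 ∂P = ∫⁻ ω, ‖𝓕 (M ω) ξ - 𝓕 (M' ω) ξ‖ₑ ^ 2 ∂P := by
      refine lintegral_congr_ae ?_
      filter_upwards [h1, h2] with ω h4 h5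
      rw [h4, h5]
    rw [lintegral_const_mul _ hm', h5]
    gcongr
    exact hδ ξ
  refine (lintegral_mono h4).trans_eq ?_
  have hw2 : Measurable fun ξ : Space d => ‖sobolevWeight s ξ‖ₑ ^ 2 := hw.enorm.pow_const 2
  rw [lintegral_mul_const _ hw2, mul_comm]

end RandomElements

/-! ### The approximations as `L²`-valued integrals -/

section

section Fubini

variable {Ω : Type*} [MeasurableSpace Ω] {P : Measure Ω} [IsProbabilityMeasure P]
  {E : Type*} [MeasurableSpace E] {lam : Measure E} [SFinite lam]

/-- The Bochner integral of an `L²(P)`-valued function is computed pointwise. -/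
lemma coeFn_integral_ae_eq {V : E → Lp ℂ 2 P} (hV : Integrable V lam) {w : Ω → E → ℂ}
    (hw : Integrable (fun p : Ω × E => w p.1 p.2) (P.prod lam))
    (hVw : ∀ᵐ x ∂lam, V x =ᵐ[P] fun ω => w ω x) :
    (∫ x, V x ∂lam : Lp ℂ 2 P) =ᵐ[P] fun ω => ∫ x, w ω x ∂lam := by
  refine Integrable.ae_eq_of_forall_setIntegral_eq _ _
    ((Lp.memLp _).integrable one_le_two) hw.integral_prod_left fun A hA _ => ?_
  rw [← L2.inner_indicatorConstLp_one hA (measure_ne_top P A), ← integral_inner hV]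
  have h1 : Integrable (fun p : Ω × E => w p.1 p.2) ((P.restrict A).prod lam) := by
    have h2 : (P.restrict A).prod lam = (P.prod lam).restrict (A ×ˢ Set.univ) := by
      rw [← Measure.prod_restrict, Measure.restrict_univ]
    rw [h2]
    exact hw.restrict
  rw [integral_integral_swap h1]
  refine integral_congr_ae ?_
  filter_upwards [hVw] with x hx
  rw [L2.inner_indicatorConstLp_one hA (measure_ne_top P A)]
  exact setIntegral_congr_ae hA (hx.mono fun ω h _ => h)

end Fubini

variable {d : ℕ} {Ω : Type*} [MeasurableSpace Ω] {P : Measure Ω} [IsProbabilityMeasure P]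
  {U : Set (Space d)} {C C' : Space d → Space d → ℝ} {X X' : ℕ → Space d → Ω → ℝ} {β : ℝ}

namespace IsStandardApproximation

/-- A Gaussian field with continuous paths is jointly measurable up to null sets. -/
lemma aemeasurable_uncurry (h : IsStandardApproximation P U C X) (hU : MeasurableSet U) (n : ℕ) :
    AEMeasurable (fun p : Ω × Space d => X n p.2 p.1) (P.prod (volume.restrict U)) := by
  rcases U.eq_empty_or_nonempty with rfl | ⟨y₀, hy₀⟩
  · simp
  have hX : ∀ x ∈ U, AEMeasurable (X n x) P := fun x hx => (h.memLp n hx).1.aemeasurable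
  set σ : ℕ → SimpleFunc (Space d) (Space d) := SimpleFunc.approxOn id measurable_id U y₀ hy₀
  have hσ : ∀ k x, σ k x ∈ U := fun k x => SimpleFunc.approxOn_mem _ _ _ _
  -- Replacing `x` by simple approximations `σ k x` gives finitely many random variables at a time.
  refine aemeasurable_of_tendsto_metrizable_ae atTop
    (f := fun k (p : Ω × Space d) => X n (σ k p.2) p.1) (fun k => ?_) ?_
  · classical
    set G : Space d → Ω × Space d → ℝ := fun b p =>
      if hb : b ∈ U then (hX b hb).mk _ p.1 else 0 with hG
    have hGm : ∀ b, Measurable (G b) := by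
      intro b
      by_cases hb : b ∈ U
      · simp only [hG, hb, dif_pos]
        exact (AEMeasurable.measurable_mk _).comp measurable_fst
      · simp only [hG, hb, dif_neg, not_false_eq_true, measurable_const]
    refine ⟨fun p => G (((σ k).comp Prod.snd measurable_snd : SimpleFunc (Ω × Space d) _) p) p,
      SimpleFunc.measurable_bind _ _ hGm, ?_⟩
    have h1 : ∀ᵐ ω ∂P, ∀ c ∈ (σ k).range, ∀ x, X n c ω = G c (ω, x) := by
      rw [Filter.eventually_all_finset]
      intro c hc
      obtain ⟨x, rfl⟩ := SimpleFunc.mem_range.1 hc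
      filter_upwards [(hX _ (hσ k x)).ae_eq_mk] with ω hω _
      rw [hω, hG]
      simp only [hσ k x, dif_pos]
    filter_upwards [Measure.quasiMeasurePreserving_fst.ae h1] with p hp
    exact hp _ (SimpleFunc.mem_range_self _ _) _
  · filter_upwards [Measure.quasiMeasurePreserving_fst.ae (h.continuous n),
      Measure.quasiMeasurePreserving_snd.ae (ae_restrict_mem hU)] with p h1 h2
    have h3 : Tendsto (fun k => σ k p.2) atTop (𝓝[U] p.2) :=
      tendsto_nhdsWithin_iff.2 ⟨SimpleFunc.tendsto_approxOn measurable_id hy₀ (subset_closure h2),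
        .of_forall fun k => hσ k _⟩
    exact (h1 p.2 h2).tendsto.comp h3

lemma norm_chaosFunction (n : ℕ) (ω : Ω) (x : Space d) :
    ‖chaosFunction P U β X n ω x‖
      = U.indicator (fun x => Real.exp (β ^ 2 / 2 * ∫ ω, X n x ω ^ 2 ∂P)) x := by
  rw [chaosFunction, norm_indicator_eq_indicator_norm]
  congr 1
  ext x
  rw [Complex.norm_exp]
  simp only [Complex.add_re, Complex.mul_re, Complex.I_re, Complex.I_im, Complex.ofReal_re,
    Complex.ofReal_im]
  ring_nf

lemma wickExp_fieldVec_ae_eq (h : IsStandardApproximation P U C X) (n : ℕ) {x : Space d}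
    (hx : x ∈ U) : wickExp β (fieldVec P X n x) =ᵐ[P] fun ω => chaosFunction P U β X n ω x := by
  filter_upwards [coeFn_wickExp β (fieldVec P X n x), coeFn_toL2 (h.memLp n hx)] with ω h1 h2
  rw [h1, chaosFunction, Set.indicator_of_mem hx, fieldVec, h2, norm_toL2_sq (h.memLp n hx)]

lemma aestronglyMeasurable_chaosFunction (h : IsStandardApproximation P U C X)
    (hU : MeasurableSet U) (β : ℝ) (n : ℕ) :
    AEStronglyMeasurable (fun p : Ω × Space d => chaosFunction P U β X n p.1 p.2)
      (P.prod volume) := by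
  have h1 : (fun p : Ω × Space d => chaosFunction P U β X n p.1 p.2)
      = (Set.univ ×ˢ U).indicator fun p : Ω × Space d =>
        Complex.exp (Complex.I * (β * X n p.2 p.1 : ℝ)
          + (β ^ 2 / 2 * ∫ ω', X n p.2 ω' ^ 2 ∂P : ℝ)) := by
    ext p
    by_cases hp : p.2 ∈ U
    · rw [chaosFunction, Set.indicator_of_mem hp,
        Set.indicator_of_mem (show p ∈ Set.univ ×ˢ U from ⟨Set.mem_univ _, hp⟩)]
    · rw [chaosFunction, Set.indicator_of_notMem hp, Set.indicator_of_notMem fun h => hp h.2]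
  rw [h1, aestronglyMeasurable_indicator_iff (MeasurableSet.univ.prod hU), ← Measure.prod_restrict,
    Measure.restrict_univ]
  have h2 : AEMeasurable (fun p : Ω × Space d => ∫ ω', X n p.2 ω' ^ 2 ∂P)
      (P.prod (volume.restrict U)) := by
    have h3 : AEMeasurable (fun x => ‖fieldVec P X n x‖ ^ 2) (volume.restrict U) :=
      ((h.continuousOn_fieldVec n).aestronglyMeasurable hU).norm.aemeasurable.pow_const 2
    refine (h3.comp_quasiMeasurePreserving Measure.quasiMeasurePreserving_snd).congr ?_
    filter_upwards [Measure.quasiMeasurePreserving_snd.ae (ae_restrict_mem hU)] with p hp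
    exact norm_toL2_sq (h.memLp n hp)
  have h4 := h.aemeasurable_uncurry hU n
  exact (Complex.measurable_exp.comp_aemeasurable
    (((Complex.measurable_ofReal.comp_aemeasurable (h4.const_mul β)).const_mul Complex.I).add
      (Complex.measurable_ofReal.comp_aemeasurable (h2.const_mul _)))).aestronglyMeasurable

variable (h : IsStandardApproximation P U C X) (hU : MeasurableSet U)
  (hint : ∀ n, IntegrableOn (fun x => Real.exp (β ^ 2 / 2 * ∫ ω, X n x ω ^ 2 ∂P)) U)
include h hU hint

lemma integrable_mul_chaosFunction (n : ℕ) {f : Space d → ℂ} (hf : AEStronglyMeasurable f)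
    {B : ℝ} (hfB : ∀ x, ‖f x‖ ≤ B) :
    Integrable (fun p : Ω × Space d => f p.2 * chaosFunction P U β X n p.1 p.2)
      (P.prod volume) := by
  have h1 : Integrable (fun p : Ω × Space d => B *
      U.indicator (fun x => Real.exp (β ^ 2 / 2 * ∫ ω, X n x ω ^ 2 ∂P)) p.2) (P.prod volume) :=
    (((integrable_indicator_iff hU).2 (hint n)).comp_snd P).const_mul B
  refine h1.mono' (hf.comp_snd.mul (h.aestronglyMeasurable_chaosFunction hU β n))
    (.of_forall fun p => ?_)
  rw [norm_mul, norm_chaosFunction]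
  exact mul_le_mul_of_nonneg_right (hfB _) (Set.indicator_nonneg (fun x _ => (Real.exp_pos _).le) _)

lemma integrable_chaosFunction (n : ℕ) :
    ∀ᵐ ω ∂P, Integrable (chaosFunction P U β X n ω) := by
  have := h.integrable_mul_chaosFunction hU hint n (f := fun _ => 1)
    aestronglyMeasurable_const (B := 1) (fun _ => by simp)
  simpa using this.prod_right_ae

/-- The integrals of the approximations as elements of `L²(P)`. -/
lemma integral_smul_wickExp_ae_eq (n : ℕ) {f : Space d → ℂ} (hf : AEStronglyMeasurable f)
    {B : ℝ} (hfB : ∀ x, ‖f x‖ ≤ B) :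
    (∫ x in U, f x • wickExp β (fieldVec P X n x) : Lp ℂ 2 P)
      =ᵐ[P] fun ω => ∫ x, f x * chaosFunction P U β X n ω x := by
  have h1 : Integrable (fun x => f x • wickExp β (fieldVec P X n x)) (volume.restrict U) :=
    (h.isWickField hU hint n).integrable.bdd_smul B hf.restrict (.of_forall hfB)
  have h2 : Integrable (fun p : Ω × Space d => f p.2 * chaosFunction P U β X n p.1 p.2)
      (P.prod (volume.restrict U)) := by
    have h3 : P.prod (volume.restrict U) = (P.prod volume).restrict (Set.univ ×ˢ U) := by
      rw [← Measure.prod_restrict, Measure.restrict_univ]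
    rw [h3]
    exact (h.integrable_mul_chaosFunction hU hint n hf hfB).restrict
  have h3 := coeFn_integral_ae_eq (P := P) h1
    (w := fun ω x => f x * chaosFunction P U β X n ω x) h2 (by
      filter_upwards [ae_restrict_mem hU] with x hx
      filter_upwards [h.wickExp_fieldVec_ae_eq (β := β) n hx,
        Lp.coeFn_smul (f x) (wickExp β (fieldVec P X n x))] with ω h4 h5
      rw [h5, Pi.smul_apply, h4, smul_eq_mul])
  filter_upwards [h3] with ω hω
  rw [hω]
  refine setIntegral_eq_integral_of_forall_compl_eq_zero fun x hx => ?_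
  rw [chaosFunction, Set.indicator_of_notMem hx, mul_zero]

/-- If the chaoses of two approximations are uniformly close in `L²(P)` over bounded test
functions, then they are close in `L²(P; H^s)`. -/
lemma lintegral_enorm_sub_sq_le (h' : IsStandardApproximation P U C' X')
    (hint' : ∀ n, IntegrableOn (fun x => Real.exp (β ^ 2 / 2 * ∫ ω, X' n x ω ^ 2 ∂P)) U)
    {s : ℝ} (hs : s < -(d : ℝ) / 2) {m n : ℕ} {δ : ℝ}
    (hδ : ∀ f : Space d → ℂ, AEStronglyMeasurable f (volume.restrict U) → (∀ x, ‖f x‖ ≤ 1) →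
      ‖∫ x in U, f x • (wickExp β (fieldVec P X m x) - wickExp β (fieldVec P X' n x))‖ ^ 2 ≤ δ) :
    ∫⁻ ω, ‖sobolevRep s (chaosFunction P U β X m ω)
        - sobolevRep s (chaosFunction P U β X' n ω)‖ₑ ^ 2 ∂P
      ≤ ENNReal.ofReal δ * ∫⁻ ξ : Space d, ‖sobolevWeight s ξ‖ₑ ^ 2 := by
  refine lintegral_enorm_sobolevRep_sub_sq_le hs (h.aestronglyMeasurable_chaosFunction hU β m)
    (h'.aestronglyMeasurable_chaosFunction hU β n) (h.integrable_chaosFunction hU hint m)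
    (h'.integrable_chaosFunction hU hint' n) fun ξ => ?_
  -- The Fourier coefficient at `ξ` is the integral against a character `f`.
  set f : Space d → ℂ := fun x => (Real.fourierChar (-inner ℝ x ξ) : ℂ) with hf
  have hfc : Continuous f := by
    have : Continuous fun t : ℝ => (Real.fourierChar t : ℂ) :=
      continuous_subtype_val.comp Real.continuous_fourierChar
    exact this.comp (by fun_prop)
  have hfm : AEStronglyMeasurable f := hfc.aestronglyMeasurable
  have hf1 : ∀ x, ‖f x‖ ≤ 1 := fun x => (Circle.norm_coe _).le
  set V := ∫ x in U, f x • wickExp β (fieldVec P X m x) with hV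
  set V' := ∫ x in U, f x • wickExp β (fieldVec P X' n x) with hV'
  have h1 : ∫⁻ ω, ‖𝓕 (chaosFunction P U β X m ω) ξ - 𝓕 (chaosFunction P U β X' n ω) ξ‖ₑ ^ 2 ∂P
      = ‖V - V'‖ₑ ^ 2 := by
    rw [Lp.enorm_def, eLpNorm_eq_lintegral_rpow_enorm_toReal two_ne_zero ENNReal.ofNat_ne_top,
      ENNReal.toReal_ofNat, ← ENNReal.rpow_two, ← ENNReal.rpow_mul, one_div,
      inv_mul_cancel₀ two_ne_zero, ENNReal.rpow_one]
    simp only [ENNReal.rpow_two]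
    refine lintegral_congr_ae ?_
    filter_upwards [h.integral_smul_wickExp_ae_eq hU hint m hfm hf1,
      h'.integral_smul_wickExp_ae_eq hU hint' n hfm hf1, Lp.coeFn_sub V V'] with ω h1 h2 h3
    rw [h3, Pi.sub_apply, hV, hV', h1, h2, Real.fourier_eq, Real.fourier_eq]
    rfl
  have h2 : V - V' = ∫ x in U, f x • (wickExp β (fieldVec P X m x)
      - wickExp β (fieldVec P X' n x)) := by
    simp only [smul_sub]
    rw [integral_sub (f := fun x => f x • wickExp β (fieldVec P X m x))
      (g := fun x => f x • wickExp β (fieldVec P X' n x))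
      ((h.isWickField hU hint m).integrable.bdd_smul 1 hfm.restrict (.of_forall hf1))
      ((h'.isWickField hU hint' n).integrable.bdd_smul 1 hfm.restrict (.of_forall hf1))]
  rw [h1, h2, ← ofReal_norm, ← ENNReal.ofReal_pow (norm_nonneg _)]
  exact ENNReal.ofReal_le_ofReal (hδ f hfm.restrict hf1)

end IsStandardApproximation

end

/-! ### Convergence in probability in Sobolev spaces -/

section

section Convergence

variable {Ω : Type*} [MeasurableSpace Ω] {P : Measure Ω}

/-- Sequences which are Cauchy in mean square converge in probability. -/
lemma exists_tendstoInMeasure_of_lintegral_sub_sq_le {V : Type*} [NormedAddCommGroup V]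
    [CompleteSpace V] {F : ℕ → Ω → V} (hF : ∀ n, AEStronglyMeasurable (F n) P)
    {δ : ℕ × ℕ → ℝ≥0∞} (hδ0 : ∀ p, δ p ≠ ∞) (hδ : Tendsto δ atTop (𝓝 0))
    (hle : ∀ p, ∫⁻ ω, ‖F p.1 ω - F p.2 ω‖ₑ ^ 2 ∂P ≤ δ p) :
    ∃ G : Ω → V, AEStronglyMeasurable G P ∧ TendstoInMeasure P F atTop G := by
  have hnorm : ∀ m n, eLpNorm (F m - F n) 2 P ≤ δ (m, n) ^ (1 / (2 : ℝ)) := fun m n => by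
    rw [eLpNorm_eq_lintegral_rpow_enorm_toReal two_ne_zero ENNReal.ofNat_ne_top,
      ENNReal.toReal_ofNat]
    simp only [ENNReal.rpow_two, Pi.sub_apply]
    exact ENNReal.rpow_le_rpow (hle (m, n)) (by norm_num)
  have hmem : ∀ n, MemLp (F n - F 0) 2 P := fun n =>
    ⟨(hF n).sub (hF 0), (hnorm n 0).trans_lt
      (ENNReal.rpow_lt_top_of_nonneg (by norm_num) (hδ0 _))⟩
  set H : ℕ → Lp V 2 P := fun n => (hmem n).toLp _ with hH
  have hdist : ∀ p : ℕ × ℕ, dist (H p.1) (H p.2) ≤ (δ p ^ (1 / (2 : ℝ))).toReal := fun p => by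
    rw [dist_edist, hH, Lp.edist_toLp_toLp]
    refine ENNReal.toReal_mono (ENNReal.rpow_lt_top_of_nonneg (by norm_num) (hδ0 _)).ne ?_
    rw [sub_sub_sub_cancel_right]
    exact hnorm _ _
  have hlim : Tendsto (fun p => (δ p ^ (1 / (2 : ℝ))).toReal) atTop (𝓝 0) := by
    have h1 := (ENNReal.continuous_rpow_const (y := 1 / (2 : ℝ))).tendsto 0 |>.comp hδ
    rw [ENNReal.zero_rpow_of_pos (by norm_num)] at h1
    simpa [Function.comp_def] using (ENNReal.tendsto_toReal ENNReal.zero_ne_top).comp h1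
  have hc : CauchySeq H := cauchySeq_iff_tendsto_dist_atTop_0.2
    (squeeze_zero (fun _ => dist_nonneg) hdist hlim)
  obtain ⟨G, hG⟩ := cauchySeq_tendsto_of_complete hc
  refine ⟨fun ω => G ω + F 0 ω, (Lp.aestronglyMeasurable G).add (hF 0), ?_⟩
  have h1 := tendstoInMeasure_of_tendsto_Lp hG
  intro ε hε
  refine (h1 ε hε).congr fun n => measure_congr ?_
  filter_upwards [(hmem n).coeFn_toLp] with ω hω
  change (ε ≤ edist (H n ω) (G ω)) = (ε ≤ edist (F n ω) (G ω + F 0 ω))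
  rw [hH, hω, Pi.sub_apply, edist_eq_enorm_sub, edist_eq_enorm_sub, ← sub_sub, sub_right_comm]

variable {d : ℕ} {s : ℝ} {μn : ℕ → Ω → 𝓢'(Space d, ℂ)} {μ : Ω → 𝓢'(Space d, ℂ)}
  {F : ℕ → Ω → Lp ℂ 2 (volume : Measure (Space d))} {G : Ω → Lp ℂ 2 (volume : Measure (Space d))}

lemma convergesInProbability_of_tendstoInMeasure (hF : ∀ n, AEStronglyMeasurable (F n) P)
    (hG : AEStronglyMeasurable G P) (hμn : ∀ n, ∀ᵐ ω ∂P, weightedFourier s (μn n ω) = F n ω)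
    (hμ : ∀ᵐ ω ∂P, weightedFourier s (μ ω) = G ω) (h : TendstoInMeasure P F atTop G) :
    ConvergesInProbability P s μn μ where
  approx n := ⟨F n, hF n, hμn n⟩
  limit := ⟨G, hG, hμ⟩
  tendsto ε hε := by
    refine (h ε hε).congr fun n => measure_congr ?_
    filter_upwards [hμn n, hμ] with ω h1 h2
    change (ε ≤ edist (F n ω) (G ω)) = (ε ≤ sobolevENorm s (μn n ω - μ ω))
    rw [sobolevENorm_sub_eq h1 h2, edist_eq_enorm_sub]

lemma ConvergesInProbability.comp (h : ConvergesInProbability P s μn μ) {ns : ℕ → ℕ}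
    (hns : Tendsto ns atTop atTop) : ConvergesInProbability P s (fun k => μn (ns k)) μ where
  approx _ := h.approx _
  limit := h.limit
  tendsto ε hε := (h.tendsto ε hε).comp hns

/-- Convergence in probability in a Sobolev space implies almost sure convergence of a subsequence
as tempered distributions. -/
lemma ConvergesInProbability.exists_seq_tendsto_ae (h : ConvergesInProbability P s μn μ) :
    ∃ ns : ℕ → ℕ, StrictMono ns ∧
      ∀ᵐ ω ∂P, Tendsto (fun k => μn (ns k) ω) atTop (𝓝 (μ ω)) := by
  choose F hF hμn using h.approx
  obtain ⟨G, hG, hμ⟩ := h.limit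
  have h1 : TendstoInMeasure P F atTop G := fun ε hε => by
    refine (h.tendsto ε hε).congr fun n => measure_congr ?_
    filter_upwards [hμn n, hμ] with ω h1 h2
    change (ε ≤ sobolevENorm s (μn n ω - μ ω)) = (ε ≤ edist (F n ω) (G ω))
    rw [sobolevENorm_sub_eq h1 h2, edist_eq_enorm_sub]
  obtain ⟨ns, hns, hae⟩ := h1.exists_seq_tendsto_ae
  refine ⟨ns, hns, ?_⟩
  filter_upwards [hae, hμ, ae_all_iff.2 hμn] with ω h2 h3 h4
  rw [weightedFourier_eq_iff.1 h3]
  simp only [fun k => weightedFourier_eq_iff.1 (h4 (ns k))]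
  exact ((sobolevEmbedding s).continuous.tendsto _).comp h2

end Convergence

variable {d : ℕ} {Ω : Type*} [MeasurableSpace Ω] {P : Measure Ω} [IsProbabilityMeasure P]
  {U : Set (Space d)} {g : Space d → Space d → ℝ} {X : ℕ → Space d → Ω → ℝ} {β : ℝ}

lemma lintegral_sobolevWeight_sq_ne_top {s : ℝ} (hs : s < -(d : ℝ) / 2) :
    ∫⁻ ξ : Space d, ‖sobolevWeight s ξ‖ₑ ^ 2 ≠ ∞ := by
  have h := eLpNorm_lt_top_iff_lintegral_rpow_enorm_lt_top (p := 2) two_ne_zero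
    ENNReal.ofNat_ne_top |>.1 (memLp_sobolevWeight hs).2
  simpa using h.ne

namespace IsStandardApproximation

/-- The limit in `L²(P; H^s)` defines one and the same random distribution for all `s < -d/2`. -/
theorem exists_limit (hC : IsLogCovariance U g)
    (h : IsStandardApproximation P U (logKernel U g) X) (hd : 0 < d) (hβ : β ^ 2 < d)
    (hint : ∀ n, IntegrableOn (fun x => Real.exp (β ^ 2 / 2 * ∫ ω, X n x ω ^ 2 ∂P)) U) :
    ∃ μ : Ω → 𝓢'(Space d, ℂ), ∀ s : ℝ, s < -(d : ℝ) / 2 →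
      ConvergesInProbability P s (chaosApprox P U β X) μ := by
  have hU := hC.isOpen.measurableSet
  obtain ⟨δ, hδ, hle⟩ := exists_tendsto_norm_sub_sq_le hC h hd hβ hint
  have hF : ∀ s n, AEStronglyMeasurable
      (fun ω => sobolevRep s (chaosFunction P U β X n ω)) P := fun s n =>
    aestronglyMeasurable_sobolevRep (h.aestronglyMeasurable_chaosFunction hU β n)
  have hμn : ∀ s, s < -(d : ℝ) / 2 → ∀ n, ∀ᵐ ω ∂P,
      weightedFourier s (chaosApprox P U β X n ω) = sobolevRep s (chaosFunction P U β X n ω) :=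
    fun s hs n => (h.integrable_chaosFunction hU hint n).mono fun ω hω =>
      weightedFourier_ofFunction hs hω
  have hG : ∀ s, s < -(d : ℝ) / 2 → ∃ G : Ω → Lp ℂ 2 (volume : Measure (Space d)),
      AEStronglyMeasurable G P ∧ TendstoInMeasure P
        (fun n ω => sobolevRep s (chaosFunction P U β X n ω)) atTop G := fun s hs => by
    have hI := lintegral_sobolevWeight_sq_ne_top hs
    refine exists_tendstoInMeasure_of_lintegral_sub_sq_le (hF s)
      (δ := fun p => ENNReal.ofReal (δ p) * ∫⁻ ξ : Space d, ‖sobolevWeight s ξ‖ₑ ^ 2)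
      (fun p => ENNReal.mul_ne_top ENNReal.ofReal_ne_top hI) ?_
      fun p => h.lintegral_enorm_sub_sq_le hU hint h hint hs (hle p)
    have h1 := ENNReal.Tendsto.mul_const (ENNReal.tendsto_ofReal hδ) (Or.inr hI)
    simpa using h1
  have hs₀ : -(d : ℝ) / 2 - 1 < -(d : ℝ) / 2 := by linarith
  set s₀ := -(d : ℝ) / 2 - 1
  obtain ⟨G₀, hG₀, hlim₀⟩ := hG s₀ hs₀
  have hconv : ∀ s, s < -(d : ℝ) / 2 → ∀ G : Ω → Lp ℂ 2 (volume : Measure (Space d)),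
      AEStronglyMeasurable G P → TendstoInMeasure P
        (fun n ω => sobolevRep s (chaosFunction P U β X n ω)) atTop G →
      ConvergesInProbability P s (chaosApprox P U β X) fun ω => sobolevEmbedding s (G ω) :=
    fun s hs G hG hlim => convergesInProbability_of_tendstoInMeasure (hF s) hG (hμn s hs)
      (.of_forall fun ω => weightedFourier_eq_iff.2 rfl) hlim
  refine ⟨fun ω => sobolevEmbedding s₀ (G₀ ω), fun s hs => ?_⟩
  obtain ⟨G, hGm, hlim⟩ := hG s hs
  refine convergesInProbability_of_tendstoInMeasure (hF s) hGm (hμn s hs) ?_ hlim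
  obtain ⟨ns, hns, hae⟩ := (hconv s hs G hGm hlim).exists_seq_tendsto_ae
  obtain ⟨ms, hms, hae₀⟩ :=
    ((hconv s₀ hs₀ G₀ hG₀ hlim₀).comp hns.tendsto_atTop).exists_seq_tendsto_ae
  filter_upwards [hae, hae₀] with ω h1 h2
  rw [weightedFourier_eq_iff]
  exact tendsto_nhds_unique h2 (h1.comp hms.tendsto_atTop)

lemma dsupport_subset (hU : MeasurableSet U) {C : Space d → Space d → ℝ}
    (h : IsStandardApproximation P U C X)
    (hint : ∀ n, IntegrableOn (fun x => Real.exp (β ^ 2 / 2 * ∫ ω, X n x ω ^ 2 ∂P)) U)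
    {s : ℝ} {μ : Ω → 𝓢'(Space d, ℂ)}
    (hμ : ConvergesInProbability P s (chaosApprox P U β X) μ) :
    ∀ᵐ ω ∂P, Distribution.dsupport (μ ω) ⊆ closure U := by
  obtain ⟨ns, -, hae⟩ := hμ.exists_seq_tendsto_ae
  filter_upwards [hae, ae_all_iff.2 (h.integrable_chaosFunction hU hint)] with ω h1 h2
  refine Set.sInter_subset_of_mem ⟨fun φ hφ => ?_, isClosed_closure⟩
  have h3 := PointwiseConvergenceCLM.tendsto_iff_forall_tendsto.1 h1 φ
  refine tendsto_nhds_unique h3 ?_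
  have h4 : ∀ n, chaosApprox P U β X n ω φ = 0 := fun n => by
    rw [chaosApprox, ofFunction_apply (h2 n)]
    refine integral_eq_zero_of_ae (.of_forall fun x => ?_)
    by_cases hx : x ∈ U
    · have : φ x = 0 := by
        by_contra hne
        exact hφ (subset_tsupport _ hne) (subset_closure hx)
      simp [this]
    · simp [chaosFunction, hx]
  simp only [h4]
  exact tendsto_const_nhds

end IsStandardApproximation

end

/-! ### Non-triviality of the limit -/

section

variable {d : ℕ} {Ω : Type*} [MeasurableSpace Ω] {P : Measure Ω} [IsProbabilityMeasure P]
  {U : Set (Space d)} {g : Space d → Space d → ℝ} {X : ℕ → Space d → Ω → ℝ} {β : ℝ}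

namespace IsLogCovariance

/-- The covariance kernel is positive near any point of the diagonal. -/
lemma exists_logKernel_pos (hC : IsLogCovariance U g) :
    ∃ x₀ ∈ U, ∃ r : ℝ, 0 < r ∧ Metric.ball x₀ r ⊆ U ∧
      ∀ x ∈ Metric.ball x₀ r, ∀ y ∈ Metric.ball x₀ r, x ≠ y → 0 < logKernel U g x y := by
  obtain ⟨x₀, hx₀⟩ := hC.isSimplyConnected.isPathConnected.nonempty
  have h1 : ContinuousAt (fun z : Space d × Space d => g z.1 z.2) (x₀, x₀) :=
    hC.continuousOn.continuousAt ((hC.isOpen.prod hC.isOpen).mem_nhds ⟨hx₀, hx₀⟩)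
  have h2 : ∀ᶠ z in 𝓝 (x₀, x₀), g x₀ x₀ - 1 < g z.1 z.2 :=
    h1.eventually (lt_mem_nhds (by simp))
  obtain ⟨r₁, hr₁, h3⟩ := Metric.eventually_nhds_iff_ball.1 h2
  obtain ⟨r₂, hr₂, h4⟩ := Metric.isOpen_iff.1 hC.isOpen x₀ hx₀
  set r := min (min r₁ r₂) (Real.exp (g x₀ x₀ - 1) / 2) with hr
  have hr0 : 0 < r := by positivity
  have hrU : Metric.ball x₀ r ⊆ U :=
    (Metric.ball_subset_ball ((min_le_left _ _).trans (min_le_right _ _))).trans h4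
  refine ⟨x₀, hx₀, r, hr0, hrU, fun x hx y hy hne => ?_⟩
  rw [logKernel_of_mem (hrU hx) (hrU hy)]
  have h5 : g x₀ x₀ - 1 < g x y := by
    refine h3 (x, y) ?_
    rw [← ball_prod_same]
    have h6 := Metric.ball_subset_ball (x := x₀)
      ((min_le_left _ _).trans (min_le_left _ _) : r ≤ r₁)
    exact ⟨h6 hx, h6 hy⟩
  have h6 : 0 < ‖x - y‖ := norm_pos_iff.2 (sub_ne_zero.2 hne)
  have h7 : ‖x - y‖ < Real.exp (g x₀ x₀ - 1) := by
    rw [← dist_eq_norm]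
    have h8 := dist_triangle_right x y x₀
    have h9 : r ≤ Real.exp (g x₀ x₀ - 1) / 2 := min_le_right _ _
    rw [Metric.mem_ball] at hx hy
    linarith
  have h8 : Real.log ‖x - y‖ < g x₀ x₀ - 1 := (Real.log_lt_iff_lt_exp h6).2 h7
  rw [one_div, Real.log_inv]
  linarith

end IsLogCovariance

namespace IsStandardApproximation

variable (hC : IsLogCovariance U g) (h : IsStandardApproximation P U (logKernel U g) X)
  (hd : 0 < d) (hβ : β ^ 2 < d)
  (hint : ∀ n, IntegrableOn (fun x => Real.exp (β ^ 2 / 2 * ∫ ω, X n x ω ^ 2 ∂P)) U)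
include hC h hd hβ hint

/-- The limit tested against a function `φ` bounded by `1` is the limit in `L²(P)` of the
approximations. -/
lemma exists_tendsto_integral_smul {s : ℝ} {μ : Ω → 𝓢'(Space d, ℂ)}
    (hμ : ConvergesInProbability P s (chaosApprox P U β X) μ) {φ : 𝓢(Space d, ℂ)}
    (hφ : ∀ x, ‖φ x‖ ≤ 1) :
    ∃ V : Lp ℂ 2 P, (V =ᵐ[P] fun ω => μ ω φ) ∧
      Tendsto (fun n => ∫ x in U, φ x • wickExp β (fieldVec P X n x)) atTop (𝓝 V) := by
  have hU := hC.isOpen.measurableSet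
  have hφm : AEStronglyMeasurable φ (volume : Measure (Space d)) :=
    φ.continuous.aestronglyMeasurable
  set V : ℕ → Lp ℂ 2 P := fun n => ∫ x in U, φ x • wickExp β (fieldVec P X n x) with hV
  obtain ⟨δ, hδ, hle⟩ := exists_tendsto_norm_sub_sq_le hC h hd hβ hint
  have hdist : ∀ p : ℕ × ℕ, dist (V p.1) (V p.2) ≤ √(δ p) := fun p => by
    refine Real.le_sqrt_of_sq_le ?_
    have h1 := hle p φ hφm.restrict hφ
    simp only [smul_sub] at h1
    rwa [integral_sub (f := fun x => φ x • wickExp β (fieldVec P X p.1 x))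
      (g := fun x => φ x • wickExp β (fieldVec P X p.2 x))
      ((h.isWickField hU hint p.1).integrable.bdd_smul 1 hφm.restrict (.of_forall hφ))
      ((h.isWickField hU hint p.2).integrable.bdd_smul 1 hφm.restrict (.of_forall hφ)),
      ← dist_eq_norm] at h1
  have hc : CauchySeq V := cauchySeq_iff_tendsto_dist_atTop_0.2
    (squeeze_zero (fun _ => dist_nonneg) hdist (by simpa using hδ.sqrt))
  obtain ⟨W, hW⟩ := cauchySeq_tendsto_of_complete hc
  refine ⟨W, ?_, hW⟩
  obtain ⟨ns, hns, hae⟩ := hμ.exists_seq_tendsto_ae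
  obtain ⟨ms, hms, hae'⟩ :=
    (tendstoInMeasure_of_tendsto_Lp (hW.comp hns.tendsto_atTop)).exists_seq_tendsto_ae
  filter_upwards [hae, hae', ae_all_iff.2 (h.integrable_chaosFunction hU hint),
    ae_all_iff.2 fun n => h.integral_smul_wickExp_ae_eq hU hint n hφm hφ] with ω h1 h2 h3 h4
  refine tendsto_nhds_unique h2 ?_
  have h5 := (PointwiseConvergenceCLM.tendsto_iff_forall_tendsto.1 h1 φ).comp hms.tendsto_atTop
  refine h5.congr fun k => ?_
  simp only [Function.comp_apply, hV]
  rw [h4, chaosApprox, ofFunction_apply (h3 _)]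

/-- If the limit were deterministic, its variance `∬ φ φ (exp (β² C) - 1)` against a bump function
`φ` would vanish, but the covariance `C` is positive near the diagonal. -/
lemma not_ae_eq_const (hβ0 : 0 < β) {s : ℝ} {μ : Ω → 𝓢'(Space d, ℂ)}
    (hμ : ConvergesInProbability P s (chaosApprox P U β X) μ) (ν : 𝓢'(Space d, ℂ)) :
    ¬ ∀ᵐ ω ∂P, μ ω = ν := by
  intro hν
  have hU := hC.isOpen.measurableSet
  have : IsFiniteMeasure (volume.restrict U) := ⟨by simpa using hC.isBounded.measure_lt_top⟩
  obtain ⟨x₀, hx₀, r, hr, hrU, hpos⟩ := hC.exists_logKernel_pos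
  let b : ContDiffBump x₀ := ⟨r / 2, r, by linarith, by linarith⟩
  have hbs : HasCompactSupport fun x => (b x : ℂ) :=
    b.hasCompactSupport.comp_left (g := fun t : ℝ => (t : ℂ)) Complex.ofReal_zero
  have hbd : ContDiff ℝ (⊤ : ℕ∞) fun x => (b x : ℂ) := Complex.ofRealCLM.contDiff.comp b.contDiff
  set φ : 𝓢(Space d, ℂ) := hbs.toSchwartzMap hbd with hφdef
  have hφb : ∀ x, φ x = (b x : ℂ) := fun x => rfl
  have hb1 : ∀ x, ‖φ x‖ ≤ 1 := fun x => by
    rw [hφb, Complex.norm_real, Real.norm_eq_abs, abs_of_nonneg b.nonneg]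
    exact b.le_one
  obtain ⟨V, hVμ, hV⟩ := exists_tendsto_integral_smul hC h hd hβ hint hμ hb1
  have hφm : AEStronglyMeasurable φ (volume : Measure (Space d)) :=
    φ.continuous.aestronglyMeasurable
  have hφW : ∀ n, Integrable (fun x => φ x • wickExp β (fieldVec P X n x)) (volume.restrict U) :=
    fun n => (h.isWickField hU hint n).integrable.bdd_smul 1 hφm.restrict (.of_forall hb1)
  set w : Space d × Space d → ℝ := fun z => b z.1 * b z.2 with hw
  have hw0 : ∀ z, 0 ≤ w z := fun z => mul_nonneg b.nonneg b.nonneg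
  have hwc : Continuous w :=
    (b.continuous.comp continuous_fst).mul (b.continuous.comp continuous_snd)
  have hw1 : ∀ z, |w z| ≤ 1 := fun z => by
    rw [abs_of_nonneg (hw0 z)]
    exact mul_le_one₀ b.le_one b.nonneg b.le_one
  have hnorm : ∀ n, ‖∫ x in U, φ x • wickExp β (fieldVec P X n x)‖ ^ 2
      = ∫ z, w z * Real.exp (β ^ 2 * crossCov (fieldVec P X n) (fieldVec P X n) z)
        ∂((volume.restrict U).prod (volume.restrict U)) := fun n => by
    have h1 := inner_self_eq_norm_sq_to_K (𝕜 := ℂ)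
      (∫ x in U, φ x • wickExp β (fieldVec P X n x))
    rw [inner_integral_integral (hφW n) (hφW n)] at h1
    have h2 : ∫ z, inner ℂ (φ z.1 • wickExp β (fieldVec P X n z.1))
        (φ z.2 • wickExp β (fieldVec P X n z.2)) ∂((volume.restrict U).prod (volume.restrict U))
        = ∫ z, ((w z * Real.exp (β ^ 2 * crossCov (fieldVec P X n) (fieldVec P X n) z) : ℝ) : ℂ)
          ∂((volume.restrict U).prod (volume.restrict U)) := by
      refine integral_congr_ae ?_
      filter_upwards [(h.isWickField hU hint n).inner_wickExp_ae (h.gaussianSpace_subset β)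
        (h.isWickField hU hint n)] with z hz
      rw [inner_smul_left, inner_smul_right, hz, hφb, hφb, Complex.conj_ofReal, hw]
      push_cast
      ring
    rw [h2, integral_complex_ofReal] at h1
    have h3 := congrArg Complex.re h1.symm
    rwa [Complex.ofReal_re, ← RCLike.ofReal_pow, RCLike.ofReal_eq_complex_ofReal,
      Complex.ofReal_re] at h3
  have hlim := tendsto_integral_mul_exp hC h hd hβ hwc.measurable hw1
  simp only [← hnorm] at hlim
  -- The second moment of the limit is the integral of `φ(x) φ(y) exp (β² C(x, y))`.
  have hV2 := tendsto_nhds_unique (hV.norm.pow 2) hlim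
  -- The mean of the approximations does not depend on `n`; it is read off by pairing with the
  -- constant `1 = wickExp β 0`.
  have hmean : inner ℂ (wickExp β 0) V = ((∫ x in U, b x : ℝ) : ℂ) := by
    have h1 : Tendsto (fun n => inner ℂ (wickExp β (0 : Lp ℝ 2 P))
        (∫ x in U, φ x • wickExp β (fieldVec P X n x))) atTop (𝓝 (inner ℂ (wickExp β 0) V)) :=
      tendsto_const_nhds.inner hV
    refine tendsto_nhds_unique h1 (tendsto_const_nhds.congr fun n => ?_)
    rw [← integral_inner (hφW n), ← integral_complex_ofReal]
    refine setIntegral_congr_fun hU fun x hx => ?_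
    rw [inner_smul_right, inner_wickExp (h.gaussianSpace_subset β (Submodule.sub_mem _
      (fieldVec_mem n hx) (Submodule.zero_mem _))), inner_zero_left, hφb]
    simp
  have hVc : V = ν φ • wickExp β (0 : Lp ℝ 2 P) := by
    refine Lp.ext ?_
    filter_upwards [hVμ, hν, coeFn_wickExp β (0 : Lp ℝ 2 P),
      Lp.coeFn_smul (ν φ) (wickExp β (0 : Lp ℝ 2 P)), Lp.coeFn_zero ℝ 2 P] with ω h1 h2 h3 h4 h5
    rw [h1, h2, h4, Pi.smul_apply, h3, h5]
    simp
  have hone : ‖wickExp β (0 : Lp ℝ 2 P)‖ = 1 := by rw [norm_wickExp]; simp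
  rw [hVc, inner_smul_right, inner_self_eq_norm_sq_to_K, hone] at hmean
  rw [hVc, norm_smul, hone, mul_one] at hV2
  have hm : ν φ = ((∫ x in U, b x : ℝ) : ℂ) := by simpa using hmean
  rw [hm, Complex.norm_real, Real.norm_eq_abs, sq_abs, sq, ← integral_prod_mul] at hV2
  have hK := integrable_exp_logKernel hC h hd hβ
  have hwK : Integrable (fun z => w z * Real.exp (β ^ 2 * logKernel U g z.1 z.2))
      ((volume.restrict U).prod (volume.restrict U)) :=
    hK.bdd_mul (c := 1) hwc.aestronglyMeasurable (.of_forall hw1)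
  have hwi : Integrable w ((volume.restrict U).prod (volume.restrict U)) :=
    Integrable.of_bound hwc.aestronglyMeasurable 1 (.of_forall hw1)
  have hzero : ∫ z, w z * (Real.exp (β ^ 2 * logKernel U g z.1 z.2) - 1)
      ∂((volume.restrict U).prod (volume.restrict U)) = 0 := by
    simp only [mul_sub, mul_one]
    rw [integral_sub hwK hwi, ← hV2, sub_self]
  have hball : ∀ {x}, b x ≠ 0 → x ∈ Metric.ball x₀ r := fun {x} hx => by
    have : x ∈ Function.support b := hx
    rwa [b.support_eq] at this
  have hnn : 0 ≤ᵐ[(volume.restrict U).prod (volume.restrict U)]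
      fun z => w z * (Real.exp (β ^ 2 * logKernel U g z.1 z.2) - 1) := by
    filter_upwards [ae_ne_of_pos hd U] with z hz
    rcases eq_or_ne (w z) 0 with h0 | h0
    · simp [h0]
    · have h1 := hpos _ (hball (left_ne_zero_of_mul h0)) _ (hball (right_ne_zero_of_mul h0)) hz
      exact mul_nonneg (hw0 z) (sub_nonneg.2 (Real.one_le_exp (by positivity)))
  have hae := (integral_eq_zero_iff_of_nonneg_ae hnn
    ((hwK.sub hwi).congr (.of_forall fun z => by simp [mul_sub]))).1 hzero
  have hnull : ((volume.restrict U).prod (volume.restrict U))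
      (Metric.ball x₀ r ×ˢ Metric.ball x₀ r) = 0 := by
    rw [measure_eq_zero_iff_ae_notMem]
    filter_upwards [hae, ae_ne_of_pos hd U] with z h1 h2 h3
    have h4 := hpos _ h3.1 _ h3.2 h2
    have h5 : 1 < Real.exp (β ^ 2 * logKernel U g z.1 z.2) :=
      Real.one_lt_exp_iff.2 (by positivity)
    have h6 : ∀ {x}, x ∈ Metric.ball x₀ r → 0 < b x := fun {x} hx => b.pos_of_mem_ball hx
    have h7 : 0 < w z * (Real.exp (β ^ 2 * logKernel U g z.1 z.2) - 1) :=
      mul_pos (mul_pos (h6 h3.1) (h6 h3.2)) (sub_pos.2 h5)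
    exact h7.ne' h1
  rw [Measure.prod_prod, mul_self_eq_zero, Measure.restrict_apply Metric.isOpen_ball.measurableSet,
    Set.inter_eq_left.2 hrU] at hnull
  exact (Metric.measure_ball_pos volume x₀ hr).ne' hnull

end IsStandardApproximation

end

/-! ### Averages over the cells of a finite partition -/

section CellAverage

variable {E ι V : Type*} [MeasurableSpace E] {lam : Measure E} [IsFiniteMeasure lam]
  {σ : SimpleFunc E ι} [NormedAddCommGroup V] [NormedSpace ℝ V]

variable (lam σ) in
/-- The average of `F` over the cell of `x`, for the finite partition of the space into the fibres
of a simple function `σ`. The value is zero on cells of measure zero. -/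
def cellAverage (F : E → V) (x : E) : V := ⨍ y in σ ⁻¹' {σ x}, F y ∂lam

lemma cellAverage_eq_map (F : E → V) :
    cellAverage lam σ F = σ.map fun a => ⨍ y in σ ⁻¹' {a}, F y ∂lam := rfl

lemma cellAverage_eq_of_mem {F : E → V} {a : ι} {x : E} (hx : x ∈ σ ⁻¹' {a}) :
    cellAverage lam σ F x = ⨍ y in σ ⁻¹' {a}, F y ∂lam := by
  rw [cellAverage, show σ x = a from hx]

variable (lam σ) in
lemma ae_measure_cell_ne_zero : ∀ᵐ x ∂lam, lam (σ ⁻¹' {σ x}) ≠ 0 := by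
  have h : ∀ᵐ x ∂lam, ∀ a ∈ σ.range, x ∈ σ ⁻¹' {a} → lam (σ ⁻¹' {a}) ≠ 0 := by
    rw [Filter.eventually_all_finset]
    intro a _
    by_cases ha : lam (σ ⁻¹' {a}) = 0
    · filter_upwards [measure_eq_zero_iff_ae_notMem.1 ha] with x hx h
      exact absurd h hx
    · exact .of_forall fun _ _ => ha
  filter_upwards [h] with x hx
  exact hx _ (σ.mem_range_self x) rfl

lemma integral_eq_sum_cells {F : E → V} (hF : Integrable F lam) :
    ∫ x, F x ∂lam = ∑ a ∈ σ.range, ∫ x in σ ⁻¹' {a}, F x ∂lam := by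
  rw [← integral_biUnion_finset _ (fun a _ => σ.measurableSet_fiber a)
    (fun a _ b _ hab => Set.disjoint_left.2 fun x ha hb => hab (ha.symm.trans hb))
    (fun _ _ => hF.integrableOn)]
  have : ⋃ a ∈ σ.range, σ ⁻¹' {a} = Set.univ :=
    Set.eq_univ_of_forall fun x => Set.mem_biUnion (σ.mem_range_self x) rfl
  rw [this, setIntegral_univ]

lemma integrable_cellAverage (F : E → V) : Integrable (cellAverage lam σ F) lam := by
  rw [cellAverage_eq_map]
  exact SimpleFunc.integrable_of_isFiniteMeasure _

lemma integral_cellAverage [CompleteSpace V] {F : E → V} (hF : Integrable F lam) :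
    ∫ x, cellAverage lam σ F x ∂lam = ∫ x, F x ∂lam := by
  rw [integral_eq_sum_cells (σ := σ) hF, integral_eq_sum_cells (σ := σ) (integrable_cellAverage F)]
  refine Finset.sum_congr rfl fun a _ => ?_
  rw [setIntegral_congr_fun (σ.measurableSet_fiber a) fun x hx => cellAverage_eq_of_mem hx,
    setIntegral_const, measure_smul_setAverage _ (measure_ne_top _ _)]

lemma norm_cellAverage_le (F : E → V) (x : E) :
    ‖cellAverage lam σ F x‖ ≤ cellAverage lam σ (fun y => ‖F y‖) x := by
  rw [cellAverage, cellAverage, setAverage_eq, setAverage_eq, norm_smul, norm_inv, smul_eq_mul,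
    Real.norm_eq_abs, abs_of_nonneg measureReal_nonneg]
  exact mul_le_mul_of_nonneg_left (norm_integral_le_integral_norm _) (by positivity)

lemma cellAverage_sub {F G : E → V} (hF : Integrable F lam) (hG : Integrable G lam) (x : E) :
    cellAverage lam σ (fun y => F y - G y) x = cellAverage lam σ F x - cellAverage lam σ G x := by
  rw [cellAverage, setAverage_eq, integral_sub hF.integrableOn hG.integrableOn, smul_sub,
    ← setAverage_eq, ← setAverage_eq]
  rfl

lemma cellAverage_mem [CompleteSpace V] {F : E → V} (hF : Integrable F lam) {S : Submodule ℝ V}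
    (hS : IsClosed (S : Set V)) (hFS : ∀ᵐ x ∂lam, F x ∈ S) :
    ∀ᵐ x ∂lam, cellAverage lam σ F x ∈ S := by
  filter_upwards [ae_measure_cell_ne_zero lam σ] with x hx
  exact S.convex.set_average_mem hS hx (measure_ne_top _ _) (ae_restrict_of_ae hFS)
    hF.integrableOn

lemma inner_cellAverage {H : Type*} [NormedAddCommGroup H] [InnerProductSpace ℝ H]
    [CompleteSpace H] {F : E → H} (hF : Integrable F lam) (v : H) (x : E) :
    inner ℝ (cellAverage lam σ F x) v = cellAverage lam σ (fun y => inner ℝ (F y) v) x := by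
  rw [cellAverage, cellAverage, setAverage_eq, setAverage_eq, real_inner_smul_left, smul_eq_mul,
    real_inner_comm, ← integral_inner hF.integrableOn]
  simp only [real_inner_comm v]

lemma integrable_cellAverage_fst {u : E × E → ℝ} (hu : Integrable u (lam.prod lam)) :
    Integrable (fun z : E × E => cellAverage lam σ (fun x => u (x, z.2)) z.1) (lam.prod lam) := by
  classical
  have h1 : (fun z : E × E => cellAverage lam σ (fun x => u (x, z.2)) z.1)
      = fun z => ∑ a ∈ σ.range, (σ ⁻¹' {a}).indicator (fun _ => (lam.real (σ ⁻¹' {a}))⁻¹) z.1 *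
        ∫ x in σ ⁻¹' {a}, u (x, z.2) ∂lam := by
    ext z
    rw [Finset.sum_eq_single (σ z.1)]
    · rw [Set.indicator_of_mem (by rfl), cellAverage, setAverage_eq, smul_eq_mul]
    · intro a _ ha
      have h2 : z.1 ∉ σ ⁻¹' {a} := fun h => ha (Eq.symm h)
      rw [Set.indicator_of_notMem h2, zero_mul]
    · exact fun h => absurd (σ.mem_range_self _) h
  rw [h1]
  refine integrable_finsetSum _ fun a _ => ?_
  refine Integrable.mul_prod ((integrable_const _).indicator (σ.measurableSet_fiber a))
    (g := fun y => ∫ x in σ ⁻¹' {a}, u (x, y) ∂lam) ?_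
  have h2 : Integrable u ((lam.restrict (σ ⁻¹' {a})).prod lam) := by
    have h3 : (lam.restrict (σ ⁻¹' {a})).prod lam
        = (lam.prod lam).restrict ((σ ⁻¹' {a}) ×ˢ Set.univ) := by
      rw [← Measure.prod_restrict, Measure.restrict_univ]
    rw [h3]
    exact hu.restrict
  exact h2.integral_prod_right

lemma integral_cellAverage_fst {u : E × E → ℝ} (hu : Integrable u (lam.prod lam)) :
    ∫ z : E × E, cellAverage lam σ (fun x => u (x, z.2)) z.1 ∂(lam.prod lam)
      = ∫ z, u z ∂(lam.prod lam) := by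
  rw [integral_prod_symm _ (integrable_cellAverage_fst hu), integral_prod_symm _ hu]
  refine integral_congr_ae ?_
  filter_upwards [hu.prod_left_ae] with y hy
  exact integral_cellAverage hy

/-- Averaging in the first variable is a contraction of `L¹`. -/
lemma integral_abs_cellAverage_fst_le {u : E × E → ℝ} (hu : Integrable u (lam.prod lam)) :
    ∫ z : E × E, |cellAverage lam σ (fun x => u (x, z.2)) z.1| ∂(lam.prod lam)
      ≤ ∫ z, |u z| ∂(lam.prod lam) := by
  rw [← integral_cellAverage_fst (σ := σ) hu.abs]
  exact integral_mono (integrable_cellAverage_fst hu).abs (integrable_cellAverage_fst hu.abs)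
    fun z => norm_cellAverage_le (fun x => u (x, z.2)) z.1

lemma integral_abs_cellAverage_fst_sub_le {u v : E × E → ℝ} (hu : Integrable u (lam.prod lam))
    (hv : Integrable v (lam.prod lam)) :
    ∫ z : E × E, |cellAverage lam σ (fun x => u (x, z.2)) z.1
        - cellAverage lam σ (fun x => v (x, z.2)) z.1| ∂(lam.prod lam)
      ≤ ∫ z, |u z - v z| ∂(lam.prod lam) := by
  refine le_trans (le_of_eq (integral_congr_ae ?_))
    (integral_abs_cellAverage_fst_le (σ := σ) (hu.sub hv))
  filter_upwards [Measure.quasiMeasurePreserving_snd.ae hu.prod_left_ae,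
    Measure.quasiMeasurePreserving_snd.ae hv.prod_left_ae] with z h1 h2
  rw [← cellAverage_sub h1 h2]

/-- Jensen's inequality for averages in the first variable. -/
lemma integral_exp_cellAverage_fst_le {u : E × E → ℝ} {t : ℝ} (hu : Integrable u (lam.prod lam))
    (hexp : Integrable (fun z => Real.exp (t * u z)) (lam.prod lam)) :
    ∫ z : E × E, Real.exp (t * cellAverage lam σ (fun x => u (x, z.2)) z.1) ∂(lam.prod lam)
      ≤ ∫ z, Real.exp (t * u z) ∂(lam.prod lam) := by
  rw [← integral_cellAverage_fst (σ := σ) hexp]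
  refine integral_mono_of_nonneg (.of_forall fun z => (Real.exp_pos _).le)
    (integrable_cellAverage_fst hexp) ?_
  filter_upwards [Measure.quasiMeasurePreserving_snd.ae hu.prod_left_ae,
    Measure.quasiMeasurePreserving_snd.ae hexp.prod_left_ae,
    Measure.quasiMeasurePreserving_fst.ae (ae_measure_cell_ne_zero lam σ)] with z h1 h2 h3
  have h4 : ConvexOn ℝ Set.univ fun r : ℝ => Real.exp (t * r) :=
    convexOn_exp.comp_linearMap (LinearMap.mul ℝ ℝ t)
  exact h4.map_set_average_le (by fun_prop) isClosed_univ h3 (measure_ne_top _ _) (by simp)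
    h1.integrableOn h2.integrableOn

end CellAverage

section Mesh

variable {E ι : Type*} [MetricSpace E] [MeasurableSpace E] [BorelSpace E]
  [SecondCountableTopology E] [ProperSpace E] {lam : Measure E} [IsFiniteMeasure lam]

/-- Averages over finer and finer partitions of integrable functions of two variables, in the first
variable, converge in `L¹`. -/
theorem tendsto_integral_abs_cellAverage_fst_sub {σ : ℕ → SimpleFunc E E} {r : ℕ → ℝ}
    (hr : Tendsto r atTop (𝓝 0)) (hσ : ∀ k, ∀ᵐ x ∂lam, dist (σ k x) x ≤ r k)
    {u : ℕ → E × E → ℝ} {c : E × E → ℝ} (hu : ∀ k, Integrable (u k) (lam.prod lam))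
    (hc : Integrable c (lam.prod lam))
    (huc : Tendsto (fun k => ∫ z, |u k z - c z| ∂(lam.prod lam)) atTop (𝓝 0)) :
    Tendsto (fun k => ∫ z : E × E, |cellAverage lam (σ k) (fun x => u k (x, z.2)) z.1 - c z|
      ∂(lam.prod lam)) atTop (𝓝 0) := by
  set M := (lam.prod lam).real Set.univ
  have hM : 0 ≤ M := measureReal_nonneg
  rw [Metric.tendsto_nhds]
  intro ε hε
  set η := ε / (4 + M) with hη
  have hη0 : 0 < η := by positivity
  -- As averaging is a contraction, it suffices to treat a compactly supported continuous `b` with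
  -- `∬ |c - b| ≤ η`; the four error terms below add up to less than `(4 + M) η`.
  obtain ⟨b, hbs, hcb, hbc, hbi⟩ := hc.exists_hasCompactSupport_integral_sub_le hη0
  obtain ⟨ρ, hρ, hρb⟩ := Metric.uniformContinuous_iff.1
    (hbs.uniformContinuous_of_continuous hbc) η hη0
  have h1 : ∀ᶠ k in atTop, r k < ρ / 2 := hr.eventually (gt_mem_nhds (by positivity))
  filter_upwards [h1, (Metric.tendsto_nhds.1 huc) η hη0] with k hk hk'
  rw [Real.dist_eq, sub_zero, abs_of_nonneg (integral_nonneg fun _ => abs_nonneg _)] at hk' ⊢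
  set T : (E × E → ℝ) → E × E → ℝ := fun v z => cellAverage lam (σ k) (fun x => v (x, z.2)) z.1
    with hT
  have hTi : ∀ {v}, Integrable v (lam.prod lam) → Integrable (T v) (lam.prod lam) := fun hv =>
    integrable_cellAverage_fst hv
  -- Over a cell of diameter less than `ρ`, the average of `b` is within `η` of its values.
  have hTb : ∀ᵐ z ∂(lam.prod lam), |T b z - b z| ≤ η := by
    filter_upwards [Measure.quasiMeasurePreserving_fst.ae (hσ k),
      Measure.quasiMeasurePreserving_fst.ae (ae_measure_cell_ne_zero lam (σ k)),
      Measure.quasiMeasurePreserving_snd.ae hbi.prod_left_ae] with z h2 h3 h4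
    have h5 : T b z ∈ Metric.closedBall (b z) η := by
      refine (convex_closedBall _ _).set_average_mem Metric.isClosed_closedBall h3
        (measure_ne_top _ _) ?_ h4.integrableOn
      filter_upwards [ae_restrict_mem ((σ k).measurableSet_fiber _),
        ae_restrict_of_ae (hσ k)] with x h6 h7
      have h8 : σ k x = σ k z.1 := h6
      refine (hρb (a := (x, z.2)) (b := z) ?_).le
      rw [Prod.dist_eq, dist_self, max_eq_left dist_nonneg]
      rw [h8] at h7
      linarith [dist_triangle_left x z.1 (σ k z.1)]
    rwa [Metric.mem_closedBall, Real.dist_eq] at h5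
  have hb1 : ∫ z, |T b z - b z| ∂(lam.prod lam) ≤ η * M := by
    refine (integral_mono_ae ((hTi hbi).sub hbi).abs (integrable_const η) hTb).trans_eq ?_
    rw [integral_const, smul_eq_mul, mul_comm]
  have hb2 : ∫ z, |b z - c z| ∂(lam.prod lam) ≤ η := by
    refine le_trans (le_of_eq (integral_congr_ae (.of_forall fun z => ?_))) hcb
    exact abs_sub_comm _ _
  have h2 : ∫ z, |T (u k) z - T c z| ∂(lam.prod lam) ≤ ∫ z, |u k z - c z| ∂(lam.prod lam) :=
    integral_abs_cellAverage_fst_sub_le (hu k) hc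
  have h3 : ∫ z, |T c z - T b z| ∂(lam.prod lam) ≤ η :=
    (integral_abs_cellAverage_fst_sub_le hc hbi).trans hcb
  have hi : ∀ {v w : E × E → ℝ}, Integrable v (lam.prod lam) → Integrable w (lam.prod lam) →
      Integrable (fun z => |v z - w z|) (lam.prod lam) := fun hv hw => (hv.sub hw).abs
  calc ∫ z, |T (u k) z - c z| ∂(lam.prod lam)
      ≤ ∫ z, (|T (u k) z - T c z| + |T c z - T b z| + (|T b z - b z| + |b z - c z|))
          ∂(lam.prod lam) := by
        refine integral_mono (hi (hTi (hu k)) hc) (((hi (hTi (hu k)) (hTi hc)).add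
          (hi (hTi hc) (hTi hbi))).add ((hi (hTi hbi) hbi).add (hi hbi hc))) fun z => ?_
        dsimp only
        linarith [abs_sub_le (T (u k) z) (T c z) (c z), abs_sub_le (T c z) (T b z) (c z),
          abs_sub_le (T b z) (b z) (c z)]
    _ = ∫ z, |T (u k) z - T c z| ∂(lam.prod lam) + ∫ z, |T c z - T b z| ∂(lam.prod lam)
        + (∫ z, |T b z - b z| ∂(lam.prod lam) + ∫ z, |b z - c z| ∂(lam.prod lam)) := by
        rw [integral_add (f := fun z => |T (u k) z - T c z| + |T c z - T b z|)
          (g := fun z => |T b z - b z| + |b z - c z|)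
          ((hi (hTi (hu k)) (hTi hc)).add (hi (hTi hc) (hTi hbi)))
          ((hi (hTi hbi) hbi).add (hi hbi hc)), integral_add (hi (hTi (hu k)) (hTi hc))
          (hi (hTi hc) (hTi hbi)), integral_add (hi (hTi hbi) hbi) (hi hbi hc)]
    _ < η * (4 + M) := by linarith
    _ = ε := by rw [hη]; field_simp

/-- A bounded set is covered by finitely many cells of small diameter. -/
lemma exists_simpleFunc_dist_le [Nonempty E] {U : Set E} (hU : Bornology.IsBounded U) {ε : ℝ}
    (hε : 0 < ε) : ∃ σ : SimpleFunc E E, ∀ x ∈ U, dist (σ x) x ≤ ε := by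
  have hcov : closure U ⊆ ⋃ n, Metric.ball (TopologicalSpace.denseSeq E n) ε := fun x _ => by
    obtain ⟨n, hn⟩ := (TopologicalSpace.denseRange_denseSeq E).exists_dist_lt x hε
    exact Set.mem_iUnion.2 ⟨n, hn⟩
  obtain ⟨t, ht⟩ := hU.isCompact_closure.elim_finite_subcover _
    (fun _ => Metric.isOpen_ball) hcov
  refine ⟨SimpleFunc.nearestPt (TopologicalSpace.denseSeq E) (t.sup id), fun x hx => ?_⟩
  obtain ⟨n, hnt, hn⟩ := Set.mem_iUnion₂.1 (ht (subset_closure hx))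
  have h1 := SimpleFunc.edist_nearestPt_le (TopologicalSpace.denseSeq E) x
    (Finset.le_sup (f := id) hnt)
  rw [edist_dist, edist_dist, ENNReal.ofReal_le_ofReal_iff dist_nonneg] at h1
  rw [Metric.mem_ball, dist_comm] at hn
  exact h1.trans hn.le

end Mesh

/-! ### Second moments of covariance kernels -/

section SecondMoment

open scoped TensorProduct in
/-- Cauchy–Schwarz for squared covariance kernels: `⟨a, b⟩² = ⟨a ⊗ a, b ⊗ b⟩`, and the integral of
an inner product is the inner product of the integrals. -/
lemma integral_inner_sq_le {E H : Type*} [MeasurableSpace E] {lam : Measure E} [SFinite lam]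
    [NormedAddCommGroup H] [InnerProductSpace ℝ H] {A B : E → H}
    (hA : AEStronglyMeasurable A lam) (hB : AEStronglyMeasurable B lam)
    (hA2 : Integrable (fun x => ‖A x‖ ^ 2) lam) (hB2 : Integrable (fun x => ‖B x‖ ^ 2) lam) :
    Integrable (fun z : E × E => inner ℝ (A z.1) (B z.2) ^ 2) (lam.prod lam) ∧
    ∫ z : E × E, inner ℝ (A z.1) (B z.2) ^ 2 ∂(lam.prod lam)
      ≤ (∫ z : E × E, inner ℝ (A z.1) (A z.2) ^ 2 ∂(lam.prod lam)
        + ∫ z : E × E, inner ℝ (B z.1) (B z.2) ^ 2 ∂(lam.prod lam)) / 2 := by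
  set τ : H → UniformSpace.Completion (H ⊗[ℝ] H) := fun v => ((v ⊗ₜ[ℝ] v : H ⊗[ℝ] H)) with hτ
  have hτc : Continuous τ := (UniformSpace.Completion.continuous_coe _).comp
    (TensorProduct.continuous_tmul.comp (continuous_id.prodMk continuous_id))
  have hin : ∀ v w, inner ℝ (τ v) (τ w) = inner ℝ v w ^ 2 := fun v w => by
    rw [hτ, UniformSpace.Completion.inner_coe, TensorProduct.inner_tmul, sq]
  have hn : ∀ v, ‖τ v‖ = ‖v‖ ^ 2 := fun v => by
    rw [hτ, UniformSpace.Completion.norm_coe, TensorProduct.norm_tmul, sq]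
  have hint : ∀ {A : E → H}, AEStronglyMeasurable A lam → Integrable (fun x => ‖A x‖ ^ 2) lam →
      Integrable (fun x => τ (A x)) lam := fun hA hA2 =>
    hA2.mono' (hτc.comp_aestronglyMeasurable hA) (.of_forall fun x => (hn _).le)
  have hi := hint hA hA2
  have hj := hint hB hB2
  have h1 := integrable_inner_prod (𝕜 := ℝ) hi hj
  have h2 := inner_integral_integral (𝕜 := ℝ) hi hj
  have h3 := inner_integral_integral (𝕜 := ℝ) hi hi
  have h4 := inner_integral_integral (𝕜 := ℝ) hj hj
  simp only [hin] at h1 h2 h3 h4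
  refine ⟨h1, ?_⟩
  rw [← h2, ← h3, ← h4, real_inner_self_eq_norm_sq, real_inner_self_eq_norm_sq]
  have h5 := real_inner_le_norm (∫ x, τ (A x) ∂lam) (∫ x, τ (B x) ∂lam)
  nlinarith [sq_nonneg (‖∫ x, τ (A x) ∂lam‖ - ‖∫ x, τ (B x) ∂lam‖)]

lemma sq_le_two_mul_exp_add_exp_neg (t : ℝ) : t ^ 2 ≤ 2 * (Real.exp t + Real.exp (-t)) := by
  rcases le_total 0 t with h | h
  · nlinarith [Real.quadratic_le_exp_of_nonneg h, Real.exp_pos (-t)]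
  · nlinarith [Real.quadratic_le_exp_of_nonneg (neg_nonneg.2 h), Real.exp_pos t]

variable {Ω : Type*} [MeasurableSpace Ω] {P : Measure Ω} [IsProbabilityMeasure P]
  {E : Type*} [MeasurableSpace E] {lam : Measure E} {β : ℝ}
  {S : Submodule ℝ (Lp ℝ 2 P)} {A : E → Lp ℝ 2 P}

namespace IsWickField

lemma integrable_norm_sq (hβ : 0 < β) (hA : IsWickField β S lam A) :
    Integrable (fun x => ‖A x‖ ^ 2) lam := by
  refine (hA.integrable.norm.const_mul (2 / β ^ 2)).mono'
    (hA.aestronglyMeasurable.norm.pow 2) (.of_forall fun x => ?_)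
  rw [Real.norm_eq_abs, abs_of_nonneg (by positivity), norm_wickExp, div_mul_eq_mul_div,
    le_div_iff₀ (by positivity)]
  nlinarith [Real.add_one_le_exp (β ^ 2 / 2 * ‖A x‖ ^ 2)]

lemma integrable_field [IsFiniteMeasure lam] (hβ : 0 < β) (hA : IsWickField β S lam A) :
    Integrable A lam :=
  ((memLp_two_iff_integrable_sq_norm hA.aestronglyMeasurable).2
    (hA.integrable_norm_sq hβ)).integrable one_le_two

lemma memLp_crossCov [SFinite lam] {T : Submodule ℝ (Lp ℝ 2 P)} {B : E → Lp ℝ 2 P} (hβ : 0 < β)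
    (hA : IsWickField β S lam A) (hB : IsWickField β T lam B) :
    MemLp (crossCov A B) 2 (lam.prod lam) :=
  (memLp_two_iff_integrable_sq
    (aestronglyMeasurable_crossCov hA.aestronglyMeasurable hB.aestronglyMeasurable)).2
    (integral_inner_sq_le hA.aestronglyMeasurable hB.aestronglyMeasurable
      (hA.integrable_norm_sq hβ) (hB.integrable_norm_sq hβ)).1

/-- The kernel `exp (-β² C)` of the pair `A`, `-A` is controlled by the kernel `exp (β² C)`, which
bounds the second moment of `C`. -/
lemma integral_crossCov_sq_le [SFinite lam] (hβ : 0 < β)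
    (hS : (S : Set (Lp ℝ 2 P)) ⊆ gaussianAt β P) (hA : IsWickField β S lam A) :
    ∫ z, crossCov A A z ^ 2 ∂(lam.prod lam)
      ≤ 4 / β ^ 4 * ∫ z, Real.exp (β ^ 2 * crossCov A A z) ∂(lam.prod lam) := by
  have h1 := integral_exp_le hS hA hA.neg
  have h2 := integrable_exp hS hA hA.neg
  have h3 := integrable_exp hS hA hA
  have e1 : ∀ z, crossCov A (fun x => -A x) z = -crossCov A A z := fun z => inner_neg_right _ _
  have e2 : ∀ z, crossCov (fun x => -A x) (fun x => -A x) z = crossCov A A z := fun z =>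
    inner_neg_neg _ _
  simp only [e1, e2, mul_neg] at h1 h2
  have h4 : ∫ z, crossCov A A z ^ 2 ∂(lam.prod lam) ≤ ∫ z, 2 / β ^ 4 *
      (Real.exp (β ^ 2 * crossCov A A z) + Real.exp (-(β ^ 2 * crossCov A A z)))
      ∂(lam.prod lam) := by
    refine integral_mono (memLp_crossCov hβ hA hA).integrable_sq ((h3.add h2).const_mul _)
      fun z => ?_
    dsimp only
    rw [div_mul_eq_mul_div, le_div_iff₀ (by positivity)]
    calc crossCov A A z ^ 2 * β ^ 4 = (β ^ 2 * crossCov A A z) ^ 2 := by ring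
      _ ≤ _ := sq_le_two_mul_exp_add_exp_neg _
  rw [integral_const_mul, integral_add h3 h2] at h4
  refine h4.trans ?_
  have h5 : 0 < 2 / β ^ 4 := by positivity
  have h6 : 4 / β ^ 4 = 2 * (2 / β ^ 4) := by ring
  rw [h6]
  nlinarith

end IsWickField

end SecondMoment

/-! ### Averaged fields -/

section AveragedFields

variable {Ω : Type*} [MeasurableSpace Ω] {P : Measure Ω} [IsProbabilityMeasure P]
  {E ι : Type*} [MeasurableSpace E] {lam : Measure E} [IsFiniteMeasure lam] {β : ℝ}
  {S : Submodule ℝ (Lp ℝ 2 P)} {A : E → Lp ℝ 2 P} {σ : SimpleFunc E ι}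

lemma crossCov_cellAverage_left (hA : Integrable A lam) (B : E → Lp ℝ 2 P) :
    crossCov (cellAverage lam σ A) B
      = fun z => cellAverage lam σ (fun x => crossCov A B (x, z.2)) z.1 :=
  funext fun z => inner_cellAverage hA (B z.2) z.1

namespace IsWickField

lemma cellAverage (hβ : 0 < β) (hS : IsClosed (S : Set (Lp ℝ 2 P)))
    (hA : IsWickField β S lam A) : IsWickField β S lam (cellAverage lam σ A) where
  mem := cellAverage_mem (hA.integrable_field hβ) hS hA.mem
  aestronglyMeasurable := (integrable_cellAverage A).aestronglyMeasurable
  integrable := by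
    have : (fun x => wickExp β (ImaginaryChaos.cellAverage lam σ A x))
        = σ.map fun a => wickExp β (⨍ y in σ ⁻¹' {a}, A y ∂lam) := rfl
    rw [this]
    exact SimpleFunc.integrable_of_isFiniteMeasure _

/-- Averaging decreases the exponential moment: by Jensen's inequality in one variable the kernel of
the averaged field is dominated by the mixed kernel, and Cauchy–Schwarz applies to the latter. -/
lemma integral_exp_cellAverage_le (hβ : 0 < β) (hSc : IsClosed (S : Set (Lp ℝ 2 P)))
    (hS : (S : Set (Lp ℝ 2 P)) ⊆ gaussianAt β P) (hA : IsWickField β S lam A) :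
    ∫ z, Real.exp (β ^ 2 * crossCov (ImaginaryChaos.cellAverage lam σ A)
        (ImaginaryChaos.cellAverage lam σ A) z) ∂(lam.prod lam)
      ≤ ∫ z, Real.exp (β ^ 2 * crossCov A A z) ∂(lam.prod lam) := by
  set A' := ImaginaryChaos.cellAverage lam σ A with hA'def
  have hA' : IsWickField β S lam A' := hA.cellAverage hβ hSc
  have h1 := integral_exp_le hS hA hA'
  have h2 := integral_exp_cellAverage_fst_le (σ := σ) (t := β ^ 2)
    ((memLp_crossCov hβ hA hA').integrable one_le_two) (integrable_exp hS hA hA')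
  simp only [← fun z => congrFun (crossCov_cellAverage_left (σ := σ) (hA.integrable_field hβ) A') z]
    at h2
  linarith

end IsWickField

lemma tendsto_inner_setAverage {A B : ℕ → E → Lp ℝ 2 P} (hA : ∀ n, Integrable (A n) lam)
    (hB : ∀ n, Integrable (B n) lam) {C : E × E → ℝ} (hC : Integrable C (lam.prod lam))
    (hlim : Tendsto (fun n => ∫ z, |crossCov (A n) (B n) z - C z| ∂(lam.prod lam)) atTop (𝓝 0))
    (s : Set E) :
    Tendsto (fun n => inner ℝ (⨍ x in s, A n x ∂lam) (⨍ x in s, B n x ∂lam)) atTop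
      (𝓝 ((lam.real s)⁻¹ * ((lam.real s)⁻¹ * ∫ z in s ×ˢ s, C z ∂(lam.prod lam)))) := by
  have h1 : ∀ n, inner ℝ (⨍ x in s, A n x ∂lam) (⨍ x in s, B n x ∂lam)
      = (lam.real s)⁻¹ * ((lam.real s)⁻¹ *
        ∫ z in s ×ˢ s, crossCov (A n) (B n) z ∂(lam.prod lam)) := fun n => by
    rw [setAverage_eq, setAverage_eq, real_inner_smul_left, real_inner_smul_right,
      inner_integral_integral (𝕜 := ℝ) (hA n).integrableOn (hB n).integrableOn,
      Measure.prod_restrict]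
    rfl
  simp only [h1]
  refine Tendsto.const_mul _ (Tendsto.const_mul _ (tendsto_iff_dist_tendsto_zero.2
    (squeeze_zero (fun _ => dist_nonneg) (fun n => ?_) hlim)))
  have hi : Integrable (crossCov (A n) (B n)) (lam.prod lam) :=
    integrable_inner_prod (𝕜 := ℝ) (hA n) (hB n)
  rw [Real.dist_eq, ← integral_sub hi.integrableOn hC.integrableOn]
  exact (abs_integral_le_integral_abs).trans
    (setIntegral_le_integral (hi.sub hC).abs (.of_forall fun _ => abs_nonneg _))

/-- If the covariance kernels of `Aₙ`, `Bₙ` and the mixed ones have the same limit in `L¹`, then the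
averages of `Aₙ` and of `Bₙ` over a fixed finite partition become close. No joint law of `Aₙ` and
`Bₙ` is involved. -/
lemma tendsto_integral_norm_wickExp_cellAverage_sub {A B : ℕ → E → Lp ℝ 2 P}
    (hA : ∀ n, Integrable (A n) lam) (hB : ∀ n, Integrable (B n) lam) {C : E × E → ℝ}
    (hC : Integrable C (lam.prod lam))
    (hAA : Tendsto (fun n => ∫ z, |crossCov (A n) (A n) z - C z| ∂(lam.prod lam)) atTop (𝓝 0))
    (hBB : Tendsto (fun n => ∫ z, |crossCov (B n) (B n) z - C z| ∂(lam.prod lam)) atTop (𝓝 0))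
    (hAB : Tendsto (fun n => ∫ z, |crossCov (A n) (B n) z - C z| ∂(lam.prod lam)) atTop (𝓝 0))
    (β : ℝ) (σ : SimpleFunc E ι) :
    Tendsto (fun n => ∫ x, ‖wickExp β (cellAverage lam σ (A n) x)
      - wickExp β (cellAverage lam σ (B n) x)‖ ∂lam) atTop (𝓝 0) := by
  set D : ℕ → ι → ℝ := fun n a => ‖wickExp β (⨍ x in σ ⁻¹' {a}, A n x ∂lam)
    - wickExp β (⨍ x in σ ⁻¹' {a}, B n x ∂lam)‖ with hD
  have h1 : ∀ n, ∫ x, ‖wickExp β (cellAverage lam σ (A n) x)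
      - wickExp β (cellAverage lam σ (B n) x)‖ ∂lam
      = ∑ a ∈ σ.range, lam.real (σ ⁻¹' {a}) * D n a := fun n => by
    have hi : Integrable (fun x => ‖wickExp β (cellAverage lam σ (A n) x)
        - wickExp β (cellAverage lam σ (B n) x)‖) lam :=
      SimpleFunc.integrable_of_isFiniteMeasure (σ.map (D n))
    rw [integral_eq_sum_cells (σ := σ) hi]
    refine Finset.sum_congr rfl fun a _ => ?_
    rw [setIntegral_congr_fun (g := fun _ => D n a) (σ.measurableSet_fiber a) fun x hx => by
      simp only [hD, cellAverage_eq_of_mem hx], setIntegral_const, smul_eq_mul]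
  have h2 : ∀ a, Tendsto (fun n => D n a) atTop (𝓝 0) := fun a => by
    have hAA' := tendsto_inner_setAverage hA hA hC hAA (σ ⁻¹' {a})
    have hBB' := tendsto_inner_setAverage hB hB hC hBB (σ ⁻¹' {a})
    have hAB' := tendsto_inner_setAverage hA hB hC hAB (σ ⁻¹' {a})
    simp only [real_inner_self_eq_norm_sq] at hAA' hBB'
    refine tendsto_norm_wickExp_sub β hAA' hBB' ?_
    have h3 := ((hAA'.sub (hAB'.const_mul 2)).add hBB').sqrt
    rw [two_mul, sub_add_eq_sub_sub, sub_self, zero_sub, neg_add_cancel, Real.sqrt_zero] at h3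
    refine h3.congr fun n => ?_
    rw [← norm_sub_sq_real, Real.sqrt_sq (norm_nonneg _)]
  simp only [h1]
  have h3 := tendsto_finsetSum σ.range fun a _ => (h2 a).const_mul (lam.real (σ ⁻¹' {a}))
  simpa using h3

variable [MetricSpace E] [BorelSpace E] [SecondCountableTopology E] [ProperSpace E]

/-- If the covariance kernels of `Aₖ` converge in `L¹`, then `Aₖ` and its averages over finer and
finer partitions have the same chaos in the limit. -/
theorem exists_tendsto_norm_cellAverage_sub_sq_le (hβ : 0 < β) {S : ℕ → Submodule ℝ (Lp ℝ 2 P)}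
    (hSc : ∀ k, IsClosed (S k : Set (Lp ℝ 2 P)))
    (hS : ∀ k, (S k : Set (Lp ℝ 2 P)) ⊆ gaussianAt β P) {A : ℕ → E → Lp ℝ 2 P}
    (hA : ∀ k, IsWickField β (S k) lam (A k)) {σ : ℕ → SimpleFunc E E} {r : ℕ → ℝ}
    (hr : Tendsto r atTop (𝓝 0)) (hσ : ∀ k, ∀ᵐ x ∂lam, dist (σ k x) x ≤ r k) {C : E × E → ℝ}
    (hC : ∀ z, C z.swap = C z) (hCi : Integrable C (lam.prod lam))
    (hCint : Integrable (fun z => Real.exp (β ^ 2 * C z)) (lam.prod lam))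
    (hlim : Tendsto (fun k => ∫ z, |crossCov (A k) (A k) z - C z| ∂(lam.prod lam)) atTop (𝓝 0))
    (hexp : Tendsto (fun k => ∫ z, Real.exp (β ^ 2 * crossCov (A k) (A k) z) ∂(lam.prod lam))
      atTop (𝓝 (∫ z, Real.exp (β ^ 2 * C z) ∂(lam.prod lam)))) :
    ∃ δ : ℕ → ℝ, Tendsto δ atTop (𝓝 0) ∧ ∀ k, ∀ f : E → ℂ, AEStronglyMeasurable f lam →
      (∀ x, ‖f x‖ ≤ 1) →
      ‖∫ x, f x • (wickExp β (cellAverage lam (σ k) (A k) x) - wickExp β (A k x)) ∂lam‖ ^ 2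
        ≤ δ k := by
  set A' : ℕ → E → Lp ℝ 2 P := fun k => cellAverage lam (σ k) (A k) with hA'def
  have hA' : ∀ k, IsWickField β (S k) lam (A' k) := fun k => (hA k).cellAverage hβ (hSc k)
  have hAi := fun k => (hA k).integrable_field hβ
  have hi : ∀ k, Integrable (crossCov (A k) (A k)) (lam.prod lam) := fun k =>
    (IsWickField.memLp_crossCov hβ (hA k) (hA k)).integrable one_le_two
  have hi' : ∀ k, Integrable (crossCov (A k) (A' k)) (lam.prod lam) := fun k =>
    (IsWickField.memLp_crossCov hβ (hA k) (hA' k)).integrable one_le_two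
  have hswap : ∀ u : E × E → ℝ, ∫ z, u z.swap ∂(lam.prod lam) = ∫ z, u z ∂(lam.prod lam) :=
    fun u => integral_prod_swap u
  -- Averaging acts on the kernels in one variable at a time.
  have h1 : Tendsto (fun k => ∫ z, |crossCov (A' k) (A k) z - C z| ∂(lam.prod lam)) atTop
      (𝓝 0) := by
    simp only [hA'def, fun k => crossCov_cellAverage_left (σ := σ k) (hAi k) (A k)]
    exact tendsto_integral_abs_cellAverage_fst_sub hr hσ hi hCi hlim
  have h2 : Tendsto (fun k => ∫ z, |crossCov (A k) (A' k) z - C z| ∂(lam.prod lam)) atTop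
      (𝓝 0) := by
    refine h1.congr fun k => ?_
    rw [← hswap]
    refine integral_congr_ae (.of_forall fun z => ?_)
    simp only [hC]
    rw [crossCov, real_inner_comm]
    rfl
  have h3 : Tendsto (fun k => ∫ z, |crossCov (A' k) (A' k) z - C z| ∂(lam.prod lam)) atTop
      (𝓝 0) := by
    simp only [fun k => show crossCov (A' k) (A' k) = _ from
      crossCov_cellAverage_left (σ := σ k) (hAi k) (A' k)]
    exact tendsto_integral_abs_cellAverage_fst_sub hr hσ hi' hCi h2
  have hmeas : ∀ {u : ℕ → E × E → ℝ}, (∀ k, Integrable (u k) (lam.prod lam)) →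
      Tendsto (fun k => ∫ z, |u k z - C z| ∂(lam.prod lam)) atTop (𝓝 0) →
      TendstoInMeasure (lam.prod lam) u atTop C := fun hu hlim => by
    refine tendstoInMeasure_of_tendsto_eLpNorm one_ne_zero (fun k => (hu k).1) hCi.1 ?_
    have h4 := ENNReal.tendsto_ofReal hlim
    rw [ENNReal.ofReal_zero] at h4
    refine h4.congr fun k => ?_
    rw [eLpNorm_one_eq_lintegral_enorm, ← ofReal_integral_norm_eq_lintegral_enorm ((hu k).sub hCi)]
    rfl
  exact exists_tendsto_norm_integral_smul_sub_sq_le hS hA' hA hC hCint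
    (hmeas (fun k => (IsWickField.memLp_crossCov hβ (hA' k) (hA' k)).integrable one_le_two) h3)
    (hmeas hi hlim)
    (hmeas (fun k => (IsWickField.memLp_crossCov hβ (hA' k) (hA k)).integrable one_le_two) h1)
    (fun k => (hA k).integral_exp_cellAverage_le hβ (hSc k) (hS k)) (fun k => le_rfl) hexp hexp

end AveragedFields

/-! ### Uniqueness of the limit -/

section

variable {d : ℕ} {Ω : Type*} [MeasurableSpace Ω] {P : Measure Ω} [IsProbabilityMeasure P]
  {U : Set (Space d)} {g : Space d → Space d → ℝ} {X X' : ℕ → Space d → Ω → ℝ} {β : ℝ}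

namespace IsStandardApproximation

variable (hC : IsLogCovariance U g) (h : IsStandardApproximation P U (logKernel U g) X)
  (hd : 0 < d) (hβ0 : 0 < β) (hβ : β ^ 2 < d)
  (hint : ∀ n, IntegrableOn (fun x => Real.exp (β ^ 2 / 2 * ∫ ω, X n x ω ^ 2 ∂P)) U)
include hC h hd hβ0 hβ hint

lemma exists_integral_crossCov_sq_le :
    ∃ M : ℝ, ∀ n, ∫ z, crossCov (fieldVec P X n) (fieldVec P X n) z ^ 2
      ∂((volume.restrict U).prod (volume.restrict U)) ≤ M := by
  obtain ⟨M, hM⟩ := (tendsto_integral_exp hC h hd hβ).bddAbove_range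
  refine ⟨4 / β ^ 4 * M, fun n => ?_⟩
  refine ((h.isWickField hC.isOpen.measurableSet hint n).integral_crossCov_sq_le hβ0
    (h.gaussianSpace_subset β)).trans (mul_le_mul_of_nonneg_left (hM ⟨n, rfl⟩) (by positivity))

/-- The convergence of the covariances holds in `L¹`. -/
lemma tendsto_integral_abs_crossCov_sub :
    Integrable (fun z : Space d × Space d => logKernel U g z.1 z.2)
      ((volume.restrict U).prod (volume.restrict U)) ∧
    Tendsto (fun n => ∫ z, |crossCov (fieldVec P X n) (fieldVec P X n) z - logKernel U g z.1 z.2|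
      ∂((volume.restrict U).prod (volume.restrict U))) atTop (𝓝 0) := by
  have hU := hC.isOpen.measurableSet
  have : IsFiniteMeasure (volume.restrict U) := ⟨by simpa using hC.isBounded.measure_lt_top⟩
  obtain ⟨M, hM⟩ := exists_integral_crossCov_sq_le hC h hd hβ0 hβ hint
  have h1 := tendsto_integral_abs_sub_of_integral_sq_le
    ((h.tendstoInMeasure_crossCov hU).comp (tendsto_atTop_diagonal (α := ℕ)))
    (fun n => (h.isWickField hU hint n).memLp_crossCov hβ0 (h.isWickField hU hint n)) hM
  exact ⟨h1.1.integrable one_le_two, h1.2⟩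

variable (h' : IsStandardApproximation P U (logKernel U g) X')
  (hint' : ∀ n, IntegrableOn (fun x => Real.exp (β ^ 2 / 2 * ∫ ω, X' n x ω ^ 2 ∂P)) U)
  (hmix : TendstoInMeasure (volume.restrict (U ×ˢ U))
    (fun (n : ℕ) (z : Space d × Space d) => ∫ ω, X n z.1 ω * X' n z.2 ω ∂P) atTop
    (fun z => logKernel U g z.1 z.2))
include h' hint' hmix

lemma tendsto_integral_abs_crossCov_sub_of_mixed :
    Tendsto (fun n => ∫ z, |crossCov (fieldVec P X n) (fieldVec P X' n) z - logKernel U g z.1 z.2|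
      ∂((volume.restrict U).prod (volume.restrict U))) atTop (𝓝 0) := by
  have hU := hC.isOpen.measurableSet
  have : IsFiniteMeasure (volume.restrict U) := ⟨by simpa using hC.isBounded.measure_lt_top⟩
  obtain ⟨M, hM⟩ := exists_integral_crossCov_sq_le hC h hd hβ0 hβ hint
  obtain ⟨M', hM'⟩ := exists_integral_crossCov_sq_le hC h' hd hβ0 hβ hint'
  rw [Measure.volume_eq_prod, ← Measure.prod_restrict] at hmix
  refine (tendsto_integral_abs_sub_of_integral_sq_le (M := (M + M') / 2)
    (hmix.congr_left fun n => h.crossCov_ae_eq h' hU n n)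
    (fun n => (h.isWickField hU hint n).memLp_crossCov hβ0 (h'.isWickField hU hint' n))
    fun n => ?_).2
  have hA := h.isWickField hU hint n
  have hB := h'.isWickField hU hint' n
  have h1 := (integral_inner_sq_le hA.aestronglyMeasurable hB.aestronglyMeasurable
    (hA.integrable_norm_sq hβ0) (hB.integrable_norm_sq hβ0)).2
  have h2 := hM n
  have h3 := hM' n
  simp only [crossCov] at h2 h3 ⊢
  linarith

/-- Along a subsequence, the chaoses of the two approximations are close in `L²(P)`, uniformly over
bounded test functions. Each is compared with the chaos of its averages over a partition, which are
jointly Gaussian with it; the averages of the two approximations are compared directly. -/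
theorem exists_seq_tendsto_norm_sub_sq_le :
    ∃ ns : ℕ → ℕ, Tendsto ns atTop atTop ∧ ∃ δ : ℕ → ℝ, Tendsto δ atTop (𝓝 0) ∧
      ∀ k, ∀ f : Space d → ℂ, AEStronglyMeasurable f (volume.restrict U) → (∀ x, ‖f x‖ ≤ 1) →
      ‖∫ x in U, f x • (wickExp β (fieldVec P X (ns k) x) - wickExp β (fieldVec P X' (ns k) x))‖ ^ 2
        ≤ δ k := by
  have hU := hC.isOpen.measurableSet
  have : IsFiniteMeasure (volume.restrict U) := ⟨by simpa using hC.isBounded.measure_lt_top⟩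
  have hF := fun n => h.isWickField hU hint n
  have hF' := fun n => h'.isWickField hU hint' n
  obtain ⟨hCi, hlim⟩ := tendsto_integral_abs_crossCov_sub hC h hd hβ0 hβ hint
  obtain ⟨-, hlim'⟩ := tendsto_integral_abs_crossCov_sub hC h' hd hβ0 hβ hint'
  have hlimx := tendsto_integral_abs_crossCov_sub_of_mixed hC h hd hβ0 hβ hint h' hint' hmix
  set r : ℕ → ℝ := fun k => 1 / ((k : ℝ) + 1) with hr
  have hr0 : ∀ k, 0 < r k := fun k => by positivity
  have hrt : Tendsto r atTop (𝓝 0) := tendsto_one_div_add_atTop_nhds_zero_nat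
  choose σ hσ using fun k => exists_simpleFunc_dist_le hC.isBounded (hr0 k)
  have hσ' : ∀ k, ∀ᵐ x ∂(volume.restrict U), dist (σ k x) x ≤ r k := fun k =>
    (ae_restrict_mem hU).mono fun x hx => hσ k x hx
  have hcell : ∀ k, ∃ n, k ≤ n ∧ ∫ x in U, ‖wickExp β (cellAverage (volume.restrict U) (σ k)
      (fieldVec P X n) x) - wickExp β (cellAverage (volume.restrict U) (σ k)
      (fieldVec P X' n) x)‖ < r k := fun k => by
    have h1 := tendsto_integral_norm_wickExp_cellAverage_sub (fun n => (hF n).integrable_field hβ0)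
      (fun n => (hF' n).integrable_field hβ0) hCi hlim hlim' hlimx β (σ k)
    exact ((eventually_ge_atTop k).and (h1.eventually (gt_mem_nhds (hr0 k)))).exists
  -- `ns k` is so large that the averages over the `k`-th partition are within `1 / (k + 1)`.
  choose ns hns hcell using hcell
  have hnst : Tendsto ns atTop atTop := tendsto_atTop_mono hns tendsto_id
  refine ⟨ns, hnst, ?_⟩
  have hclosed : ∀ Y : ℕ → Space d → Ω → ℝ,
      IsClosed (gaussianSpace P U Y : Set (Lp ℝ 2 P)) := fun Y =>
    Submodule.isClosed_topologicalClosure _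
  have hCs : ∀ z : Space d × Space d, logKernel U g z.swap.1 z.swap.2 = logKernel U g z.1 z.2 :=
    fun z => hC.symm _ _
  have hCe := integrable_exp_logKernel hC h hd hβ
  obtain ⟨δ, hδ, hle⟩ := exists_tendsto_norm_cellAverage_sub_sq_le hβ0
    (fun _ => hclosed X) (fun _ => h.gaussianSpace_subset β) (fun k => hF (ns k)) hrt hσ'
    (C := fun z => logKernel U g z.1 z.2) hCs hCi hCe (hlim.comp hnst)
    ((tendsto_integral_exp hC h hd hβ).comp hnst)
  obtain ⟨δ', hδ', hle'⟩ := exists_tendsto_norm_cellAverage_sub_sq_le hβ0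
    (fun _ => hclosed X') (fun _ => h'.gaussianSpace_subset β) (fun k => hF' (ns k)) hrt hσ'
    (C := fun z => logKernel U g z.1 z.2) hCs hCi hCe (hlim'.comp hnst)
    ((tendsto_integral_exp hC h' hd hβ).comp hnst)
  refine ⟨fun k => 3 * (δ k + r k ^ 2 + δ' k), ?_, fun k f hf hf1 => ?_⟩
  · simpa using ((hδ.add (hrt.pow 2)).add hδ').const_mul 3
  set A := fieldVec P X (ns k)
  set B := fieldVec P X' (ns k)
  set A' := cellAverage (volume.restrict U) (σ k) A
  set B' := cellAverage (volume.restrict U) (σ k) B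
  have hA : Integrable (fun x => wickExp β (A x)) (volume.restrict U) := (hF (ns k)).integrable
  have hB : Integrable (fun x => wickExp β (B x)) (volume.restrict U) := (hF' (ns k)).integrable
  have hA' : Integrable (fun x => wickExp β (A' x)) (volume.restrict U) :=
    ((hF (ns k)).cellAverage hβ0 (hclosed X)).integrable
  have hB' : Integrable (fun x => wickExp β (B' x)) (volume.restrict U) :=
    ((hF' (ns k)).cellAverage hβ0 (hclosed X')).integrable
  have hsm : ∀ {V W : Space d → Lp ℂ 2 P}, Integrable V (volume.restrict U) →
      Integrable W (volume.restrict U) →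
      Integrable (fun x => f x • (V x - W x)) (volume.restrict U) := fun hV hW =>
    (hV.sub hW).bdd_smul 1 hf (.of_forall hf1)
  have hsplit : ∫ x in U, f x • (wickExp β (A x) - wickExp β (B x))
      = (∫ x in U, f x • (wickExp β (A' x) - wickExp β (B' x)))
        - (∫ x in U, f x • (wickExp β (A' x) - wickExp β (A x)))
        + ∫ x in U, f x • (wickExp β (B' x) - wickExp β (B x)) := by
    rw [← integral_sub (hsm hA' hB') (hsm hA' hA),
      ← integral_add (f := fun x => f x • (wickExp β (A' x) - wickExp β (B' x))
        - f x • (wickExp β (A' x) - wickExp β (A x))) ((hsm hA' hB').sub (hsm hA' hA)) (hsm hB' hB)]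
    refine integral_congr_ae (.of_forall fun x => ?_)
    dsimp only
    module
  have h1 : ‖∫ x in U, f x • (wickExp β (A' x) - wickExp β (B' x))‖ ≤ r k := by
    refine le_trans ?_ (hcell k).le
    refine (norm_integral_le_integral_norm _).trans
      (integral_mono (hsm hA' hB').norm (hA'.sub hB').norm fun x => ?_)
    simp only [norm_smul]
    exact mul_le_of_le_one_left (norm_nonneg _) (hf1 x)
  have h2 := hle k f hf hf1
  have h3 := hle' k f hf hf1
  set a := ‖∫ x in U, f x • (wickExp β (A' x) - wickExp β (A x))‖
  set b := ‖∫ x in U, f x • (wickExp β (A' x) - wickExp β (B' x))‖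
  set c := ‖∫ x in U, f x • (wickExp β (B' x) - wickExp β (B x))‖
  have h4 : ‖∫ x in U, f x • (wickExp β (A x) - wickExp β (B x))‖ ≤ a + b + c := by
    rw [hsplit]
    linarith [norm_add_le ((∫ x in U, f x • (wickExp β (A' x) - wickExp β (B' x)))
      - ∫ x in U, f x • (wickExp β (A' x) - wickExp β (A x)))
      (∫ x in U, f x • (wickExp β (B' x) - wickExp β (B x))),
      norm_sub_le (∫ x in U, f x • (wickExp β (A' x) - wickExp β (B' x)))
      (∫ x in U, f x • (wickExp β (A' x) - wickExp β (A x)))]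
  have h5 : b ^ 2 ≤ r k ^ 2 := pow_le_pow_left₀ (norm_nonneg _) h1 2
  have h6 := pow_le_pow_left₀ (norm_nonneg _) h4 2
  nlinarith [sq_nonneg (a - b), sq_nonneg (b - c), sq_nonneg (a - c)]

/-- Two approximations whose mixed covariances have the right limit have the same chaos. -/
theorem ae_eq_of_mixed {s s' : ℝ} {μ μ' : Ω → 𝓢'(Space d, ℂ)}
    (hμ : ConvergesInProbability P s (chaosApprox P U β X) μ)
    (hμ' : ConvergesInProbability P s' (chaosApprox P U β X') μ') : ∀ᵐ ω ∂P, μ ω = μ' ω := by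
  have hU := hC.isOpen.measurableSet
  obtain ⟨ns, hns, δ, hδ, hle⟩ :=
    exists_seq_tendsto_norm_sub_sq_le hC h hd hβ0 hβ hint h' hint' hmix
  have hs₀ : -(d : ℝ) / 2 - 1 < -(d : ℝ) / 2 := by linarith
  set s₀ := -(d : ℝ) / 2 - 1
  have hI := lintegral_sobolevWeight_sq_ne_top hs₀
  set F : ℕ → Ω → Lp ℂ 2 (volume : Measure (Space d)) := fun k ω =>
    sobolevRep s₀ (chaosFunction P U β X (ns k) ω)
      - sobolevRep s₀ (chaosFunction P U β X' (ns k) ω) with hF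
  have hFm : ∀ k, AEStronglyMeasurable (F k) P := fun k =>
    (aestronglyMeasurable_sobolevRep (h.aestronglyMeasurable_chaosFunction hU β _)).sub
      (aestronglyMeasurable_sobolevRep (h'.aestronglyMeasurable_chaosFunction hU β _))
  have hlim : Tendsto (fun k => ∫⁻ ω, ‖F k ω‖ₑ ^ 2 ∂P) atTop (𝓝 0) := by
    have h1 := ENNReal.Tendsto.mul_const (ENNReal.tendsto_ofReal hδ) (Or.inr hI)
    rw [ENNReal.ofReal_zero, zero_mul] at h1
    exact tendsto_of_tendsto_of_tendsto_of_le_of_le tendsto_const_nhds h1 (fun _ => zero_le)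
      fun k => h.lintegral_enorm_sub_sq_le hU hint h' hint' hs₀ (hle k)
  have hFlim : TendstoInMeasure P F atTop 0 := by
    refine tendstoInMeasure_of_tendsto_eLpNorm two_ne_zero hFm aestronglyMeasurable_zero ?_
    have h1 := (ENNReal.continuous_rpow_const (y := 1 / (2 : ℝ))).tendsto 0 |>.comp hlim
    rw [ENNReal.zero_rpow_of_pos (by norm_num)] at h1
    refine h1.congr fun k => ?_
    rw [sub_zero, eLpNorm_eq_lintegral_rpow_enorm_toReal two_ne_zero ENNReal.ofNat_ne_top,
      ENNReal.toReal_ofNat]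
    simp only [ENNReal.rpow_two, Function.comp_apply]
  obtain ⟨ms, hms, h1⟩ := (hμ.comp hns).exists_seq_tendsto_ae
  obtain ⟨ls, hls, h2⟩ := ((hμ'.comp hns).comp hms.tendsto_atTop).exists_seq_tendsto_ae
  obtain ⟨js, hjs, h3⟩ :=
    (hFlim.comp (hms.tendsto_atTop.comp hls.tendsto_atTop)).exists_seq_tendsto_ae
  filter_upwards [h1, h2, h3, ae_all_iff.2 (h.integrable_chaosFunction hU hint),
    ae_all_iff.2 (h'.integrable_chaosFunction hU hint')] with ω h1 h2 h3 h4 h5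
  have h6 := h1.comp (hls.tendsto_atTop.comp hjs.tendsto_atTop)
  have h7 := h2.comp hjs.tendsto_atTop
  have h8 := ((sobolevEmbedding s₀).continuous.tendsto _).comp h3
  rw [Pi.zero_apply, map_zero] at h8
  refine sub_eq_zero.1 (tendsto_nhds_unique (h6.sub h7) (h8.congr fun k => ?_))
  simp only [Function.comp_apply, hF, map_sub]
  rw [chaosApprox, chaosApprox, ← weightedFourier_eq_iff.1 (weightedFourier_ofFunction hs₀ (h4 _)),
    ← weightedFourier_eq_iff.1 (weightedFourier_ofFunction hs₀ (h5 _))]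

end IsStandardApproximation

end

end ImaginaryChaos

end

theorem theorem1p1 {d : ℕ} {U : Set (ImaginaryChaos.Space d)}
    {g : ImaginaryChaos.Space d → ImaginaryChaos.Space d → ℝ}
    (hC : ImaginaryChaos.IsLogCovariance U g)
    -- the log-correlated field
    {Ω' : Type*} [MeasurableSpace Ω'] (P' : Measure Ω') [IsProbabilityMeasure P']
    (X : Ω' → (𝓢(ImaginaryChaos.Space d, ℝ) →L[ℝ] ℝ))
    (hX : ImaginaryChaos.IsGaussianField P' (ImaginaryChaos.logKernel U g) X)
    -- a standard approximation of it
    {Ω : Type*} [MeasurableSpace Ω] (P : Measure Ω) [IsProbabilityMeasure P]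
    (Xn : ℕ → ImaginaryChaos.Space d → Ω → ℝ)
    (hXn : ImaginaryChaos.IsStandardApproximation P U (ImaginaryChaos.logKernel U g) Xn)
    (β : ℝ) (hβ0 : 0 < β) (hβ : β < √(d : ℝ))
    -- the functions `μₙ`, whose modulus is deterministic, are integrable
    (hint : ∀ n, IntegrableOn (fun x => Real.exp (β ^ 2 / 2 * ∫ ω, Xn n x ω ^ 2 ∂P)) U) :
    (∃ μ : Ω → 𝓢'(ImaginaryChaos.Space d, ℂ),
      (∀ s : ℝ, s < -(d : ℝ) / 2 → ImaginaryChaos.ConvergesInProbability P s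
        (ImaginaryChaos.chaosApprox P U β Xn) μ) ∧
      (∀ ν : 𝓢'(ImaginaryChaos.Space d, ℂ), ¬ ∀ᵐ ω ∂P, μ ω = ν) ∧
      ∀ᵐ ω ∂P, Distribution.dsupport (μ ω) ⊆ closure U) ∧
    (∀ Xn' : ℕ → ImaginaryChaos.Space d → Ω → ℝ,
      ImaginaryChaos.IsStandardApproximation P U (ImaginaryChaos.logKernel U g) Xn' →
      (∀ n, IntegrableOn (fun x => Real.exp (β ^ 2 / 2 * ∫ ω, Xn' n x ω ^ 2 ∂P)) U) →
      TendstoInMeasure (volume.restrict (U ×ˢ U))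
        (fun (n : ℕ) (z : ImaginaryChaos.Space d × ImaginaryChaos.Space d) =>
          ∫ ω, Xn n z.1 ω * Xn' n z.2 ω ∂P)
        atTop (fun z => ImaginaryChaos.logKernel U g z.1 z.2) →
      ∀ s s' : ℝ, s < -(d : ℝ) / 2 → s' < -(d : ℝ) / 2 →
      ∀ μ μ' : Ω → 𝓢'(ImaginaryChaos.Space d, ℂ),
        ImaginaryChaos.ConvergesInProbability P s (ImaginaryChaos.chaosApprox P U β Xn) μ →
        ImaginaryChaos.ConvergesInProbability P s' (ImaginaryChaos.chaosApprox P U β Xn') μ' →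
        ∀ᵐ ω ∂P, μ ω = μ' ω) := by
  have hd : 0 < d := by
    rcases d.eq_zero_or_pos with rfl | h
    · simp at hβ
      linarith
    · exact h
  have hβ2 : β ^ 2 < d := (Real.lt_sqrt hβ0.le).1 hβ
  have hU := hC.isOpen.measurableSet
  refine ⟨?_, fun Xn' hXn' hint' hmix s s' _ _ μ μ' hμ hμ' =>
    ImaginaryChaos.IsStandardApproximation.ae_eq_of_mixed hC hXn hd hβ0 hβ2 hint hXn' hint' hmix
      hμ hμ'⟩
  obtain ⟨μ, hμ⟩ := ImaginaryChaos.IsStandardApproximation.exists_limit hC hXn hd hβ2 hint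
  have hμ₀ := hμ (-(d : ℝ) / 2 - 1) (by linarith)
  exact ⟨μ, hμ, ImaginaryChaos.IsStandardApproximation.not_ae_eq_const hC hXn hd hβ2 hint hβ0 hμ₀,
    hXn.dsupport_subset hU hint hμ₀⟩
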